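/- For each sample size $n$ let $X_1,\dots,X_n$ be i.i.d. random vectors in $\mathbb{R}^d$, $d=d^{(n)}\to\infty$, from a canonical exponential family with density $h(x;\theta)=\exp(x'\theta-\psi(\theta))$ with respect to a measure $\nu$ on $\mathbb{R}^d$, $\theta\in\Theta$, where $\Theta\subset\mathbb{R}^d$ is open and $\psi(\theta)=\ln\int e^{x'\theta}\,d\nu(x)<\infty$ on $\Theta$, at the true parameter $\theta_0\in\Theta$. (The objects $d,\nu,\Theta,\theta_0,\pi$ all depend on $n$.) Let $\mu=\psi'(\theta_0)$ be the mean of an observation and suppose, after reparametrization, that its covariance is $J=\psi''(\theta_0)=I$. Assume that for every $c>0$ the ball $\{\|\theta-\theta_0\|^2\le cd/n\}$ lies in $\Theta$ for all large $n$, and that there are constants $c_0,p>0$ such that: (Moments) for all $c>0$ and $n\ge 1$ the quantities $\sup E_\theta|\eta'(X_1-\mu)|^3$ and $\sup E_\theta|\eta'(X_1-\mu)|^4$, over $\|\eta\|=1$ and $\theta\in\Theta$ with $\|\theta-\theta_0\|^2\le cd/n$, are less than $c_0+c^p$; (Prior) the prior density $\pi$ on $\Theta$ is proper, lower semicontinuous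 and positive at $\theta_0$; $\sup_{\theta\in\Theta}\ln[\pi(\theta)/\pi(\theta_0)]\le A\,d$ for a constant $A$ and all large $n$; and, for some $V$ with $V(c)<c_0+c^p$ for all $c>0$, one has $\pi(\theta)>0$ and $|\ln\pi(\theta)-\ln\pi(\theta_0)|\le V(c)\sqrt d\,\|\theta-\theta_0\|$ for all $c>0$, $n\ge1$ and $\theta\in\Theta$ with $\|\theta-\theta_0\|^2\le cd/n$; (Rate) $d^3/n\to0$. Let $\bar X=\frac1n\sum_i X_i$, $s=\sqrt n(\bar X-\mu)$, $\Lambda=\sqrt n(\Theta-\theta_0)-s$, and for $\lambda\in\Lambda$ $$\ell(\lambda)=\exp\Big(\sqrt n\,\bar X'\lambda-n\psi\big(\theta_0+\tfrac{\lambda+s}{\sqrt n}\big)+n\psi\big(\theta_0+\tfrac{s}{\sqrt n}\big)\Big)\,\frac{\pi(\theta_0+(\lambda+s)/\sqrt n)}{\pi(\theta_0+s/\sqrt n)},\qquad f(\lambda)=\frac{\ell(\lambda)}{\int_\Lambda\ell}.$$ Let $\phi$ be the density of $N(0,I_d)$. Then there is a constant $C>1$ such that, with $K=B(0,\|K\|)$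 the closed ball of radius $\|K\|=C\sqrt d$: (C.1) $s$ has mean zero and variance with bounded eigenvalues, $K\subset\Lambda$ with probability tending to one, $\int_K f\ge 1-o_p(1)$ and $\int_K\phi\ge 1-o(1)$; (C.2) there are random $\epsilon_1,\epsilon_2>0$ such that with probability tending to one $\ell$ is lower semicontinuous on $\Lambda$ and, for all $\lambda\in K$, $\ell(\lambda)>0$ and $|\ln\ell(\lambda)+\tfrac12\|\lambda\|^2|\le\epsilon_1+\epsilon_2\|\lambda\|^2/2$; (C.3) $\epsilon_1=o_p(1)$ and $\epsilon_2\|K\|^2=o_p(1)$. Moreover, the posterior is asymptotically normal: $\int_\Lambda|f(\lambda)-\phi(\lambda)|\,d\lambda=o_p(1)$. Finally, let $Q(A)=\int_{A\cap K}f/\int_K f$, and let $Q_t$ be the law after $t$ steps, from an initial law $Q_0$, of the Metropolis walk that from $u\in K$ proposes $y\sim N(u,\sigma^2I)$, moves to $y$ with probability $\min\{f(y)/f(u),1\}$ if $y\in K$, and otherwise stays at $u$, where $\sigma=\min\{\frac1{4\sqrt d\,\|K\|},\frac{\|K\|}{120d}\}$. There is a constant $B>0$ such that with probability tending to one both of the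 following hold, where $\|\mu-\mu'\|_{TV}=\sup_A|\mu(A)-\mu'(A)|$. (Post-burn-in) For all $M\ge1$, $\varepsilon\in(0,1)$ and all probability measures $Q_0$ that are $M$-warm ($Q_0(A)\le M\,Q(A)$ for all measurable $A$), $\|Q_t-Q\|_{TV}\le\varepsilon$ for all $t\ge B\,d^2\ln(M/\varepsilon)$; thus, for fixed $M$ and $\varepsilon$, $O_p(d^2)$ steps suffice. (Including burn-in) For all $u\in K$ and $\varepsilon\in(0,1)$, if $Q_0$ is the law of one step from $u$ conditional on a proper (accepted) move, then $\|Q_t-Q\|_{TV}\le\varepsilon$ for all $t\ge B\,(d^3\ln d+d^2\ln(1/\varepsilon))$. -/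

import Mathlib

open MeasureTheory ProbabilityTheory Filter Topology

noncomputable section

/-- Euclidean space of dimension `d`, with the Euclidean norm. -/
abbrev Vec (d : ℕ) : Type := EuclideanSpace ℝ (Fin d)

/-! ## Stochastic orders along a sequence of probability spaces -/

/-- The events `A n` have probability tending to one: the (outer) probability of the complement
tends to zero. -/
def WithProbTendingToOne {Ω : ℕ → Type*} [∀ n, MeasurableSpace (Ω n)] (P : ∀ n, Measure (Ω n))
    (A : ∀ n, Set (Ω n)) : Prop :=
  Tendsto (fun n => P n (A n)ᶜ) atTop (𝓝 0)

/-- `Y n = o_p(1)`: convergence to zero in probability. -/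
def IsLittleOP {Ω : ℕ → Type*} [∀ n, MeasurableSpace (Ω n)] (P : ∀ n, Measure (Ω n))
    (Y : ∀ n, Ω n → ℝ) : Prop :=
  ∀ δ : ℝ, 0 < δ → WithProbTendingToOne P (fun n => {ω | |Y n ω| < δ})

/-! ## Quasi-posteriors, the normal density, and the CLT conditions -/

/-- The (quasi-)posterior density `f = ℓ / ∫_Λ ℓ` on the parameter space `Λ` (zero off `Λ`). -/
def posteriorDensity {d : ℕ} (Λ : Set (Vec d)) (l : Vec d → ℝ) (x : Vec d) : ℝ :=
  Λ.indicator l x / ∫ y in Λ, l y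

/-- The density of `N(0, J⁻¹)`:
`(2π)^(-d/2) det(J⁻¹)^(-1/2) exp(-⟨x, J x⟩ / 2)`. -/
def normalDensity {d : ℕ} (J : Vec d →L[ℝ] Vec d) (x : Vec d) : ℝ :=
  Real.sqrt (LinearMap.det (J : Vec d →ₗ[ℝ] Vec d)) / (2 * Real.pi) ^ ((d : ℝ) / 2) *
    Real.exp (-(inner ℝ x (J x)) / 2)

/-- `‖K‖_J² = sup {⟨v, J v⟩ : v ∈ K}` for the closed ball `K = B(0, r)`. -/
def ballNormSq {d : ℕ} (J : Vec d →L[ℝ] Vec d) (r : ℝ) : ℝ :=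
  sSup ((fun v : Vec d => inner ℝ v (J v)) '' Metric.closedBall 0 r)

/-- First CLT condition. The vector `s` has mean zero and a variance with bounded eigenvalues; the
closed ball `K = B(0, r)` lies in the local parameter space, and it carries asymptotically the
whole mass of the posterior density and of the normal density. -/
structure ConditionC1 {Ω : ℕ → Type*} [∀ n, MeasurableSpace (Ω n)] (P : ∀ n, Measure (Ω n))
    {d : ℕ → ℕ} (s : ∀ n, Ω n → Vec (d n)) (Λ : ∀ n, Ω n → Set (Vec (d n)))
    (l : ∀ n, Ω n → Vec (d n) → ℝ) (J : ∀ n, Vec (d n) →L[ℝ] Vec (d n)) (r : ℕ → ℝ) : Prop where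
  square_integrable : ∀ᶠ n in atTop, MemLp (s n) 2 (P n)
  mean_zero : ∀ᶠ n in atTop, ∫ ω, s n ω ∂(P n) = 0
  variance_bounded : ∃ b : ℝ, ∀ᶠ n in atTop, ∀ v : Vec (d n),
    ∫ ω, (inner ℝ v (s n ω)) ^ 2 ∂(P n) ≤ b * ‖v‖ ^ 2
  ball_subset : WithProbTendingToOne P (fun n => {ω | Metric.closedBall 0 (r n) ⊆ Λ n ω})
  posterior_mass : ∀ δ : ℝ, 0 < δ → WithProbTendingToOne P (fun n =>
    {ω | 1 - δ ≤ ∫ x in Metric.closedBall 0 (r n), posteriorDensity (Λ n ω) (l n ω) x})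
  normal_mass : ∀ δ : ℝ, 0 < δ → ∀ᶠ n in atTop,
    1 - δ ≤ ∫ x in Metric.closedBall 0 (r n), normalDensity (J n) x

/-- Second CLT condition. `J` is symmetric with eigenvalues bounded away from zero and from above,
and (with probability tending to one) the localized likelihood `l` is lower semicontinuous on the
local parameter space and, on the ball `K = B(0, r)`, is positive with
`|ln l(x) + ⟨x, J x⟩ / 2| ≤ ε₁ + ε₂ ⟨x, J x⟩ / 2`. -/
structure ConditionC2 {Ω : ℕ → Type*} [∀ n, MeasurableSpace (Ω n)] (P : ∀ n, Measure (Ω n))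
    {d : ℕ → ℕ} (Λ : ∀ n, Ω n → Set (Vec (d n))) (l : ∀ n, Ω n → Vec (d n) → ℝ)
    (J : ∀ n, Vec (d n) →L[ℝ] Vec (d n)) (r : ℕ → ℝ) (ε₁ ε₂ : ∀ n, Ω n → ℝ) : Prop where
  J_symmetric : ∀ n, ∀ u v : Vec (d n), inner ℝ (J n u) v = inner ℝ u (J n v)
  J_eigenvalues : ∃ a b : ℝ, 0 < a ∧ ∀ n, ∀ v : Vec (d n),
    a * ‖v‖ ^ 2 ≤ inner ℝ v (J n v) ∧ inner ℝ v (J n v) ≤ b * ‖v‖ ^ 2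
  errors_measurable : ∀ n, Measurable (ε₁ n) ∧ Measurable (ε₂ n)
  errors_pos : ∀ n ω, 0 < ε₁ n ω ∧ 0 < ε₂ n ω
  lower_semicontinuous :
    WithProbTendingToOne P (fun n => {ω | LowerSemicontinuousOn (l n ω) (Λ n ω)})
  quadratic_approx : WithProbTendingToOne P (fun n =>
    {ω | ∀ x ∈ Metric.closedBall (0 : Vec (d n)) (r n), 0 < l n ω x ∧
      |Real.log (l n ω x) - (-(1 / 2) * inner ℝ x (J n x))|
        ≤ ε₁ n ω + ε₂ n ω * inner ℝ x (J n x) / 2})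

/-- Third CLT condition: `ε₁ = o_p(1)` and `ε₂ ‖K‖_J² = o_p(1)`. -/
structure ConditionC3 {Ω : ℕ → Type*} [∀ n, MeasurableSpace (Ω n)] (P : ∀ n, Measure (Ω n))
    {d : ℕ → ℕ} (J : ∀ n, Vec (d n) →L[ℝ] Vec (d n)) (r : ℕ → ℝ)
    (ε₁ ε₂ : ∀ n, Ω n → ℝ) : Prop where
  eps_one : IsLittleOP P ε₁
  eps_two : IsLittleOP P (fun n ω => ε₂ n ω * ballNormSq (J n) (r n))

/-- The three CLT conditions together, for the ball `K = B(0, r)`. -/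
def CLTConditions {Ω : ℕ → Type*} [∀ n, MeasurableSpace (Ω n)] (P : ∀ n, Measure (Ω n))
    {d : ℕ → ℕ} (s : ∀ n, Ω n → Vec (d n)) (Λ : ∀ n, Ω n → Set (Vec (d n)))
    (l : ∀ n, Ω n → Vec (d n) → ℝ) (J : ∀ n, Vec (d n) →L[ℝ] Vec (d n)) (r : ℕ → ℝ) : Prop :=
  ConditionC1 P s Λ l J r ∧
    ∃ ε₁ ε₂ : ∀ n, Ω n → ℝ, ConditionC2 P Λ l J r ε₁ ε₂ ∧ ConditionC3 P J r ε₁ ε₂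

/-- Asymptotic normality in total variation: `∫_Λ |f - φ| = o_p(1)`. -/
def AsymptoticallyNormal {Ω : ℕ → Type*} [∀ n, MeasurableSpace (Ω n)] (P : ∀ n, Measure (Ω n))
    {d : ℕ → ℕ} (Λ : ∀ n, Ω n → Set (Vec (d n))) (l : ∀ n, Ω n → Vec (d n) → ℝ)
    (J : ∀ n, Vec (d n) →L[ℝ] Vec (d n)) : Prop :=
  ∀ δ : ℝ, 0 < δ → WithProbTendingToOne P (fun n =>
    {ω | ∫⁻ x in Λ n ω, ENNReal.ofReal |posteriorDensity (Λ n ω) (l n ω) x - normalDensity (J n) x|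
      < ENNReal.ofReal δ})

/-! ## The Gaussian Metropolis random walk on the ball `K = B(0, r)` -/

/-- The probability measure `Q(A) = ∫_{A ∩ K} f / ∫_K f`, with `K = B(0, r)`. -/
def targetMeasure {d : ℕ} (f : Vec d → ℝ) (r : ℝ) : Measure (Vec d) :=
  cond (volume.withDensity (fun x => ENNReal.ofReal (f x))) (Metric.closedBall 0 r)

/-- The density at `x` of the Gaussian proposal `N(u, σ² I)`. -/
def gaussianProposal {d : ℕ} (σ : ℝ) (u x : Vec d) : ℝ :=
  (2 * Real.pi * σ ^ 2) ^ (-(d : ℝ) / 2) * Real.exp (-‖x - u‖ ^ 2 / (2 * σ ^ 2))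

/-- The sub-probability law of an accepted (proper) move from `u`:
`A ↦ ∫_{K ∩ A} min {f(x) / f(u), 1} q(x | u) dx`. -/
def properMove {d : ℕ} (f : Vec d → ℝ) (r σ : ℝ) (u : Vec d) : Measure (Vec d) :=
  (volume.restrict (Metric.closedBall 0 r)).withDensity
    (fun x => ENNReal.ofReal (min (f x / f u) 1 * gaussianProposal σ u x))

/-- The probability `p_u` of a proper move from `u`. -/
def properMoveProb {d : ℕ} (f : Vec d → ℝ) (r σ : ℝ) (u : Vec d) : ENNReal :=
  properMove f r σ u Set.univ

/-- The one-step law `P_u` of the Metropolis walk: a proper move, or a stay at `u` with the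
remaining probability `1 - p_u`. -/
def metropolisStep {d : ℕ} (f : Vec d → ℝ) (r σ : ℝ) (u : Vec d) : Measure (Vec d) :=
  properMove f r σ u + (1 - properMoveProb f r σ u) • Measure.dirac u

/-- The law `Q_t` after `t` steps from the law `Q₀`: `Q_{t+1}(A) = ∫ P_u(A) dQ_t(u)`. -/
def walkLaw {d : ℕ} (f : Vec d → ℝ) (r σ : ℝ) (Q₀ : Measure (Vec d)) (t : ℕ) :
    Measure (Vec d) :=
  (fun μ : Measure (Vec d) => μ.bind (metropolisStep f r σ))^[t] Q₀

/-- The one-step law from `u` conditional on a proper move. -/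
def properStart {d : ℕ} (f : Vec d → ℝ) (r σ : ℝ) (u : Vec d) : Measure (Vec d) :=
  (properMoveProb f r σ u)⁻¹ • properMove f r σ u

/-- The standard deviation of the proposal, `σ = min {1 / (4 √d L), ‖K‖ / (120 d)}`, where
`L = sup_{x ∈ K} ‖J x‖ = ‖J‖ r` and `‖K‖ = r`. -/
def walkScale {d : ℕ} (J : Vec d →L[ℝ] Vec d) (r : ℝ) : ℝ :=
  min (1 / (4 * Real.sqrt d * (‖J‖ * r))) (r / (120 * d))

/-- `‖μ - ν‖_TV ≤ ε`, where `‖μ - ν‖_TV = sup_A |μ(A) - ν(A)|`. -/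
def TVLe {d : ℕ} (μ ν : Measure (Vec d)) (ε : ℝ) : Prop :=
  ∀ A : Set (Vec d), MeasurableSet A → |μ.real A - ν.real A| ≤ ε

/-- `Q₀` is `M`-warm with respect to `Q`. -/
def IsWarm {d : ℕ} (M : ℝ) (Q₀ Q : Measure (Vec d)) : Prop :=
  ∀ A : Set (Vec d), MeasurableSet A → Q₀ A ≤ ENNReal.ofReal M * Q A

/-- From every `M`-warm start the walk is within `ε` of its target after any number
`t ≥ B d² ln (M / ε)` of steps. -/
def MixesFromWarmStart {d : ℕ} (f : Vec d → ℝ) (r σ B : ℝ) : Prop :=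
  ∀ M ε : ℝ, 1 ≤ M → 0 < ε → ε < 1 →
    ∀ Q₀ : Measure (Vec d), IsProbabilityMeasure Q₀ → IsWarm M Q₀ (targetMeasure f r) →
      ∀ t : ℕ, B * (d : ℝ) ^ 2 * Real.log (M / ε) ≤ t →
        TVLe (walkLaw f r σ Q₀ t) (targetMeasure f r) ε

/-- From a first proper move out of any point of `K` the walk is within `ε` of its target after
any number `t ≥ B (d³ ln d + d² ln (1 / ε))` of steps. -/
def MixesFromAnyPoint {d : ℕ} (f : Vec d → ℝ) (r σ B : ℝ) : Prop :=
  ∀ ε : ℝ, 0 < ε → ε < 1 → ∀ u ∈ Metric.closedBall (0 : Vec d) r,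
    ∀ t : ℕ, B * ((d : ℝ) ^ 3 * Real.log d + (d : ℝ) ^ 2 * Real.log (1 / ε)) ≤ t →
      TVLe (walkLaw f r σ (properStart f r σ u) t) (targetMeasure f r) ε

/-! ## Canonical exponential families with a prior -/

/-- A `d`-dimensional canonical exponential family with a prior: the measure `base` that dominates
the family, the parameter set, the true parameter, and the prior density. -/
structure ExpModel (d : ℕ) where
  base : Measure (Vec d)
  paramSet : Set (Vec d)
  trueParam : Vec d
  prior : Vec d → ℝ

namespace ExpModel

variable {d : ℕ}

/-- `ψ(θ) = ln ∫ exp(x'θ) dν(x)`. -/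
def logPartition (m : ExpModel d) (θ : Vec d) : ℝ :=
  Real.log (∫ x, Real.exp (inner ℝ x θ) ∂m.base)

/-- The density `h(x; θ) = exp(x'θ - ψ(θ))` with respect to `base`. -/
def density (m : ExpModel d) (θ x : Vec d) : ℝ :=
  Real.exp (inner ℝ x θ - m.logPartition θ)

/-- The law of one observation under `θ`. -/
def law (m : ExpModel d) (θ : Vec d) : Measure (Vec d) :=
  m.base.withDensity (fun x => ENNReal.ofReal (m.density θ x))

/-- The mean `μ = ψ'(θ₀)` of an observation under the true parameter. -/
def mean (m : ExpModel d) : Vec d := ∫ x, x ∂(m.law m.trueParam)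

/-- `B_{1n}(c)` for `k = 3` and `B_{2n}(c)` for `k = 4`: the supremum of `E_θ |η'(x - μ)|^k` over
unit vectors `η` and parameters with `‖θ - θ₀‖² ≤ c d / n`. -/
def momentSup (m : ExpModel d) (n k : ℕ) (c : ℝ) : ENNReal :=
  ⨆ θ ∈ {θ : Vec d | θ ∈ m.paramSet ∧ ‖θ - m.trueParam‖ ^ 2 ≤ c * d / n},
    ⨆ η ∈ Metric.sphere (0 : Vec d) 1,
      ∫⁻ x, ENNReal.ofReal (|inner ℝ η (x - m.mean)| ^ k) ∂(m.law θ)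

/-- The model is a canonical exponential family on an open parameter set that contains the true
parameter, and the covariance of an observation under the true parameter (the Hessian of `ψ`
at that parameter) is the identity. -/
structure IsCanonical (m : ExpModel d) : Prop where
  isOpen : IsOpen m.paramSet
  base_ne_zero : m.base ≠ 0
  integrable : ∀ θ ∈ m.paramSet, Integrable (fun x => Real.exp (inner ℝ x θ)) m.base
  trueParam_mem : m.trueParam ∈ m.paramSet
  covariance : ∀ u v : Vec d,
    ∫ x, inner ℝ u (x - m.mean) * inner ℝ v (x - m.mean) ∂(m.law m.trueParam) = inner ℝ u v

/-- `X 0, …, X (n - 1)` are iid observations from the model at the true parameter. -/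
structure IsSample (m : ExpModel d) {n : ℕ} {Ω : Type*} [MeasurableSpace Ω] (P : Measure Ω)
    (X : Fin n → Ω → Vec d) : Prop where
  measurable : ∀ i, Measurable (X i)
  independent : iIndepFun X P
  identically : ∀ i, P.map (X i) = m.law m.trueParam

/-- The prior is a proper density on the parameter set, lower semicontinuous there. -/
structure IsProperPrior (m : ExpModel d) : Prop where
  nonneg : ∀ θ ∈ m.paramSet, 0 ≤ m.prior θ
  integrable : IntegrableOn m.prior m.paramSet
  total_mass : ∫ θ in m.paramSet, m.prior θ = 1
  lower_semicontinuous : LowerSemicontinuousOn m.prior m.paramSet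

/-- The empirical mean of the data. -/
def sampleMean {n : ℕ} (X : Fin n → Vec d) : Vec d := (n : ℝ)⁻¹ • ∑ i, X i

/-- `s = √n (X̄ - μ)`. -/
def score (m : ExpModel d) {n : ℕ} (X : Fin n → Vec d) : Vec d :=
  Real.sqrt n • (sampleMean X - m.mean)

/-- The parameter `θ = θ₀ + (x + s) / √n` with local parameter `x = √n (θ - θ₀) - s`. -/
def toParam (m : ExpModel d) {n : ℕ} (X : Fin n → Vec d) (x : Vec d) : Vec d :=
  m.trueParam + (Real.sqrt n)⁻¹ • (x + m.score X)

/-- The local parameter space `Λ = √n (Θ - θ₀) - s`. -/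
def localSpace (m : ExpModel d) {n : ℕ} (X : Fin n → Vec d) : Set (Vec d) :=
  {x | m.toParam X x ∈ m.paramSet}

/-- The localized likelihood times the localized prior:
`exp(√n X̄'x - n ψ(θ₀ + (x + s)/√n) + n ψ(θ₀ + s/√n)) π(θ₀ + (x + s)/√n) / π(θ₀ + s/√n)`. -/
def localLikelihood (m : ExpModel d) {n : ℕ} (X : Fin n → Vec d) (x : Vec d) : ℝ :=
  Real.exp (Real.sqrt n * inner ℝ (sampleMean X) x - n * m.logPartition (m.toParam X x)
      + n * m.logPartition (m.toParam X 0))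
    * (m.prior (m.toParam X x) / m.prior (m.toParam X 0))

end ExpModel

/-- Moment condition on a sequence of models: `B_{1n}(c) < c₀ + c^p` and `B_{2n}(c) < c₀ + c^p` for
all `c > 0` and all `n ≥ 1`. -/
def MomentCondition {d : ℕ → ℕ} (m : ∀ n, ExpModel (d n)) (c₀ p : ℝ) : Prop :=
  ∀ c : ℝ, 0 < c → ∀ n : ℕ, 1 ≤ n →
    (m n).momentSup n 3 c < ENNReal.ofReal (c₀ + c ^ p) ∧
    (m n).momentSup n 4 c < ENNReal.ofReal (c₀ + c ^ p)

/-- Condition on a sequence of priors: each is a proper density, positive at the true parameter;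
`sup_θ ln (π(θ) / π(θ₀)) = O(d)`; and
`|ln π(θ) - ln π(θ₀)| ≤ V(c) √d ‖θ - θ₀‖` when `‖θ - θ₀‖² ≤ c d / n`, with `V(c) < c₀ + c^p`. -/
structure PriorCondition {d : ℕ → ℕ} (m : ∀ n, ExpModel (d n)) (c₀ p : ℝ) : Prop where
  proper : ∀ n : ℕ, 1 ≤ n → (m n).IsProperPrior
  pos_at_true : ∀ n : ℕ, 1 ≤ n → 0 < (m n).prior (m n).trueParam
  upper : ∃ A : ℝ, ∀ᶠ n : ℕ in atTop, ∀ θ ∈ (m n).paramSet,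
    (m n).prior θ ≤ (m n).prior (m n).trueParam * Real.exp (A * d n)
  lipschitz : ∃ V : ℝ → ℝ, (∀ c : ℝ, 0 < c → V c < c₀ + c ^ p) ∧
    ∀ c : ℝ, 0 < c → ∀ n : ℕ, 1 ≤ n → ∀ θ ∈ (m n).paramSet,
      ‖θ - (m n).trueParam‖ ^ 2 ≤ c * d n / n → 0 < (m n).prior θ ∧
        |Real.log ((m n).prior θ) - Real.log ((m n).prior (m n).trueParam)|
          ≤ V c * Real.sqrt (d n) * ‖θ - (m n).trueParam‖

/-- For every `c > 0` the neighbourhood `‖θ - θ₀‖² ≤ c d / n` of the true parameter lies in the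
parameter set for all large `n`. -/
def NeighbourhoodCondition {d : ℕ → ℕ} (m : ∀ n, ExpModel (d n)) : Prop :=
  ∀ c : ℝ, 0 < c → ∀ᶠ n : ℕ in atTop,
    {θ : Vec (d n) | ‖θ - (m n).trueParam‖ ^ 2 ≤ c * d n / n} ⊆ (m n).paramSet

end

/-!
The posterior of a canonical exponential family is close to normal when `d³ / n → 0`, and a density
close to a normal one on a ball of radius of order `√d` is sampled quickly by a Metropolis walk. The
two halves of the argument meet in `LocallyGaussian` and `NearGaussian`.

*Posterior.* In the local parameter `w = √n (θ - θ₀)` the negative log-likelihood ratio, centred by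
its linear part, is `Ψ(w)` (`ExpModel.cumulant`). Along a line it is `n` times a cumulant generating
function, whose third derivative is controlled by the third moments of the tilted laws, so that
`|Ψ(w) - ‖w‖² / 2| = O(‖w‖³ / √n)` (`abs_cgf_sub_sq_le`, `ExpModel.abs_cumulant_sub_le`). For
`‖w‖ = O(√d)` this is `O(√(d³ / n))`, and the Lipschitz condition bounds the variation of the log
prior there by the same order. Since `E ‖s‖² = d`, the score is `O(√d)` outside an event of small
probability (`ExpModel.IsSample.prob_score_large_le`), and the expansion holds on `B(0, C √d)`. Off
this ball the convexity of `ψ` makes the log-likelihood fall below `-(3 C / 8) √d ‖x‖`; for `C`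
large in terms of the growth constant `A` of the prior, the remaining mass is at most `exp (1 - d)`
(`ExpModel.IsRegular.lintegral_tail_le`). The mass of the ball and the total variation distance to
the normal law follow by integration.

*Metropolis walk.* The walk is reversible, and positive, because `min (f(x), f(y))` and the Gaussian
kernel are both positive definite (`metropolis_positive`). For such a chain a bound on the variance
by the mean squared increment over one step (a spectral gap) contracts the `L²` norm, hence the
distance to stationarity from a warm start (`abs_iterate_bind_sub_le`). For the standard normal
density on all of space the variance bound comes from rotating `x` into an independent copy `y`
in `N` equal angles: this gives the factor `N²`, with `N` of order `1 / σ` (`gaussian_poincare`).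
Inversion in the sphere folds the exterior of the ball into the ball without increasing distances,
and for a radius at least `√(2 d)` the loss in the Gaussian density pays for the Jacobian; this
transfers the bound to the ball with the rejection at its boundary (`ball_poincare`). With `σ` of
order `1 / d` the gap is of order `1 / d²`, uniformly over densities within a factor two of a
multiple of the normal one. A proper move out of any point has a law that is `exp (O(d ln d))`-warm
(`NearGaussian.isWarm_properStart`, `log_warmth_le`), which accounts for the burn-in.

To turn statements for each fixed error and each fixed bound on `‖s‖² / d` into convergence in
probability with a single error sequence, `withProbTendingToOne_of_tight` and
`exists_vanishing_error` are used.
-/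

noncomputable section

/-! ### Reversible positive Markov kernels with a spectral gap -/

section Reversible

variable {E : Type*} [MeasurableSpace E]

/-- Bounded measurable real functions. -/
def BddMeas (g : E → ℝ) : Prop := Measurable g ∧ ∃ c : ℝ, ∀ x, |g x| ≤ c

lemma BddMeas.integrable {g : E → ℝ} (hg : BddMeas g) (μ : Measure E) [IsFiniteMeasure μ] :
    Integrable g μ := by
  obtain ⟨hm, c, hc⟩ := hg
  exact Integrable.of_bound hm.aestronglyMeasurable c (ae_of_all _ hc)

lemma BddMeas.mul {g h : E → ℝ} (hg : BddMeas g) (hh : BddMeas h) :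
    BddMeas (fun x => g x * h x) := by
  obtain ⟨hm, c, hc⟩ := hg
  obtain ⟨hm', c', hc'⟩ := hh
  refine ⟨hm.mul hm', c * c', fun x => ?_⟩
  rw [abs_mul]
  exact mul_le_mul (hc x) (hc' x) (abs_nonneg _) ((abs_nonneg _).trans (hc x))

lemma BddMeas.add {g h : E → ℝ} (hg : BddMeas g) (hh : BddMeas h) :
    BddMeas (fun x => g x + h x) := by
  obtain ⟨hm, c, hc⟩ := hg
  obtain ⟨hm', c', hc'⟩ := hh
  exact ⟨hm.add hm', c + c', fun x => (abs_add_le _ _).trans (add_le_add (hc x) (hc' x))⟩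

lemma BddMeas.const_mul {g : E → ℝ} (hg : BddMeas g) (a : ℝ) : BddMeas (fun x => a * g x) :=
  BddMeas.mul ⟨measurable_const, |a|, fun _ => le_rfl⟩ hg

lemma BddMeas.comp {F : Type*} [MeasurableSpace F] {g : E → ℝ} (hg : BddMeas g) {T : F → E}
    (hT : Measurable T) : BddMeas (fun x => g (T x)) := by
  obtain ⟨hm, c, hc⟩ := hg
  exact ⟨hm.comp hT, c, fun x => hc _⟩

/-- The Markov operator `g ↦ ∫ g(y) κ(·, dy)`. -/
def markovOp (κ : Kernel E E) (g : E → ℝ) (x : E) : ℝ := ∫ y, g y ∂(κ x)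

lemma BddMeas.markovOp {κ : Kernel E E} [IsMarkovKernel κ] {g : E → ℝ} (hg : BddMeas g) :
    BddMeas (markovOp κ g) := by
  obtain ⟨hm, c, hc⟩ := hg
  refine ⟨hm.stronglyMeasurable.integral_kernel.measurable, c, fun x => ?_⟩
  have := norm_integral_le_of_norm_le_const (μ := κ x) (f := g) (C := c) (ae_of_all _ hc)
  simpa [_root_.markovOp] using this

variable {κ : Kernel E E} [IsMarkovKernel κ] {Q : Measure E} [IsProbabilityMeasure Q]

lemma integral_mul_markovOp {g h : E → ℝ} (hg : BddMeas g) (hh : BddMeas h) :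
    ∫ z, g z.1 * h z.2 ∂(Q ⊗ₘ κ) = ∫ x, g x * markovOp κ h x ∂Q := by
  rw [Measure.integral_compProd]
  · simp_rw [integral_const_mul]
    rfl
  · exact ((hg.comp measurable_fst).mul (hh.comp measurable_snd)).integrable _

/-- Reversibility makes the Markov operator self-adjoint. -/
lemma integral_symm (hsym : (Q ⊗ₘ κ).map Prod.swap = Q ⊗ₘ κ) {g h : E → ℝ}
    (hg : BddMeas g) (hh : BddMeas h) :
    ∫ x, g x * markovOp κ h x ∂Q = ∫ x, h x * markovOp κ g x ∂Q := by
  rw [← integral_mul_markovOp hg hh, ← integral_mul_markovOp hh hg]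
  conv_lhs => rw [← hsym]
  rw [integral_map measurable_swap.aemeasurable]
  · simp [mul_comm]
  · exact ((hg.comp measurable_fst).mul (hh.comp measurable_snd)).1.aestronglyMeasurable

lemma integral_markovOp (hsym : (Q ⊗ₘ κ).map Prod.swap = Q ⊗ₘ κ) {g : E → ℝ}
    (hg : BddMeas g) : ∫ x, markovOp κ g x ∂Q = ∫ x, g x ∂Q := by
  have h1 : BddMeas (fun _ : E => (1 : ℝ)) := ⟨measurable_const, 1, by simp⟩
  have := integral_symm hsym h1 hg
  simpa [markovOp] using this

/-- Duality between the evolution of laws and the Markov operator. -/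
lemma integral_iterate_bind {Q₀ : Measure E} [IsProbabilityMeasure Q₀] (t : ℕ) {g : E → ℝ}
    (hg : BddMeas g) :
    ∫ x, g x ∂((fun μ : Measure E => μ.bind κ)^[t] Q₀) = ∫ x, (markovOp κ)^[t] g x ∂Q₀ := by
  induction t generalizing g with
  | zero => rfl
  | succ t ih =>
    rw [Function.iterate_succ_apply', Function.iterate_succ_apply, ← ih hg.markovOp]
    have : IsProbabilityMeasure ((fun μ : Measure E => μ.bind κ)^[t] Q₀) := by
      clear ih
      induction t with
      | zero => simpa
      | succ t ih =>
        rw [Function.iterate_succ_apply']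
        infer_instance
    have h := Kernel.integral_comp (κ := Kernel.const Unit
      ((fun μ : Measure E => μ.bind κ)^[t] Q₀)) (η := κ) (a := ()) (f := g)
      (by rw [Kernel.comp_const]; exact hg.integrable _)
    rw [Kernel.comp_const] at h
    exact h

lemma BddMeas.iterate_markovOp {g : E → ℝ} (hg : BddMeas g) (t : ℕ) :
    BddMeas ((_root_.markovOp κ)^[t] g) := by
  induction t generalizing g with
  | zero => exact hg
  | succ t ih =>
    rw [Function.iterate_succ_apply]
    exact ih hg.markovOp

/-- For a reversible positive kernel the spectral gap contracts the `L²` norm: with the form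
`B(g, h) = ⟨g, P h⟩`, the Cauchy-Schwarz inequality gives
`‖P g‖⁴ = B(g, P g)² ≤ B(g, g) B(P g, P g)`. -/
lemma integral_sq_markovOp_le (hsym : (Q ⊗ₘ κ).map Prod.swap = Q ⊗ₘ κ)
    (hpos : ∀ g : E → ℝ, BddMeas g → 0 ≤ ∫ x, g x * markovOp κ g x ∂Q) {θ : ℝ} (hθ : 0 ≤ θ)
    (hgap : ∀ g : E → ℝ, BddMeas g → ∫ x, g x ∂Q = 0 →
      ∫ x, g x * markovOp κ g x ∂Q ≤ θ * ∫ x, g x ^ 2 ∂Q)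
    {g : E → ℝ} (hg : BddMeas g) (h0 : ∫ x, g x ∂Q = 0) :
    ∫ x, markovOp κ g x ^ 2 ∂Q ≤ θ ^ 2 * ∫ x, g x ^ 2 ∂Q := by
  set h := markovOp κ g with hh
  have hhb : BddMeas h := hg.markovOp
  have hh0 : ∫ x, h x ∂Q = 0 := by rw [hh, integral_markovOp hsym hg, h0]
  have hBgg := hpos g hg
  have hBhh := hpos h hhb
  have hgg := hgap g hg h0
  have hhh := hgap h hhb hh0
  have hcross : ∫ x, g x * markovOp κ h x ∂Q = ∫ x, h x ^ 2 ∂Q := by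
    rw [integral_symm hsym hg hhb]
    congr 1; ext x; ring
  have hquad : ∀ t : ℝ, 0 ≤ (∫ x, h x * markovOp κ h x ∂Q) * (t * t)
      + (2 * ∫ x, h x ^ 2 ∂Q) * t + ∫ x, g x * markovOp κ g x ∂Q := by
    intro t
    have hb : BddMeas (fun x => g x + t * h x) := hg.add (hhb.const_mul t)
    have key := hpos _ hb
    have hop : markovOp κ (fun x => g x + t * h x)
        = fun x => markovOp κ g x + t * markovOp κ h x := by
      ext x
      simp only [markovOp]
      rw [integral_add (hg.integrable _) ((hhb.const_mul t).integrable _), integral_const_mul]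
    have hexp : ∫ x, (g x + t * h x) * markovOp κ (fun x => g x + t * h x) x ∂Q
        = ∫ x, g x * markovOp κ g x ∂Q + t * ∫ x, g x * markovOp κ h x ∂Q
          + t * ∫ x, h x * markovOp κ g x ∂Q + t ^ 2 * ∫ x, h x * markovOp κ h x ∂Q := by
      rw [hop]
      have i1 := hg.mul (hg.markovOp (κ := κ))
      have i2 := (hg.mul (hhb.markovOp (κ := κ))).const_mul t
      have i3 := (hhb.mul (hg.markovOp (κ := κ))).const_mul t
      have i4 := (hhb.mul (hhb.markovOp (κ := κ))).const_mul (t ^ 2)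
      rw [← integral_const_mul, ← integral_const_mul, ← integral_const_mul,
        ← integral_add (i1.integrable Q) (i2.integrable Q),
        ← integral_add ((i1.add i2).integrable Q) (i3.integrable Q),
        ← integral_add (((i1.add i2).add i3).integrable Q) (i4.integrable Q)]
      congr 1; ext x; ring
    rw [hexp, ← integral_symm hsym hg hhb, hcross] at key
    nlinarith [key]
  have hd := discrim_le_zero hquad
  rw [discrim] at hd
  have hA : 0 ≤ ∫ x, h x ^ 2 ∂Q := integral_nonneg fun x => sq_nonneg _
  have hG : 0 ≤ ∫ x, g x ^ 2 ∂Q := integral_nonneg fun x => sq_nonneg _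
  set A := ∫ x, h x ^ 2 ∂Q
  set G := ∫ x, g x ^ 2 ∂Q
  have h2 : A * A ≤ (θ ^ 2 * G) * A := by
    have := mul_le_mul hhh hgg hBgg (mul_nonneg hθ hA)
    nlinarith
  rcases hA.eq_or_lt with h3 | h3
  · rw [← h3]; positivity
  · exact le_of_mul_le_mul_right h2 h3

lemma integral_sq_iterate_markovOp_le (hsym : (Q ⊗ₘ κ).map Prod.swap = Q ⊗ₘ κ)
    (hpos : ∀ g : E → ℝ, BddMeas g → 0 ≤ ∫ x, g x * markovOp κ g x ∂Q) {θ : ℝ} (hθ : 0 ≤ θ)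
    (hgap : ∀ g : E → ℝ, BddMeas g → ∫ x, g x ∂Q = 0 →
      ∫ x, g x * markovOp κ g x ∂Q ≤ θ * ∫ x, g x ^ 2 ∂Q) (t : ℕ)
    {g : E → ℝ} (hg : BddMeas g) (h0 : ∫ x, g x ∂Q = 0) :
    ∫ x, ((markovOp κ)^[t] g x) ^ 2 ∂Q ≤ (θ ^ 2) ^ t * ∫ x, g x ^ 2 ∂Q := by
  induction t generalizing g with
  | zero => simp
  | succ t ih =>
    rw [Function.iterate_succ_apply, pow_succ, mul_assoc]
    refine (ih hg.markovOp (by rw [integral_markovOp hsym hg, h0])).trans ?_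
    gcongr
    exact integral_sq_markovOp_le hsym hpos hθ hgap hg h0

/-- Distance to stationarity after `t` steps from a warm start. The bound is proved in the dual
form `Q_t(A) - Q(A) = ∫ P^t (1_A - Q(A)) dQ₀`. -/
lemma abs_iterate_bind_sub_le (hsym : (Q ⊗ₘ κ).map Prod.swap = Q ⊗ₘ κ)
    (hpos : ∀ g : E → ℝ, BddMeas g → 0 ≤ ∫ x, g x * markovOp κ g x ∂Q) {θ : ℝ} (hθ : 0 ≤ θ)
    (hgap : ∀ g : E → ℝ, BddMeas g → ∫ x, g x ∂Q = 0 →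
      ∫ x, g x * markovOp κ g x ∂Q ≤ θ * ∫ x, g x ^ 2 ∂Q) (t : ℕ) {M : ℝ} (hM : 1 ≤ M)
    {Q₀ : Measure E} [IsProbabilityMeasure Q₀] (hwarm : Q₀ ≤ ENNReal.ofReal M • Q) {A : Set E}
    (hA : MeasurableSet A) :
    |((fun μ : Measure E => μ.bind κ)^[t] Q₀).real A - Q.real A| ≤ M * θ ^ t := by
  set g : E → ℝ := fun x => A.indicator 1 x - Q.real A with hgdef
  have hind : BddMeas (A.indicator (1 : E → ℝ)) := by
    refine ⟨measurable_one.indicator hA, 1, fun x => ?_⟩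
    by_cases hx : x ∈ A <;> simp [hx]
  have hg : BddMeas g := hind.add ⟨measurable_const, |(-Q.real A)|, fun _ => le_rfl⟩
  have hg1 : ∀ x, |g x| ≤ 1 := by
    intro x
    have h1 : Q.real A ≤ 1 := measureReal_le_one
    have h0 : 0 ≤ Q.real A := measureReal_nonneg
    by_cases hx : x ∈ A <;> simp only [hgdef, hx, Set.indicator_of_mem, Pi.one_apply,
      Set.indicator_of_notMem, not_false_eq_true] <;> rw [abs_le] <;> constructor <;> linarith
  have hg0 : ∫ x, g x ∂Q = 0 := by
    rw [hgdef, integral_sub (hind.integrable _) (integrable_const _), integral_indicator_one hA]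
    simp
  set Qt := (fun μ : Measure E => μ.bind κ)^[t] Q₀ with hQt
  have hQtp : IsProbabilityMeasure Qt := by
    rw [hQt]
    clear_value g
    clear hQt Qt
    induction t with
    | zero => simpa
    | succ t ih =>
      rw [Function.iterate_succ_apply']
      infer_instance
  have hdiff : Qt.real A - Q.real A = ∫ x, (markovOp κ)^[t] g x ∂Q₀ := by
    rw [← integral_iterate_bind t hg, ← hQt, hgdef,
      integral_sub (hind.integrable _) (integrable_const _), integral_indicator_one hA]
    simp
  set G := (markovOp κ)^[t] g with hG
  have hGb : BddMeas G := hg.iterate_markovOp t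
  have hG2 : BddMeas (fun x => G x ^ 2) := by simpa [sq] using hGb.mul hGb
  have hsq : (∫ x, G x ∂Q₀) ^ 2 ≤ ∫ x, G x ^ 2 ∂Q₀ := by
    have hv := ProbabilityTheory.variance_nonneg G Q₀
    rw [ProbabilityTheory.variance_eq_sub] at hv
    · simpa using hv
    · obtain ⟨hm, c, hc⟩ := hGb
      exact MemLp.of_bound hm.aestronglyMeasurable c (ae_of_all _ hc)
  have hQ0Q : ∫ x, G x ^ 2 ∂Q₀ ≤ M * ∫ x, G x ^ 2 ∂Q := by
    have := integral_mono_measure hwarm (ae_of_all _ fun x => sq_nonneg (G x))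
      ((hG2.integrable Q).smul_measure ENNReal.ofReal_ne_top)
    rwa [integral_smul_measure, ENNReal.toReal_ofReal (by linarith), smul_eq_mul] at this
  have hdecay := integral_sq_iterate_markovOp_le hsym hpos hθ hgap t hg hg0
  have hgle : ∫ x, g x ^ 2 ∂Q ≤ 1 := by
    have hg2 : BddMeas (fun x => g x ^ 2) := by simpa [sq] using hg.mul hg
    have := integral_mono (hg2.integrable Q) (integrable_const (1 : ℝ))
      (fun x => by have := (sq_le_one_iff_abs_le_one (g x)).2 (hg1 x); simpa using this)
    simpa using this
  rw [hdiff]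
  apply abs_le_of_sq_le_sq _ (by positivity)
  calc (∫ x, G x ∂Q₀) ^ 2 ≤ M * ∫ x, G x ^ 2 ∂Q := hsq.trans hQ0Q
    _ ≤ M * ((θ ^ 2) ^ t * 1) := by
        gcongr
        exact hdecay.trans (by gcongr)
    _ ≤ M ^ 2 * (θ ^ 2) ^ t := by
        have : M ≤ M ^ 2 := by nlinarith
        rw [mul_one]
        gcongr
    _ = (M * θ ^ t) ^ 2 := by ring

end Reversible

/-! ### A Poincaré inequality for the Gaussian measure at a fixed correlation -/

section Rotation

variable {d : ℕ}

lemma abs_det_prod_rotation (θ : ℝ) :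
    |LinearMap.det ((ContinuousLinearMap.rotation θ : Vec d × Vec d →L[ℝ] Vec d × Vec d) :
      Vec d × Vec d →ₗ[ℝ] Vec d × Vec d)| = 1 := by
  set r : ℝ → (Vec d × Vec d →ₗ[ℝ] Vec d × Vec d) := fun θ =>
    ((ContinuousLinearMap.rotation θ : Vec d × Vec d →L[ℝ] Vec d × Vec d) :
      Vec d × Vec d →ₗ[ℝ] Vec d × Vec d) with hr
  have happ : ∀ θ z, r θ z = (Real.cos θ • z.1 + Real.sin θ • z.2,
      -Real.sin θ • z.1 + Real.cos θ • z.2) := fun θ z => rfl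
  -- the rotations by `θ` and `-θ` are inverse to each other, and conjugate by `(x, y) ↦ (x, -y)`
  have h1 : r θ ∘ₗ r (-θ) = LinearMap.id := by
    ext z i <;> simp [happ, Real.cos_neg, Real.sin_neg] <;>
      first
        | ring1
        | linear_combination (z i) * (Real.sin_sq_add_cos_sq θ)
  let J : (Vec d × Vec d) ≃ₗ[ℝ] (Vec d × Vec d) :=
    (LinearEquiv.refl ℝ (Vec d)).prodCongr (LinearEquiv.neg ℝ)
  have h2 : r (-θ) = (J : _ →ₗ[ℝ] _) ∘ₗ r θ ∘ₗ (J.symm : _ →ₗ[ℝ] _) := by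
    ext z i <;> simp [happ, J, Real.cos_neg, Real.sin_neg]
  have h3 : LinearMap.det (r (-θ)) = LinearMap.det (r θ) := by
    rw [h2]; exact LinearMap.det_conj _ _
  have h4 : LinearMap.det (r θ) * LinearMap.det (r θ) = 1 := by
    conv_lhs => rw [← h3, h3]
    nth_rewrite 2 [← h3]
    rw [← LinearMap.det_comp, h1, LinearMap.det_id]
  rw [abs_eq (by norm_num)]
  exact mul_self_eq_one_iff.1 h4

lemma measurePreserving_rotation (θ : ℝ) :
    MeasurePreserving (ContinuousLinearMap.rotation θ : Vec d × Vec d →L[ℝ] Vec d × Vec d)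
      (volume.prod volume) (volume.prod volume) := by
  refine ⟨(ContinuousLinearMap.rotation θ).continuous.measurable, ?_⟩
  have hdet := abs_det_prod_rotation (d := d) θ
  have h := Measure.map_linearMap_addHaar_eq_smul_addHaar
    (μ := (volume : Measure (Vec d)).prod (volume : Measure (Vec d)))
    (f := ((ContinuousLinearMap.rotation θ : Vec d × Vec d →L[ℝ] Vec d × Vec d) :
      Vec d × Vec d →ₗ[ℝ] Vec d × Vec d)) (by intro h0; rw [h0] at hdet; simp at hdet)
  rw [abs_inv, hdet] at h
  simpa using h

/-- The unnormalized density of a pair of independent standard Gaussian vectors. -/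
def gaussPair (z : Vec d × Vec d) : ENNReal :=
  ENNReal.ofReal (Real.exp (-(‖z.1‖ ^ 2 + ‖z.2‖ ^ 2) / 2))

lemma measurable_gaussPair : Measurable (gaussPair (d := d)) := by
  unfold gaussPair; fun_prop

lemma gaussPair_rotation (θ : ℝ) (z : Vec d × Vec d) :
    gaussPair (ContinuousLinearMap.rotation θ z) = gaussPair z := by
  unfold gaussPair
  rw [ContinuousLinearMap.rotation_apply]
  congr 4
  simp only [norm_add_sq_real, norm_smul, inner_smul_left, inner_smul_right, mul_pow]
  simp
  linear_combination (‖z.1‖ ^ 2 + ‖z.2‖ ^ 2) * (Real.sin_sq_add_cos_sq θ)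

/-- Interpolating between independent Gaussian vectors `x` and `y` along the arc
`cos θ x + sin θ y` in `N` steps: consecutive points all have the same joint law, so the variance
of `g` is at most `N²` times its mean squared increment over one step. -/
lemma gaussian_poincare {g : Vec d → ℝ} (hg : Measurable g) {N : ℕ} (hN : 0 < N) {δ : ℝ}
    (hδ : N * δ = Real.pi / 2) :
    ∫⁻ z, ENNReal.ofReal ((g z.1 - g z.2) ^ 2) * gaussPair z ∂(volume.prod volume) ≤
      (N : ENNReal) ^ 2 * ∫⁻ z, ENNReal.ofReal
        ((g z.1 - g (Real.cos δ • z.1 + Real.sin δ • z.2)) ^ 2) * gaussPair z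
          ∂((volume : Measure (Vec d)).prod (volume : Measure (Vec d))) := by
  set pt : ℕ → Vec d × Vec d → Vec d := fun i z => Real.cos (i * δ) • z.1 + Real.sin (i * δ) • z.2
    with hpt
  have hptm : ∀ i, Measurable (pt i) := fun i => by simp only [hpt]; fun_prop
  have hstep : ∀ i : ℕ, ∫⁻ z, ENNReal.ofReal ((g (pt i z) - g (pt (i + 1) z)) ^ 2) * gaussPair z
        ∂((volume : Measure (Vec d)).prod (volume : Measure (Vec d)))
      = ∫⁻ z, ENNReal.ofReal
        ((g z.1 - g (Real.cos δ • z.1 + Real.sin δ • z.2)) ^ 2) * gaussPair z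
          ∂((volume : Measure (Vec d)).prod (volume : Measure (Vec d))) := by
    intro i
    rw [← (measurePreserving_rotation (d := d) (i * δ)).lintegral_comp
      (f := fun z => ENNReal.ofReal
        ((g z.1 - g (Real.cos δ • z.1 + Real.sin δ • z.2)) ^ 2) * gaussPair z)]
    · refine lintegral_congr fun z => ?_
      rw [gaussPair_rotation, ContinuousLinearMap.rotation_apply]
      have : pt (i + 1) z = Real.cos δ • (Real.cos (i * δ) • z.1 + Real.sin (i * δ) • z.2)
          + Real.sin δ • (-Real.sin (i * δ) • z.1 + Real.cos (i * δ) • z.2) := by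
        simp only [hpt]
        push_cast
        rw [add_mul, one_mul, Real.cos_add, Real.sin_add]
        module
      rw [this]
    · have := measurable_gaussPair (d := d)
      fun_prop
  have hpt0 : ∀ z, pt 0 z = z.1 := fun z => by simp [hpt]
  have hptN : ∀ z, pt N z = z.2 := fun z => by simp [hpt, hδ]
  calc ∫⁻ z, ENNReal.ofReal ((g z.1 - g z.2) ^ 2) * gaussPair z ∂(volume.prod volume)
      ≤ ∫⁻ z, (N : ENNReal) * ∑ i ∈ Finset.range N,
          ENNReal.ofReal ((g (pt i z) - g (pt (i + 1) z)) ^ 2) * gaussPair z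
            ∂((volume : Measure (Vec d)).prod (volume : Measure (Vec d))) := by
        refine lintegral_mono fun z => ?_
        rw [← Finset.sum_mul, ← mul_assoc]
        gcongr
        rw [← ENNReal.ofReal_sum_of_nonneg (fun _ _ => sq_nonneg _), ← ENNReal.ofReal_natCast,
          ← ENNReal.ofReal_mul (by positivity)]
        apply ENNReal.ofReal_le_ofReal
        have h1 := sq_sum_le_card_mul_sum_sq (s := Finset.range N)
          (f := fun i => g (pt i z) - g (pt (i + 1) z))
        rw [Finset.sum_range_sub', hpt0, hptN, Finset.card_range] at h1
        exact h1
    _ = _ := by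
        rw [lintegral_const_mul, lintegral_finsetSum]
        · simp_rw [hstep]
          rw [Finset.sum_const, Finset.card_range, nsmul_eq_mul, sq, mul_assoc]
        · intro i _
          have := measurable_gaussPair (d := d)
          have := hptm i
          have := hptm (i + 1)
          fun_prop
        · have := measurable_gaussPair (d := d)
          fun_prop

/-- The unnormalized joint density of Gaussian vectors with correlation `c`, where
`s² = 1 - c²`. -/
def corrDensity (c s : ℝ) (x z : Vec d) : ℝ :=
  (s ^ d)⁻¹ * Real.exp (-(c * ‖x - z‖ ^ 2 / (2 * s ^ 2) + (‖x‖ ^ 2 + ‖z‖ ^ 2) / (2 * (1 + c))))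

/-- One step of the rotation as an integral against the density of a correlated pair. -/
lemma lintegral_gaussPair_corr {c s : ℝ} (hs : 0 < s) (hc : 0 < c) (hcs : c ^ 2 + s ^ 2 = 1)
    {F : Vec d → Vec d → ENNReal} (hF : Measurable (Function.uncurry F)) :
    ∫⁻ z, F z.1 (c • z.1 + s • z.2) * gaussPair z
          ∂((volume : Measure (Vec d)).prod (volume : Measure (Vec d)))
      = ∫⁻ x, ∫⁻ z, F x z * ENNReal.ofReal (corrDensity c s x z) := by
  rw [lintegral_prod]
  swap
  · have := measurable_gaussPair (d := d)
    have h2 : Measurable (fun z : Vec d × Vec d => F z.1 (c • z.1 + s • z.2)) :=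
      hF.comp (f := fun z : Vec d × Vec d => (z.1, c • z.1 + s • z.2)) (by fun_prop)
    fun_prop
  refine lintegral_congr fun x => ?_
  set G : Vec d → ENNReal := fun y => F x (c • x + y) *
    ENNReal.ofReal (Real.exp (-(‖x‖ ^ 2 + ‖s⁻¹ • y‖ ^ 2) / 2)) with hG
  have hFx : Measurable (F x) := hF.of_uncurry_left
  have hGm : Measurable G := by
    simp only [hG]
    fun_prop
  have h1 : ∫⁻ y, F x (c • x + s • y) * gaussPair (x, y) = ∫⁻ y, G (s • y) := by
    refine lintegral_congr fun y => ?_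
    simp only [hG, gaussPair]
    rw [smul_smul, inv_mul_cancel₀ hs.ne', one_smul]
  have h2 : ∫⁻ y, G (s • y) = ENNReal.ofReal ((s ^ d)⁻¹) * ∫⁻ y, G y := by
    rw [← lintegral_map hGm (measurable_const_smul s), Measure.map_addHaar_smul _ hs.ne',
      lintegral_smul_measure, abs_of_pos (by positivity)]
    simp
  have h3 : ∫⁻ y, G y = ∫⁻ z, G (z - c • x) := by
    rw [lintegral_sub_right_eq_self (fun y => G y)]
  simp only at h1 ⊢
  rw [h1, h2, h3, ← lintegral_const_mul _ (by fun_prop)]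
  refine lintegral_congr fun z => ?_
  simp only [hG, corrDensity]
  rw [ENNReal.ofReal_mul (by positivity)]
  have : c • x + (z - c • x) = z := by abel
  rw [this, mul_left_comm]
  congr 4
  rw [norm_smul, mul_pow, norm_sub_sq_real, norm_sub_sq_real, norm_smul, inner_smul_right,
    real_inner_comm x z]
  have hs2 : s ^ 2 = (1 - c) * (1 + c) := by linarith
  have hc1 : 1 - c ≠ 0 := by
    intro h; rw [h] at hs2; simp at hs2; exact hs.ne' hs2
  have hc2 : 1 + c ≠ 0 := by positivity
  simp only [Real.norm_eq_abs, sq_abs, mul_pow, inv_pow]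
  rw [hs2]
  field_simp
  ring

end Rotation

/-! ### Folding the complement of a ball into the ball by inversion -/

section Inversion

variable {d : ℕ}

/-- The map that fixes the closed ball `B(0, R)` and sends its complement into the ball by
inversion in the sphere. -/
def foldBall (R : ℝ) (x : Vec d) : Vec d := if ‖x‖ ≤ R then x else (R / ‖x‖) ^ 2 • x

/-- The Jacobian of `foldBall`, that is, the absolute value of the determinant of its derivative. -/
def foldJac (R : ℝ) (x : Vec d) : ℝ := if ‖x‖ ≤ R then 1 else (R / ‖x‖) ^ (2 * d)

lemma measurable_foldBall (R : ℝ) : Measurable (foldBall (d := d) R) := by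
  unfold foldBall
  refine Measurable.ite (measurableSet_le (by fun_prop) (by fun_prop)) (by fun_prop) (by fun_prop)

lemma measurable_foldJac (R : ℝ) : Measurable (foldJac (d := d) R) := by
  unfold foldJac
  refine Measurable.ite (measurableSet_le (by fun_prop) (by fun_prop)) (by fun_prop) (by fun_prop)

lemma norm_inversion_smul {R : ℝ} (hR : 0 < R) {x : Vec d} (hx : R < ‖x‖) :
    ‖(R / ‖x‖) ^ 2 • x‖ = R ^ 2 / ‖x‖ := by
  have h0 : 0 < ‖x‖ := hR.trans hx
  rw [norm_smul, Real.norm_eq_abs, abs_of_nonneg (by positivity)]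
  field_simp

lemma norm_foldBall_le {R : ℝ} (hR : 0 < R) (x : Vec d) : ‖foldBall R x‖ ≤ R := by
  unfold foldBall
  split_ifs with h
  · exact h
  · push Not at h
    rw [norm_inversion_smul hR h, div_le_iff₀ (hR.trans h)]
    nlinarith

lemma foldBall_of_mem {R : ℝ} {x : Vec d} (hx : x ∈ Metric.closedBall (0 : Vec d) R) :
    foldBall R x = x := by
  simp [foldBall, mem_closedBall_zero_iff.1 hx]

lemma foldBall_sub_le_of_mixed {R : ℝ} (hR : 0 < R) {x y : Vec d} (hx : ‖x‖ ≤ R)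
    (hy : R < ‖y‖) : ‖x - (R / ‖y‖) ^ 2 • y‖ ≤ ‖x - y‖ := by
  refine le_of_sq_le_sq ?_ (norm_nonneg _)
  have h0 : 0 < ‖y‖ := hR.trans hy
  set a := (R / ‖y‖) ^ 2 with ha
  have ha0 : 0 ≤ a := by positivity
  have hay : a * ‖y‖ ^ 2 = R ^ 2 := by rw [ha]; field_simp
  have ha1 : a ≤ 1 := by
    rw [ha, sq_le_one_iff₀ (by positivity), div_le_one h0]; exact hy.le
  rw [norm_sub_sq_real, norm_sub_sq_real, norm_smul, inner_smul_right, mul_pow,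
    Real.norm_eq_abs, sq_abs]
  have hin : inner ℝ x y ≤ ‖x‖ * ‖y‖ := real_inner_le_norm x y
  have hb : R / ‖y‖ ≤ 1 := by rw [div_le_one h0]; exact hy.le
  have hb0 : 0 ≤ R / ‖y‖ := by positivity
  -- AM-GM: `2 R |y| ≤ R² + |y|² `
  have h3 : 2 * inner ℝ x y ≤ (1 + a) * ‖y‖ ^ 2 := by
    have : inner ℝ x y ≤ R * ‖y‖ := hin.trans (by gcongr)
    nlinarith [sq_nonneg (R - ‖y‖)]
  nlinarith [mul_le_mul_of_nonneg_left h3 (sub_nonneg.2 ha1)]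

/-- Folding does not increase distances. -/
lemma norm_foldBall_sub_le {R : ℝ} (hR : 0 < R) (x y : Vec d) :
    ‖foldBall R x - foldBall R y‖ ≤ ‖x - y‖ := by
  unfold foldBall
  split_ifs with hx hy hy
  · exact le_rfl
  · exact foldBall_sub_le_of_mixed hR hx (not_le.1 hy)
  · rw [norm_sub_rev, norm_sub_rev x]
    exact foldBall_sub_le_of_mixed hR hy (not_le.1 hx)
  · push Not at hx hy
    have hx0 : 0 < ‖x‖ := hR.trans hx
    have hy0 : 0 < ‖y‖ := hR.trans hy
    have h := EuclideanGeometry.dist_inversion_inversion (c := (0 : Vec d)) (x := x) (y := y)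
      (norm_pos_iff.1 hx0) (norm_pos_iff.1 hy0) R
    simp only [EuclideanGeometry.inversion, vsub_eq_sub, sub_zero, vadd_eq_add,
      add_zero, dist_eq_norm] at h
    rw [h]
    have : R ^ 2 / (‖x‖ * ‖y‖) ≤ 1 := by
      rw [div_le_one (by positivity)]; nlinarith
    nlinarith [norm_nonneg (x - y)]

/-- The ball and its complement each contribute at most the integral over the ball. -/
lemma lintegral_foldBall_le {R : ℝ} (hR : 0 < R) {G : Vec d → ENNReal} :
    ∫⁻ x, G (foldBall R x) * ENNReal.ofReal (foldJac R x)
      ≤ 2 * ∫⁻ x in Metric.closedBall 0 R, G x := by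
  rw [← lintegral_add_compl _ (Metric.isClosed_closedBall (x := (0 : Vec d)) (ε := R)).measurableSet,
    two_mul]
  have hK := (Metric.isClosed_closedBall (x := (0 : Vec d)) (ε := R)).measurableSet
  gcongr ?_ + ?_
  · refine le_of_eq (setLIntegral_congr_fun hK fun x hx => ?_)
    simp [foldBall, foldJac, mem_closedBall_zero_iff.1 hx]
  · have hout : ∀ x ∈ (Metric.closedBall (0 : Vec d) R)ᶜ, R < ‖x‖ := fun x hx => by
      simpa using hx
    have hinv : ∀ x : Vec d, EuclideanGeometry.inversion 0 R x = (R / ‖x‖) ^ 2 • x := fun x => by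
      simp [EuclideanGeometry.inversion]
    have hder : ∀ x ∈ (Metric.closedBall (0 : Vec d) R)ᶜ,
        HasFDerivWithinAt (EuclideanGeometry.inversion (0 : Vec d) R)
          ((R / dist x 0) ^ 2 • (((ℝ ∙ (x - 0))ᗮ.reflection : Vec d →L[ℝ] Vec d)))
          (Metric.closedBall (0 : Vec d) R)ᶜ x := fun x hx =>
      (EuclideanGeometry.hasFDerivAt_inversion
        (norm_pos_iff.1 (hR.trans (hout x hx)))).hasFDerivWithinAt
    have hcov := lintegral_image_eq_lintegral_abs_det_fderiv_mul volume hK.compl hder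
      ((EuclideanGeometry.inversion_injective 0 hR.ne').injOn) G
    have hsub : EuclideanGeometry.inversion (0 : Vec d) R '' (Metric.closedBall (0 : Vec d) R)ᶜ
        ⊆ Metric.closedBall 0 R := by
      rintro _ ⟨x, hx, rfl⟩
      have h := norm_foldBall_le hR x
      rw [foldBall, if_neg (not_le.2 (hout x hx))] at h
      rw [mem_closedBall_zero_iff, hinv]
      exact h
    refine le_trans (le_of_eq ?_) (lintegral_mono_set hsub)
    rw [hcov]
    refine setLIntegral_congr_fun hK.compl fun x hx => ?_
    have hx' := hout x hx
    simp only [hinv, foldBall, foldJac, not_le.2 hx', if_false]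
    rw [mul_comm]
    congr 2
    rw [ContinuousLinearMap.det, ContinuousLinearMap.toLinearMap_smul, LinearMap.det_smul]
    have hdet : |LinearMap.det ((((ℝ ∙ (x - 0))ᗮ.reflection : Vec d →L[ℝ] Vec d)) :
        Vec d →ₗ[ℝ] Vec d)| = 1 := by
      have := Submodule.det_reflection (𝕜 := ℝ) (ℝ ∙ (x - 0))ᗮ
      have h2 : LinearMap.det ((((ℝ ∙ (x - 0))ᗮ.reflection : Vec d →L[ℝ] Vec d)) :
        Vec d →ₗ[ℝ] Vec d) = (-1) ^ Module.finrank ℝ ((ℝ ∙ (x - 0))ᗮᗮ : Submodule ℝ (Vec d)) := this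
      rw [h2, abs_pow]
      simp
    rw [abs_mul, hdet, mul_one, dist_zero_right, abs_of_nonneg (by positivity), ← pow_mul]
    simp

end Inversion

/-! ### Transfer of the Gaussian Poincaré inequality to a ball -/

section BallPoincare

variable {d : ℕ}

/-- Inversion in a sphere of radius at least `√(2 d)` gains more from the decay of the Gaussian
density than it loses in volume. -/
lemma exp_le_foldJac_mul {R : ℝ} (hR : 0 < R) (hRd : 2 * (d : ℝ) ≤ R ^ 2) (x : Vec d) :
    Real.exp (-‖x‖ ^ 2 / 4) ≤ foldJac R x * Real.exp (-‖foldBall R x‖ ^ 2 / 4) := by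
  unfold foldJac foldBall
  split_ifs with h
  · simp
  · push Not at h
    have h0 : 0 < ‖x‖ := hR.trans h
    rw [norm_inversion_smul hR h]
    have hy : 0 < (‖x‖ / R) ^ 2 := by positivity
    have hy1 : 1 ≤ (‖x‖ / R) ^ 2 := by
      rw [one_le_sq_iff₀ (by positivity), one_le_div hR]; exact h.le
    have hlog : 0 ≤ Real.log ((‖x‖ / R) ^ 2) := Real.log_nonneg hy1
    have hsinh := Real.self_le_sinh_iff.2 hlog
    rw [Real.sinh_log hy] at hsinh
    have hpow : (R / ‖x‖) ^ (2 * d) = Real.exp (-(d * Real.log ((‖x‖ / R) ^ 2))) := by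
      rw [Real.exp_neg, Real.exp_nat_mul, Real.exp_log hy, pow_mul, ← inv_pow, ← inv_pow, inv_div]
    rw [hpow, ← Real.exp_add]
    apply Real.exp_le_exp.2
    have e1 : ‖x‖ ^ 2 = R ^ 2 * (‖x‖ / R) ^ 2 := by field_simp
    have e2 : (R ^ 2 / ‖x‖) ^ 2 = R ^ 2 * ((‖x‖ / R) ^ 2)⁻¹ := by field_simp
    rw [e1, e2]
    set L := Real.log ((‖x‖ / R) ^ 2)
    set y := (‖x‖ / R) ^ 2
    nlinarith [mul_le_mul_of_nonneg_right hRd hlog, mul_le_mul_of_nonneg_left hsinh (sq_nonneg R)]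

/-- The kernel `min (φ(u), φ(v)) q(u, v)` of the Metropolis walk with Gaussian target, up to
normalization. -/
def walkKernel (σ : ℝ) (u v : Vec d) : ℝ :=
  (σ ^ d)⁻¹ * Real.exp (-(max (‖u‖ ^ 2) (‖v‖ ^ 2) / 2) - ‖u - v‖ ^ 2 / (2 * σ ^ 2))

lemma measurable_walkKernel (σ : ℝ) :
    Measurable (Function.uncurry (walkKernel (d := d) σ)) := by
  unfold walkKernel Function.uncurry
  fun_prop

/-- A correlated Gaussian pair, folded into the ball, is dominated by the Metropolis kernel. The
step `s` is smaller than `σ` by a relative amount of order `1 / d`: this leaves room to absorb the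
factor `exp (R ‖u - v‖ / 2)` and costs only a bounded factor in the normalization. -/
lemma corrDensity_le (hd : 1 ≤ d) {R c s σ : ℝ} (hR : 0 < R) (hRd : 2 * (d : ℝ) ≤ R ^ 2)
    (hc : 0 < c) (hc1 : c ≤ 1) (hs : 0 < s) (hσ : 0 < σ)
    (hcs : (1 + 1 / (d : ℝ)) / σ ^ 2 ≤ c / s ^ 2) (hσR : 16 * (R ^ 2 * σ ^ 2 * d) ≤ 1)
    (hσs : σ ^ d ≤ Real.exp 4 * s ^ d) (x z : Vec d) :
    corrDensity c s x z ≤ Real.exp 5 * walkKernel σ (foldBall R x) (foldBall R z)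
      * foldJac R x * foldJac R z := by
  have hd0 : (0 : ℝ) < d := by exact_mod_cast hd
  set u := foldBall R x with hu
  set v := foldBall R z with hv
  have hJx : Real.exp (-‖x‖ ^ 2 / 4) ≤ foldJac R x * Real.exp (-‖u‖ ^ 2 / 4) :=
    exp_le_foldJac_mul hR hRd x
  have hJz : Real.exp (-‖z‖ ^ 2 / 4) ≤ foldJac R z * Real.exp (-‖v‖ ^ 2 / 4) :=
    exp_le_foldJac_mul hR hRd z
  have hJx0 : 0 ≤ foldJac R x := by unfold foldJac; split_ifs <;> positivity
  have hJz0 : 0 ≤ foldJac R z := by unfold foldJac; split_ifs <;> positivity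
  have huR : ‖u‖ ≤ R := norm_foldBall_le hR x
  have hvR : ‖v‖ ≤ R := norm_foldBall_le hR z
  have hD : ‖u - v‖ ≤ ‖x - z‖ := norm_foldBall_sub_le hR x z
  set D := ‖u - v‖ with hDdef
  have hD0 : 0 ≤ D := norm_nonneg _
  have hsσ : (s ^ d)⁻¹ ≤ Real.exp 4 * (σ ^ d)⁻¹ := by
    rw [inv_le_comm₀ (by positivity) (by positivity), mul_inv, inv_inv,
      inv_mul_le_iff₀ (Real.exp_pos _)]
    exact hσs
  have hdist : c * ‖x - z‖ ^ 2 / (2 * s ^ 2) ≥ (1 + 1 / (d : ℝ)) / σ ^ 2 * D ^ 2 / 2 := by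
    have h1 : c * ‖x - z‖ ^ 2 / (2 * s ^ 2) = c / s ^ 2 * ‖x - z‖ ^ 2 / 2 := by
      field_simp
    rw [h1]
    gcongr
  have hnorm : (‖x‖ ^ 2 + ‖z‖ ^ 2) / (2 * (1 + c)) ≥ ‖x‖ ^ 2 / 4 + ‖z‖ ^ 2 / 4 := by
    rw [ge_iff_le, ← add_div]
    exact div_le_div_of_nonneg_left (by positivity) (by positivity) (by linarith)
  have hmax : max (‖u‖ ^ 2) (‖v‖ ^ 2) / 2 ≤ ‖u‖ ^ 2 / 4 + ‖v‖ ^ 2 / 4 + R * D / 2 := by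
    have h1 : |‖u‖ - ‖v‖| ≤ D := abs_norm_sub_norm_le u v
    rw [abs_le] at h1
    have hu0 := norm_nonneg u
    have hv0 := norm_nonneg v
    have h2 : (‖u‖ - ‖v‖) * (‖u‖ + ‖v‖) ≤ D * (R + R) := by gcongr; exact h1.2
    have h3 : (‖v‖ - ‖u‖) * (‖u‖ + ‖v‖) ≤ D * (R + R) := by gcongr; linarith
    rcases max_cases (‖u‖ ^ 2) (‖v‖ ^ 2) with ⟨h, _⟩ | ⟨h, _⟩ <;> rw [h] <;> linarith
  have habs : R * D / 2 ≤ 1 / (d : ℝ) / σ ^ 2 * D ^ 2 / 2 + 1 := by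
    have h1 : 1 / (d : ℝ) / σ ^ 2 * D ^ 2 / 2 = D ^ 2 / (2 * (σ ^ 2 * d)) := by field_simp
    rw [h1, ← sub_le_iff_le_add, le_div_iff₀ (by positivity)]
    have h2 : 0 < σ ^ 2 * d := by positivity
    set e := σ ^ 2 * d with he
    have h3 : 16 * (R ^ 2 * e) ≤ 1 := by rw [he]; linarith
    have h4 : 16 * (R ^ 2 * e) * e ≤ 1 * e := by gcongr
    have h5 := sq_nonneg (D - R * e / 2)
    have h6 : (D - R * e / 2) ^ 2 = D ^ 2 - R * D * e + R ^ 2 * e * e / 4 := by ring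
    have h7 : (R * D / 2 - 1) * (2 * e) = R * D * e - 2 * e := by ring
    linarith
  have hexp : Real.exp (-(c * ‖x - z‖ ^ 2 / (2 * s ^ 2) + (‖x‖ ^ 2 + ‖z‖ ^ 2) / (2 * (1 + c))))
      ≤ Real.exp (-((1 + 1 / (d : ℝ)) / σ ^ 2 * D ^ 2 / 2)) *
        (Real.exp (-‖x‖ ^ 2 / 4) * Real.exp (-‖z‖ ^ 2 / 4)) := by
    rw [← Real.exp_add, ← Real.exp_add]
    apply Real.exp_le_exp.2
    linarith
  have hfin : Real.exp (-((1 + 1 / (d : ℝ)) / σ ^ 2 * D ^ 2 / 2)) *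
        (Real.exp (-‖u‖ ^ 2 / 4) * Real.exp (-‖v‖ ^ 2 / 4))
      ≤ Real.exp 1 * Real.exp (-(max (‖u‖ ^ 2) (‖v‖ ^ 2) / 2) - D ^ 2 / (2 * σ ^ 2)) := by
    rw [← Real.exp_add, ← Real.exp_add, ← Real.exp_add]
    apply Real.exp_le_exp.2
    have h1 : (1 + 1 / (d : ℝ)) / σ ^ 2 * D ^ 2 / 2
        = D ^ 2 / (2 * σ ^ 2) + 1 / (d : ℝ) / σ ^ 2 * D ^ 2 / 2 := by field_simp
    linarith
  unfold corrDensity walkKernel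
  calc (s ^ d)⁻¹ * Real.exp (-(c * ‖x - z‖ ^ 2 / (2 * s ^ 2)
          + (‖x‖ ^ 2 + ‖z‖ ^ 2) / (2 * (1 + c))))
      ≤ (Real.exp 4 * (σ ^ d)⁻¹) * (Real.exp (-((1 + 1 / (d : ℝ)) / σ ^ 2 * D ^ 2 / 2)) *
        ((foldJac R x * Real.exp (-‖u‖ ^ 2 / 4)) * (foldJac R z * Real.exp (-‖v‖ ^ 2 / 4)))) := by
        refine mul_le_mul hsσ (hexp.trans ?_) (Real.exp_pos _).le (by positivity)
        gcongr
    _ = (Real.exp 4 * (σ ^ d)⁻¹ * (foldJac R x * foldJac R z)) *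
        (Real.exp (-((1 + 1 / (d : ℝ)) / σ ^ 2 * D ^ 2 / 2)) *
        (Real.exp (-‖u‖ ^ 2 / 4) * Real.exp (-‖v‖ ^ 2 / 4))) := by ring
    _ ≤ (Real.exp 4 * (σ ^ d)⁻¹ * (foldJac R x * foldJac R z)) *
        (Real.exp 1 * Real.exp (-(max (‖u‖ ^ 2) (‖v‖ ^ 2) / 2) - D ^ 2 / (2 * σ ^ 2))) := by
        gcongr
    _ = _ := by
        rw [show (5 : ℝ) = 4 + 1 by norm_num, Real.exp_add]
        ring

/-- The Gaussian inequality, applied to the function `g ∘ foldBall R` on all of space, and folded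
back into the ball; the factor `4` comes from folding both variables. -/
lemma ball_poincare_of_angle (hd : 1 ≤ d) {R σ : ℝ} (hR : 0 < R) (hRd : 2 * (d : ℝ) ≤ R ^ 2)
    (hσ : 0 < σ) (hσR : 16 * (R ^ 2 * σ ^ 2 * d) ≤ 1) {N : ℕ} (hN : 0 < N) {δ : ℝ}
    (hNδ : N * δ = Real.pi / 2) (hc : 0 < Real.cos δ) (hs : 0 < Real.sin δ)
    (hcs : (1 + 1 / (d : ℝ)) / σ ^ 2 ≤ Real.cos δ / Real.sin δ ^ 2)
    (hσs : σ ^ d ≤ Real.exp 4 * Real.sin δ ^ d) {g : Vec d → ℝ} (hg : Measurable g) :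
    ∫⁻ x in Metric.closedBall 0 R, ∫⁻ y in Metric.closedBall 0 R,
        ENNReal.ofReal ((g x - g y) ^ 2) * gaussPair (x, y)
      ≤ (N : ENNReal) ^ 2 * (4 * ENNReal.ofReal (Real.exp 5) *
        ∫⁻ x in Metric.closedBall 0 R, ∫⁻ y in Metric.closedBall 0 R,
          ENNReal.ofReal ((g x - g y) ^ 2) * ENNReal.ofReal (walkKernel σ x y)) := by
  have hK := (Metric.isClosed_closedBall (x := (0 : Vec d)) (ε := R)).measurableSet
  have hT := measurable_foldBall (d := d) R
  have hJ := measurable_foldJac (d := d) R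
  have hW := measurable_walkKernel (d := d) σ
  have hGP := measurable_gaussPair (d := d)
  set g' : Vec d → ℝ := fun x => g (foldBall R x) with hg'
  have hgm : Measurable g' := hg.comp hT
  calc ∫⁻ x in Metric.closedBall 0 R, ∫⁻ y in Metric.closedBall 0 R,
        ENNReal.ofReal ((g x - g y) ^ 2) * gaussPair (x, y)
      = ∫⁻ x in Metric.closedBall 0 R, ∫⁻ y in Metric.closedBall 0 R,
        ENNReal.ofReal ((g' x - g' y) ^ 2) * gaussPair (x, y) := by
        refine setLIntegral_congr_fun hK fun x hx => setLIntegral_congr_fun hK fun y hy => ?_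
        simp only [hg', foldBall_of_mem hx, foldBall_of_mem hy]
    _ ≤ ∫⁻ x, ∫⁻ y, ENNReal.ofReal ((g' x - g' y) ^ 2) * gaussPair (x, y) := by
        refine (setLIntegral_le_lintegral _ _).trans (lintegral_mono fun x => ?_)
        exact setLIntegral_le_lintegral _ _
    _ = ∫⁻ z, ENNReal.ofReal ((g' z.1 - g' z.2) ^ 2) * gaussPair z ∂(volume.prod volume) := by
        rw [lintegral_prod]
        fun_prop
    _ ≤ _ := gaussian_poincare hgm hN hNδ
    _ ≤ _ := by
        gcongr
        rw [lintegral_gaussPair_corr (F := fun x z => ENNReal.ofReal ((g' x - g' z) ^ 2)) hs hc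
          (by rw [add_comm]; exact Real.sin_sq_add_cos_sq δ)
          (by unfold Function.uncurry; fun_prop)]
        have hW2 : Measurable (fun p : Vec d × Vec d => walkKernel σ p.1 p.2) := hW
        set H : Vec d → Vec d → ENNReal := fun u v =>
          ENNReal.ofReal ((g u - g v) ^ 2) * ENNReal.ofReal (walkKernel σ u v) with hH
        have hHm : Measurable (Function.uncurry H) := by
          unfold Function.uncurry; simp only [hH]; fun_prop
        have hinner : ∀ x, ∫⁻ z, ENNReal.ofReal ((g' x - g' z) ^ 2) *
              ENNReal.ofReal (corrDensity (Real.cos δ) (Real.sin δ) x z)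
            ≤ (ENNReal.ofReal (Real.exp 5) * 2) * ((∫⁻ v in Metric.closedBall 0 R,
              H (foldBall R x) v) * ENNReal.ofReal (foldJac R x)) := by
          intro x
          have hJx0 : 0 ≤ foldJac R x := by unfold foldJac; split_ifs <;> positivity
          calc _ ≤ ∫⁻ z, (ENNReal.ofReal (Real.exp 5) * ENNReal.ofReal (foldJac R x)) *
                (H (foldBall R x) (foldBall R z) * ENNReal.ofReal (foldJac R z)) := by
                refine lintegral_mono fun z => ?_
                have h1 := ENNReal.ofReal_le_ofReal (corrDensity_le hd hR hRd hc
                  (Real.cos_le_one δ) hs hσ hcs hσR hσs x z)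
                have hw : 0 ≤ walkKernel σ (foldBall R x) (foldBall R z) := by
                  unfold walkKernel; positivity
                rw [ENNReal.ofReal_mul (by positivity), ENNReal.ofReal_mul (by positivity),
                  ENNReal.ofReal_mul (by positivity)] at h1
                refine (mul_le_mul_right h1 _).trans (le_of_eq ?_)
                simp only [hH, hg']
                ring
            _ ≤ _ := by
                rw [lintegral_const_mul]
                · have h2 := lintegral_foldBall_le hR (G := H (foldBall R x))
                  refine (mul_le_mul_right h2 _).trans (le_of_eq ?_)
                  ring
                · have := hHm.of_uncurry_left (x := foldBall R x)
                  fun_prop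
        refine (lintegral_mono hinner).trans ?_
        rw [lintegral_const_mul]
        · have h3 := lintegral_foldBall_le hR
            (G := fun u => ∫⁻ v in Metric.closedBall 0 R, H u v)
          refine (mul_le_mul_right h3 _).trans (le_of_eq ?_)
          ring
        · have h4 : Measurable (fun u => ∫⁻ v in Metric.closedBall 0 R, H u v) :=
            Measurable.lintegral_prod_right' hHm
          fun_prop

/-- There is an angle `δ = π / (2 N)`, with `N` of order `1 / σ`, that is smaller than `σ` by a
relative amount of order `1 / d`: small enough for `cos δ / sin² δ` to exceed `1 / σ²` by a factor
`1 + 1 / d`, and large enough for `(σ / sin δ)^d` to stay bounded. -/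
lemma exists_angle (hd : 2 ≤ d) {σ : ℝ} (hσ : 0 < σ) (hσd : σ * (8 * d) ≤ 1) :
    ∃ (N : ℕ) (δ : ℝ), 0 < N ∧ N * δ = Real.pi / 2 ∧ 0 < Real.cos δ ∧ 0 < Real.sin δ ∧
      (1 + 1 / (d : ℝ)) / σ ^ 2 ≤ Real.cos δ / Real.sin δ ^ 2 ∧
      σ ^ d ≤ Real.exp 4 * Real.sin δ ^ d ∧ (N : ℝ) ≤ 5 / σ := by
  have hd2 : (2 : ℝ) ≤ d := by exact_mod_cast hd
  set e : ℝ := 1 / d with he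
  have he0 : 0 < e := by positivity
  have he2 : e ≤ 1 / 2 := by rw [he]; gcongr
  have hσe : σ ≤ e / 8 := by
    rw [he, div_div, le_div_iff₀ (by positivity)]; linarith
  set τ := σ * (1 - e) with hτ
  have hτ0 : 0 < τ := mul_pos hσ (by linarith)
  set N := ⌈Real.pi / 2 / τ⌉₊ with hN
  have hpi := Real.pi_gt_three
  have hpi' := Real.pi_lt_d2
  have hN0 : 0 < N := Nat.ceil_pos.2 (by positivity)
  have hNr : (0 : ℝ) < N := by exact_mod_cast hN0
  have hNlow : Real.pi / 2 / τ ≤ N := Nat.le_ceil _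
  have hNup : (N : ℝ) < Real.pi / 2 / τ + 1 := Nat.ceil_lt_add_one (by positivity)
  set δ := Real.pi / 2 / N with hδ
  have hδ0 : 0 < δ := by positivity
  have hNδ : N * δ = Real.pi / 2 := by rw [hδ]; field_simp
  have hδτ : δ ≤ τ := by
    rw [div_le_iff₀ hτ0] at hNlow
    rw [hδ, div_le_iff₀ hNr]; linarith
  have hδσ : δ ≤ σ := hδτ.trans (by
    rw [hτ]; exact mul_le_of_le_one_right hσ.le (by linarith))
  have hδ1 : δ ≤ 1 / 16 := by linarith
  have hcos := Real.one_sub_sq_div_two_le_cos (x := δ)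
  have hsin := Real.sin_gt_sub_cube hδ0
  have hsinle := Real.sin_le hδ0.le
  have hδ2 : δ ^ 2 ≤ δ := by
    rw [sq]; exact mul_le_of_le_one_right hδ0.le (by linarith)
  have hcos0 : 0 < Real.cos δ := by linarith
  have hsin0 : 0 < Real.sin δ := Real.sin_pos_of_pos_of_lt_pi hδ0 (by linarith)
  -- `τ - δ` is at most `τ²`, since `N` is at most `π / (2 τ) + 1`
  have hτδ : τ ≤ δ * (1 + τ) := by
    have h1 : (N : ℝ) * τ ≤ Real.pi / 2 + τ := by
      have := mul_le_mul_of_nonneg_right hNup.le hτ0.le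
      rw [add_mul, div_mul_cancel₀ _ hτ0.ne'] at this; linarith
    have h2 : δ * ((N : ℝ) * τ) ≤ δ * (Real.pi / 2 + τ) := by gcongr
    have h3 : δ * ((N : ℝ) * τ) = Real.pi / 2 * τ := by rw [← hNδ]; ring
    rw [h3] at h2
    have h4 : δ * 1 ≤ δ * (Real.pi / 2) := by gcongr; linarith
    have h5 : τ * 1 ≤ τ * (Real.pi / 2) := by gcongr; linarith
    have h6 : 0 < δ * τ := mul_pos hδ0 hτ0
    have h7 : Real.pi / 2 * τ ≤ Real.pi / 2 * (δ * (1 + τ)) := by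
      have : δ * τ * 1 ≤ δ * τ * (Real.pi / 2) := by gcongr; linarith
      linarith
    exact le_of_mul_le_mul_left h7 (by positivity)
  refine ⟨N, δ, hN0, hNδ, hcos0, hsin0, ?_, ?_, ?_⟩
  · rw [div_le_div_iff₀ (by positivity) (by positivity)]
    have h1 : Real.sin δ ^ 2 ≤ δ ^ 2 := by gcongr
    have h2 : δ ^ 2 ≤ τ ^ 2 := by gcongr
    have h3 : (1 + e) * Real.sin δ ^ 2 ≤ (1 + e) * τ ^ 2 := by gcongr; linarith
    refine h3.trans ?_
    have h4 : (1 - σ ^ 2 / 2) ≤ Real.cos δ := by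
      have : δ ^ 2 ≤ σ ^ 2 := by gcongr
      linarith
    have h5 : (1 - σ ^ 2 / 2) * σ ^ 2 ≤ Real.cos δ * σ ^ 2 := by gcongr
    refine le_trans ?_ h5
    rw [hτ, mul_pow, ← mul_assoc, mul_comm (1 + e), mul_assoc, mul_comm _ (σ ^ 2)]
    gcongr
    have h6 : e ^ 3 ≤ e ^ 2 := pow_le_pow_of_le_one he0.le (by linarith) (by norm_num)
    have h7 : σ ^ 2 ≤ σ := by
      rw [sq]; exact mul_le_of_le_one_right hσ.le (by linarith)
    have h8 : (1 - e) ^ 2 * (1 + e) = 1 - e - e ^ 2 + e ^ 3 := by ring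
    linarith
  · have h1 : σ ≤ Real.exp (4 * e) * Real.sin δ := by
      have h2 : 1 + 4 * e ≤ Real.exp (4 * e) := by
        have := Real.add_one_le_exp (4 * e); linarith
      refine le_trans ?_ (mul_le_mul_of_nonneg_right h2 hsin0.le)
      have h3 : δ * (1 - δ ^ 2 / 6) ≤ Real.sin δ := by linarith
      have h4 : δ * (1 - e / 8) ≤ Real.sin δ :=
        le_trans (mul_le_mul_of_nonneg_left (by linarith) hδ0.le) h3
      have hτe : τ ≤ e / 8 := by
        refine le_trans ?_ hσe
        rw [hτ]; exact mul_le_of_le_one_right hσ.le (by linarith)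
      have h5 : σ * (1 - e) ≤ δ * (1 + e / 8) := hτδ.trans (by gcongr)
      have hee : e ^ 2 ≤ e * (1 / 2) := by rw [sq]; gcongr
      have h6 : (1 + e / 8) ≤ (1 - e) * ((1 + 4 * e) * (1 - e / 8)) := by
        have h61 : 1 + e ≤ (1 - e) * (1 + 4 * e) := by linarith
        have h62 : (1 + e) * (1 - e / 8) ≤ (1 - e) * (1 + 4 * e) * (1 - e / 8) := by
          gcongr; linarith
        linarith
      have h7 : σ * (1 - e) ≤ (1 - e) * ((1 + 4 * e) * Real.sin δ) := by
        calc σ * (1 - e) ≤ δ * (1 + e / 8) := h5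
          _ ≤ δ * ((1 - e) * ((1 + 4 * e) * (1 - e / 8))) := by gcongr
          _ = (1 - e) * ((1 + 4 * e) * (δ * (1 - e / 8))) := by ring
          _ ≤ _ := by
            have : 0 ≤ 1 - e := by linarith
            gcongr
      have h8 : (1 - e) * σ ≤ (1 - e) * ((1 + 4 * e) * Real.sin δ) := by linarith
      exact le_of_mul_le_mul_left h8 (by linarith)
    calc σ ^ d ≤ (Real.exp (4 * e) * Real.sin δ) ^ d := by gcongr
      _ = Real.exp 4 * Real.sin δ ^ d := by
        rw [mul_pow, ← Real.exp_nat_mul]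
        congr 2
        rw [he]; field_simp
  · have h1 : (N : ℝ) * τ ≤ Real.pi / 2 + τ := by
      have := mul_le_mul_of_nonneg_right hNup.le hτ0.le
      rw [add_mul, div_mul_cancel₀ _ hτ0.ne'] at this; linarith
    rw [le_div_iff₀ hσ]
    have h2 : σ * (1 / 2) ≤ τ := by rw [hτ]; gcongr; linarith
    have h3 : (N : ℝ) * (σ * (1 / 2)) ≤ N * τ := by gcongr
    have h4 : τ ≤ σ := by rw [hτ]; exact mul_le_of_le_one_right hσ.le (by linarith)
    linarith

/-- Discrete Poincaré inequality at scale `σ` for the Gaussian weight on the ball `B(0, R)`. -/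
lemma ball_poincare (hd : 2 ≤ d) {R σ : ℝ} (hR : 0 < R) (hRd : 2 * (d : ℝ) ≤ R ^ 2)
    (hσ : 0 < σ) (hσd : σ * (8 * d) ≤ 1) (hσR : 16 * (R ^ 2 * σ ^ 2 * d) ≤ 1)
    {g : Vec d → ℝ} (hg : Measurable g) :
    ∫⁻ x in Metric.closedBall 0 R, ∫⁻ y in Metric.closedBall 0 R,
        ENNReal.ofReal ((g x - g y) ^ 2) * gaussPair (x, y)
      ≤ ENNReal.ofReal (100 * Real.exp 5 / σ ^ 2) *
        ∫⁻ x in Metric.closedBall 0 R, ∫⁻ y in Metric.closedBall 0 R,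
          ENNReal.ofReal ((g x - g y) ^ 2) * ENNReal.ofReal (walkKernel σ x y) := by
  obtain ⟨N, δ, hN, hNδ, hc, hs, hcs, hσs, hNσ⟩ := exists_angle hd hσ hσd
  refine (ball_poincare_of_angle (by omega) hR hRd hσ hσR hN hNδ hc hs hcs hσs hg).trans ?_
  rw [← mul_assoc]
  gcongr
  rw [← ENNReal.ofReal_natCast, show (4 : ENNReal) = ENNReal.ofReal 4 by simp,
    ← ENNReal.ofReal_pow (by positivity), ← ENNReal.ofReal_mul (by positivity),
    ← ENNReal.ofReal_mul (by positivity)]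
  apply ENNReal.ofReal_le_ofReal
  calc (N : ℝ) ^ 2 * (4 * Real.exp 5) ≤ (5 / σ) ^ 2 * (4 * Real.exp 5) := by gcongr
    _ = _ := by ring

end BallPoincare

/-! ### The Metropolis walk as a reversible positive Markov kernel -/

section Metropolis

variable {d : ℕ}

lemma lintegral_gaussianProposal {σ : ℝ} (hσ : 0 < σ) (u : Vec d) :
    ∫⁻ x, ENNReal.ofReal (gaussianProposal σ u x) = 1 := by
  have hb : 0 < 1 / (2 * σ ^ 2) := by positivity
  have h1 := GaussianFourier.integral_rexp_neg_mul_sq_norm (V := Vec d) hb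
  have h2 : ∫ x, gaussianProposal σ u x = 1 := by
    unfold gaussianProposal
    rw [integral_const_mul]
    have h3 : ∫ x : Vec d, Real.exp (-‖x - u‖ ^ 2 / (2 * σ ^ 2))
        = ∫ x : Vec d, Real.exp (-‖x‖ ^ 2 / (2 * σ ^ 2)) :=
      integral_sub_right_eq_self (fun x : Vec d => Real.exp (-‖x‖ ^ 2 / (2 * σ ^ 2))) u
    have h4 : (fun x : Vec d => Real.exp (-‖x‖ ^ 2 / (2 * σ ^ 2)))
        = fun x => Real.exp (-(1 / (2 * σ ^ 2)) * ‖x‖ ^ 2) := by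
      ext x; congr 1; ring
    have h5 : Real.pi / (1 / (2 * σ ^ 2)) = 2 * Real.pi * σ ^ 2 := by field_simp
    rw [h3, h4, h1, finrank_euclideanSpace_fin, h5, neg_div,
      Real.rpow_neg (by positivity), inv_mul_cancel₀ (by positivity)]
  have h6 : Integrable (gaussianProposal σ u) := by
    by_contra h
    rw [integral_undef h] at h2
    exact zero_ne_one h2
  rw [← ofReal_integral_eq_lintegral_ofReal h6
    (ae_of_all _ fun x => by unfold gaussianProposal; positivity), h2, ENNReal.ofReal_one]

/-- The density of a proper move. -/
def moveDensity (f : Vec d → ℝ) (σ : ℝ) (u x : Vec d) : ENNReal :=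
  ENNReal.ofReal (min (f x / f u) 1 * gaussianProposal σ u x)

lemma measurable_moveDensity {f : Vec d → ℝ} (hf : Measurable f) (σ : ℝ) :
    Measurable (Function.uncurry (moveDensity f σ)) := by
  unfold Function.uncurry moveDensity gaussianProposal
  fun_prop

lemma lintegral_properMove {f : Vec d → ℝ} (hf : Measurable f) (r σ : ℝ) (u : Vec d)
    {F : Vec d → ENNReal} (hF : Measurable F) :
    ∫⁻ x, F x ∂(properMove f r σ u) = ∫⁻ x in Metric.closedBall 0 r, moveDensity f σ u x * F x := by
  unfold properMove
  rw [lintegral_withDensity_eq_lintegral_mul _ _ hF]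
  · rfl
  · exact (measurable_moveDensity hf σ).of_uncurry_left

lemma measurable_properMove {f : Vec d → ℝ} (hf : Measurable f) (r σ : ℝ) :
    Measurable (properMove f r σ) := by
  refine Measure.measurable_of_measurable_coe _ fun A hA => ?_
  have h : ∀ u, properMove f r σ u A
      = ∫⁻ x in Metric.closedBall 0 r, moveDensity f σ u x * A.indicator 1 x := fun u => by
    rw [← lintegral_properMove hf r σ u (measurable_one.indicator hA), lintegral_indicator_one hA]
  simp_rw [h]
  refine Measurable.lintegral_prod_right' (f := fun p : Vec d × Vec d =>
    moveDensity f σ p.1 p.2 * A.indicator 1 p.2) ?_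
  have h1 : Measurable (fun p : Vec d × Vec d => moveDensity f σ p.1 p.2) :=
    measurable_moveDensity hf σ
  have h2 : Measurable (fun p : Vec d × Vec d => A.indicator (1 : Vec d → ENNReal) p.2) :=
    (measurable_one.indicator hA).comp measurable_snd
  exact h1.mul h2

lemma measurable_properMoveProb {f : Vec d → ℝ} (hf : Measurable f) (r σ : ℝ) :
    Measurable (properMoveProb f r σ) :=
  (Measure.measurable_coe MeasurableSet.univ).comp (measurable_properMove hf r σ)

lemma properMoveProb_le_one (f : Vec d → ℝ) (r : ℝ) {σ : ℝ} (hσ : 0 < σ) (u : Vec d) :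
    properMoveProb f r σ u ≤ 1 := by
  unfold properMoveProb properMove
  rw [withDensity_apply _ MeasurableSet.univ, Measure.restrict_univ]
  refine (setLIntegral_le_lintegral _ _).trans ?_
  rw [← lintegral_gaussianProposal hσ u]
  refine lintegral_mono fun x => ENNReal.ofReal_le_ofReal ?_
  have : 0 ≤ gaussianProposal σ u x := by unfold gaussianProposal; positivity
  exact mul_le_of_le_one_left this (min_le_right _ _)

lemma measurable_metropolisStep {f : Vec d → ℝ} (hf : Measurable f) (r σ : ℝ) :
    Measurable (metropolisStep f r σ) := by
  refine Measure.measurable_of_measurable_coe _ fun A hA => ?_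
  simp only [metropolisStep, Measure.add_apply, Measure.smul_apply, smul_eq_mul]
  have h1 := (Measure.measurable_coe hA).comp (measurable_properMove hf r σ)
  have h2 := (Measure.measurable_coe hA).comp (Measure.measurable_dirac (α := Vec d))
  have h3 := measurable_properMoveProb hf r σ
  exact h1.add ((measurable_const.sub h3).mul h2)

/-- The Metropolis step as a Markov kernel. -/
def metropolisKernel (f : Vec d → ℝ) (hf : Measurable f) (r σ : ℝ) : Kernel (Vec d) (Vec d) :=
  ⟨metropolisStep f r σ, measurable_metropolisStep hf r σ⟩

lemma isMarkovKernel_metropolis (f : Vec d → ℝ) (hf : Measurable f) (r : ℝ) {σ : ℝ} (hσ : 0 < σ) :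
    IsMarkovKernel (metropolisKernel f hf r σ) := by
  refine ⟨fun u => ⟨?_⟩⟩
  have h := properMoveProb_le_one f r hσ u
  change metropolisStep f r σ u Set.univ = 1
  simp only [metropolisStep, Measure.add_apply, Measure.smul_apply, smul_eq_mul, measure_univ,
    mul_one]
  exact add_tsub_cancel_of_le h

/-- The joint density `min (f(x), f(y)) q(x, y)` of two successive states at a proper move. -/
def flowDensity (f : Vec d → ℝ) (σ : ℝ) (x y : Vec d) : ℝ :=
  min (f x) (f y) * gaussianProposal σ x y

lemma gaussianProposal_comm (σ : ℝ) (x y : Vec d) :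
    gaussianProposal σ x y = gaussianProposal σ y x := by
  unfold gaussianProposal
  rw [norm_sub_rev]

lemma flowDensity_comm (f : Vec d → ℝ) (σ : ℝ) (x y : Vec d) :
    flowDensity f σ x y = flowDensity f σ y x := by
  unfold flowDensity
  rw [min_comm, gaussianProposal_comm]

lemma measurable_flowDensity {f : Vec d → ℝ} (hf : Measurable f) (σ : ℝ) :
    Measurable (fun p : Vec d × Vec d => flowDensity f σ p.1 p.2) := by
  unfold flowDensity gaussianProposal
  fun_prop

lemma ofReal_mul_moveDensity (f : Vec d → ℝ) (σ : ℝ) {x : Vec d} (y : Vec d) (hx : 0 < f x) :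
    ENNReal.ofReal (f x) * moveDensity f σ x y = ENNReal.ofReal (flowDensity f σ x y) := by
  unfold moveDensity flowDensity
  rw [← ENNReal.ofReal_mul hx.le, ← mul_assoc, mul_min_of_nonneg _ _ hx.le, mul_one,
    mul_div_cancel₀ _ hx.ne', min_comm]

lemma targetMeasure_eq {f : Vec d → ℝ} (r : ℝ) :
    targetMeasure f r = (∫⁻ x in Metric.closedBall 0 r, ENNReal.ofReal (f x))⁻¹ •
      (volume.restrict (Metric.closedBall 0 r)).withDensity (fun x => ENNReal.ofReal (f x)) := by
  have hK := (Metric.isClosed_closedBall (x := (0 : Vec d)) (ε := r)).measurableSet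
  unfold targetMeasure ProbabilityTheory.cond
  rw [withDensity_apply _ hK, restrict_withDensity hK]

lemma lintegral_targetMeasure {f : Vec d → ℝ} (hf : Measurable f) (r : ℝ) {F : Vec d → ENNReal}
    (hF : Measurable F) :
    ∫⁻ x, F x ∂(targetMeasure f r) = (∫⁻ x in Metric.closedBall 0 r, ENNReal.ofReal (f x))⁻¹ *
      ∫⁻ x in Metric.closedBall 0 r, ENNReal.ofReal (f x) * F x := by
  rw [targetMeasure_eq, lintegral_smul_measure,
    lintegral_withDensity_eq_lintegral_mul _ (by fun_prop) hF]
  rfl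

lemma isProbabilityMeasure_target {f : Vec d → ℝ} {r : ℝ}
    (h0 : ∫⁻ x in Metric.closedBall 0 r, ENNReal.ofReal (f x) ≠ 0)
    (htop : ∫⁻ x in Metric.closedBall 0 r, ENNReal.ofReal (f x) ≠ ⊤) :
    IsProbabilityMeasure (targetMeasure f r) := by
  refine ⟨?_⟩
  rw [targetMeasure_eq, Measure.smul_apply, withDensity_apply _ MeasurableSet.univ,
    Measure.restrict_univ, smul_eq_mul, ENNReal.inv_mul_cancel h0 htop]

/-- The joint law of two successive states: proper moves and stays. -/
lemma lintegral_target_compProd {f : Vec d → ℝ} (hf : Measurable f) {r σ : ℝ} (hσ : 0 < σ)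
    (hpos : ∀ x ∈ Metric.closedBall (0 : Vec d) r, 0 < f x) [IsProbabilityMeasure (targetMeasure f r)]
    {F : Vec d × Vec d → ENNReal} (hF : Measurable F) :
    ∫⁻ z, F z ∂(targetMeasure f r ⊗ₘ metropolisKernel f hf r σ)
      = (∫⁻ x in Metric.closedBall 0 r, ENNReal.ofReal (f x))⁻¹ *
          (∫⁻ x in Metric.closedBall 0 r, ∫⁻ y in Metric.closedBall 0 r,
            ENNReal.ofReal (flowDensity f σ x y) * F (x, y))
        + ∫⁻ x, (1 - properMoveProb f r σ x) * F (x, x) ∂(targetMeasure f r) := by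
  have hK := (Metric.isClosed_closedBall (x := (0 : Vec d)) (ε := r)).measurableSet
  have := isMarkovKernel_metropolis f hf r hσ
  have hm1 : Measurable (fun p : Vec d × Vec d => moveDensity f σ p.1 p.2) :=
    measurable_moveDensity hf σ
  have hm2 : Measurable (fun x => ∫⁻ y in Metric.closedBall 0 r, moveDensity f σ x y * F (x, y)) :=
    Measurable.lintegral_prod_right' (hm1.mul hF)
  have hm3 := measurable_properMoveProb hf r σ
  rw [Measure.lintegral_compProd hF]
  have hstep : ∀ x, ∫⁻ y, F (x, y) ∂(metropolisKernel f hf r σ x)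
      = (∫⁻ y in Metric.closedBall 0 r, moveDensity f σ x y * F (x, y))
        + (1 - properMoveProb f r σ x) * F (x, x) := by
    intro x
    change ∫⁻ y, F (x, y) ∂(metropolisStep f r σ x) = _
    unfold metropolisStep
    rw [lintegral_add_measure, lintegral_smul_measure, lintegral_dirac' _ (by fun_prop),
      lintegral_properMove hf r σ x (by fun_prop)]
    rfl
  simp_rw [hstep]
  rw [lintegral_add_left hm2, lintegral_targetMeasure hf r hm2]
  congr 2
  refine setLIntegral_congr_fun hK fun x hx => ?_
  rw [← lintegral_const_mul]
  · refine lintegral_congr fun y => ?_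
    rw [← mul_assoc, ofReal_mul_moveDensity f σ y (hpos x hx)]
  · exact (hm1.mul hF).comp measurable_prodMk_left

/-- Detailed balance. -/
lemma target_compProd_symm {f : Vec d → ℝ} (hf : Measurable f) {r σ : ℝ} (hσ : 0 < σ)
    (hpos : ∀ x ∈ Metric.closedBall (0 : Vec d) r, 0 < f x)
    [IsProbabilityMeasure (targetMeasure f r)] :
    (targetMeasure f r ⊗ₘ metropolisKernel f hf r σ).map Prod.swap
      = targetMeasure f r ⊗ₘ metropolisKernel f hf r σ := by
  ext A hA
  have hF : Measurable (A.indicator (1 : Vec d × Vec d → ENNReal)) := measurable_one.indicator hA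
  rw [← lintegral_indicator_one hA, ← lintegral_indicator_one hA,
    lintegral_map hF measurable_swap,
    lintegral_target_compProd hf hσ hpos hF,
    lintegral_target_compProd (F := fun p => A.indicator 1 p.swap) hf hσ hpos
      (hF.comp measurable_swap)]
  congr 2
  have hfm := measurable_flowDensity hf σ
  rw [lintegral_lintegral_swap]
  · simp_rw [flowDensity_comm f σ]
    rfl
  · have := hF.comp measurable_swap
    exact ((hfm.ennreal_ofReal).mul this).aemeasurable

end Metropolis

section Positivity

/-- A kernel of the form `∫ Φ(x, b) Φ(y, b) dν(b)` is positive definite. -/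
lemma integral_mul_kernel_nonneg {α β : Type*} [MeasurableSpace α] [MeasurableSpace β]
    {μ : Measure α} {ν : Measure β} [SFinite μ] [SFinite ν] {Φ : α → β → ℝ}
    (hΦ : Measurable (Function.uncurry Φ)) (hΦ0 : ∀ x b, 0 ≤ Φ x b) {k : α → α → ℝ}
    (hk : ∀ x y, ∫⁻ b, ENNReal.ofReal (Φ x b * Φ y b) ∂ν = ENNReal.ofReal (k x y))
    (hfin : ∫⁻ x, ∫⁻ y, ENNReal.ofReal (k x y) ∂μ ∂μ ≠ ⊤) (hk0 : ∀ x y, 0 ≤ k x y)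
    {g : α → ℝ} (hg : BddMeas g) :
    0 ≤ ∫ z : α × α, k z.1 z.2 * (g z.1 * g z.2) ∂(μ.prod μ) := by
  obtain ⟨hgm, c, hc⟩ := hg
  set H : (α × α) × β → ℝ := fun p => (g p.1.1 * Φ p.1.1 p.2) * (g p.1.2 * Φ p.1.2 p.2) with hH
  have hΦ1 : Measurable (fun p : (α × α) × β => Φ p.1.1 p.2) :=
    hΦ.comp (f := fun p : (α × α) × β => (p.1.1, p.2)) (by fun_prop)
  have hΦ2 : Measurable (fun p : (α × α) × β => Φ p.1.2 p.2) :=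
    hΦ.comp (f := fun p : (α × α) × β => (p.1.2, p.2)) (by fun_prop)
  have hHm : Measurable H := by simp only [hH]; fun_prop
  have hΦΦ : Measurable (fun p : (α × α) × β => ENNReal.ofReal (Φ p.1.1 p.2 * Φ p.1.2 p.2)) := by
    fun_prop
  have hint : Integrable H ((μ.prod μ).prod ν) := by
    refine ⟨hHm.aestronglyMeasurable, ?_⟩
    rw [hasFiniteIntegral_iff_enorm]
    have hb : ∀ p, ‖H p‖ₑ ≤ ENNReal.ofReal (c * c) *
        ENNReal.ofReal (Φ p.1.1 p.2 * Φ p.1.2 p.2) := by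
      intro p
      have hc0 : 0 ≤ c := (abs_nonneg _).trans (hc p.1.1)
      rw [← ENNReal.ofReal_mul (by positivity), Real.enorm_eq_ofReal_abs]
      apply ENNReal.ofReal_le_ofReal
      have h1 := hΦ0 p.1.1 p.2
      have h2 := hΦ0 p.1.2 p.2
      simp only [hH]
      rw [abs_mul, abs_mul, abs_mul, abs_of_nonneg h1, abs_of_nonneg h2]
      calc |g p.1.1| * Φ p.1.1 p.2 * (|g p.1.2| * Φ p.1.2 p.2)
          ≤ c * Φ p.1.1 p.2 * (c * Φ p.1.2 p.2) := by gcongr <;> exact hc _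
        _ = _ := by ring
    refine (lintegral_mono hb).trans_lt ?_
    rw [lintegral_const_mul _ hΦΦ, lintegral_prod _ hΦΦ.aemeasurable, lintegral_prod]
    · simp_rw [hk]
      exact ENNReal.mul_lt_top ENNReal.ofReal_lt_top hfin.lt_top
    · exact (Measurable.lintegral_prod_right' hΦΦ).aemeasurable
  have h1 : ∫ p, H p ∂((μ.prod μ).prod ν)
      = ∫ z : α × α, k z.1 z.2 * (g z.1 * g z.2) ∂(μ.prod μ) := by
    rw [integral_prod _ hint]
    congr 1
    ext z
    have h2 : ∀ b, H (z, b) = (g z.1 * g z.2) * (Φ z.1 b * Φ z.2 b) := fun b => by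
      simp only [hH]; ring
    simp_rw [h2]
    rw [integral_const_mul, mul_comm]
    congr 1
    rw [integral_eq_lintegral_of_nonneg_ae
      (ae_of_all _ fun b => mul_nonneg (hΦ0 _ _) (hΦ0 _ _)), hk, ENNReal.toReal_ofReal (hk0 _ _)]
    have h3 : Measurable (Φ z.1) := hΦ.of_uncurry_left
    have h4 : Measurable (Φ z.2) := hΦ.of_uncurry_left
    exact (h3.mul h4).aestronglyMeasurable
  rw [← h1, integral_prod_symm _ hint]
  refine integral_nonneg fun b => ?_
  simp only [hH, Pi.zero_apply]
  rw [integral_prod_mul (fun x => g x * Φ x b) (fun x => g x * Φ x b)]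
  exact mul_self_nonneg _

end Positivity

section MetropolisPositive

variable {d : ℕ}

/-- The Gaussian proposal kernel is the square of a Gaussian kernel of half the variance. -/
lemma gaussianProposal_mul {σ τ : ℝ} (hτ : 0 < τ) (hστ : σ ^ 2 = 2 * τ ^ 2) (x y z : Vec d) :
    gaussianProposal τ x z * gaussianProposal τ y z
      = gaussianProposal σ x y * gaussianProposal (τ / Real.sqrt 2) ((1 / 2 : ℝ) • (x + y)) z := by
  have hsq : (τ / Real.sqrt 2) ^ 2 = τ ^ 2 / 2 := by
    rw [div_pow, Real.sq_sqrt (by norm_num)]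
  unfold gaussianProposal
  rw [hsq, hστ]
  have hpar : ‖z - x‖ ^ 2 + ‖z - y‖ ^ 2
      = 2 * ‖z - (1 / 2 : ℝ) • (x + y)‖ ^ 2 + ‖y - x‖ ^ 2 / 2 := by
    have h1 := parallelogram_law_with_norm ℝ (z - x) (z - y)
    have h2 : z - x + (z - y) = (2 : ℝ) • (z - (1 / 2 : ℝ) • (x + y)) := by module
    have h3 : z - x - (z - y) = y - x := by abel
    rw [h2, h3, norm_smul] at h1
    simp only [Real.norm_ofNat] at h1
    nlinarith
  have hexp : Real.exp (-‖z - x‖ ^ 2 / (2 * τ ^ 2)) * Real.exp (-‖z - y‖ ^ 2 / (2 * τ ^ 2))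
      = Real.exp (-‖y - x‖ ^ 2 / (2 * (2 * τ ^ 2))) *
        Real.exp (-‖z - (1 / 2 : ℝ) • (x + y)‖ ^ 2 / (2 * (τ ^ 2 / 2))) := by
    rw [← Real.exp_add, ← Real.exp_add]
    congr 1
    field_simp
    linarith
  have hconst : (2 * Real.pi * τ ^ 2) ^ (-(d : ℝ) / 2) * (2 * Real.pi * τ ^ 2) ^ (-(d : ℝ) / 2)
      = (2 * Real.pi * (2 * τ ^ 2)) ^ (-(d : ℝ) / 2) *
        (2 * Real.pi * (τ ^ 2 / 2)) ^ (-(d : ℝ) / 2) := by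
    rw [← Real.mul_rpow (by positivity) (by positivity),
      ← Real.mul_rpow (by positivity) (by positivity)]
    congr 1; ring
  calc _ = ((2 * Real.pi * τ ^ 2) ^ (-(d : ℝ) / 2) * (2 * Real.pi * τ ^ 2) ^ (-(d : ℝ) / 2)) *
        (Real.exp (-‖z - x‖ ^ 2 / (2 * τ ^ 2)) * Real.exp (-‖z - y‖ ^ 2 / (2 * τ ^ 2))) := by ring
    _ = _ := by rw [hexp, hconst]; ring

lemma gaussianProposal_nonneg (σ : ℝ) (x y : Vec d) : 0 ≤ gaussianProposal σ x y := by
  unfold gaussianProposal; positivity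

lemma lintegral_gaussianProposal_mul {σ τ : ℝ} (hτ : 0 < τ) (hστ : σ ^ 2 = 2 * τ ^ 2)
    (x y : Vec d) :
    ∫⁻ z, ENNReal.ofReal (gaussianProposal τ x z * gaussianProposal τ y z)
      = ENNReal.ofReal (gaussianProposal σ x y) := by
  simp_rw [gaussianProposal_mul hτ hστ, ENNReal.ofReal_mul (gaussianProposal_nonneg σ x y)]
  rw [lintegral_const_mul, lintegral_gaussianProposal (by positivity), mul_one]
  unfold gaussianProposal
  fun_prop

lemma lintegral_flowDensity_lt_top {f : Vec d → ℝ} {r σ : ℝ} (hσ : 0 < σ)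
    (hf0 : ∀ x, 0 ≤ f x)
    (htop : ∫⁻ x in Metric.closedBall 0 r, ENNReal.ofReal (f x) ≠ ⊤) :
    ∫⁻ x in Metric.closedBall 0 r, ∫⁻ y in Metric.closedBall 0 r,
      ENNReal.ofReal (flowDensity f σ x y) ≠ ⊤ := by
  refine ne_top_of_le_ne_top htop (lintegral_mono fun x => ?_)
  calc ∫⁻ y in Metric.closedBall 0 r, ENNReal.ofReal (flowDensity f σ x y)
      ≤ ∫⁻ y, ENNReal.ofReal (f x) * ENNReal.ofReal (gaussianProposal σ x y) := by
        refine (setLIntegral_le_lintegral _ _).trans (lintegral_mono fun y => ?_)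
        rw [← ENNReal.ofReal_mul (hf0 x)]
        apply ENNReal.ofReal_le_ofReal
        exact mul_le_mul_of_nonneg_right (min_le_left _ _) (gaussianProposal_nonneg _ _ _)
    _ = ENNReal.ofReal (f x) := by
        rw [lintegral_const_mul, lintegral_gaussianProposal hσ, mul_one]
        unfold gaussianProposal; fun_prop

/-- The flow of proper moves is a positive definite kernel: it is the product of
`min (f(x), f(y)) = ∫ 1{s < f(x)} 1{s < f(y)} ds` and of a Gaussian kernel. -/
lemma integral_flowDensity_nonneg {f : Vec d → ℝ} (hf : Measurable f) {r σ : ℝ} (hσ : 0 < σ)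
    (hf0 : ∀ x, 0 ≤ f x)
    (htop : ∫⁻ x in Metric.closedBall 0 r, ENNReal.ofReal (f x) ≠ ⊤)
    {g : Vec d → ℝ} (hg : BddMeas g) :
    0 ≤ ∫ z : Vec d × Vec d, flowDensity f σ z.1 z.2 * (g z.1 * g z.2)
      ∂((volume.restrict (Metric.closedBall 0 r)).prod
        (volume.restrict (Metric.closedBall 0 r))) := by
  set τ := σ / Real.sqrt 2 with hτdef
  have hτ : 0 < τ := by positivity
  have hστ : σ ^ 2 = 2 * τ ^ 2 := by
    rw [hτdef, div_pow, Real.sq_sqrt (by norm_num)]; ring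
  have hflow0 : ∀ x y, 0 ≤ flowDensity f σ x y := fun x y =>
    mul_nonneg (le_min (hf0 x) (hf0 y)) (gaussianProposal_nonneg _ _ _)
  refine integral_mul_kernel_nonneg (β := ℝ × Vec d)
    (ν := (volume.restrict (Set.Ioi (0 : ℝ))).prod volume)
    (Φ := fun x b => (Set.Iio (f x)).indicator 1 b.1 * gaussianProposal τ x b.2)
    ?_ ?_ ?_ (lintegral_flowDensity_lt_top hσ hf0 htop) hflow0 hg
  · unfold Function.uncurry
    refine Measurable.mul ?_ (by unfold gaussianProposal; fun_prop)
    have h1 : MeasurableSet {p : Vec d × ℝ × Vec d | p.2.1 < f p.1} :=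
      measurableSet_lt (by fun_prop) (by fun_prop)
    exact (measurable_one (α := ℝ)).indicator h1
  · intro x b
    exact mul_nonneg (Set.indicator_nonneg (fun _ _ => zero_le_one) _)
      (gaussianProposal_nonneg _ _ _)
  · intro x y
    have h1 : ∀ b : ℝ × Vec d, ENNReal.ofReal ((Set.Iio (f x)).indicator 1 b.1 *
        gaussianProposal τ x b.2 * ((Set.Iio (f y)).indicator 1 b.1 * gaussianProposal τ y b.2))
        = (Set.Iio (min (f x) (f y))).indicator 1 b.1 *
          ENNReal.ofReal (gaussianProposal τ x b.2 * gaussianProposal τ y b.2) := by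
      intro b
      by_cases hx : b.1 < f x <;> by_cases hy : b.1 < f y <;> simp [hx, hy]
    simp_rw [h1]
    rw [lintegral_prod_mul (f := (Set.Iio (min (f x) (f y))).indicator 1)
      (g := fun z => ENNReal.ofReal (gaussianProposal τ x z * gaussianProposal τ y z)),
      lintegral_gaussianProposal_mul hτ hστ, lintegral_indicator_one measurableSet_Iio,
      Measure.restrict_apply measurableSet_Iio]
    · unfold flowDensity
      rw [ENNReal.ofReal_mul (le_min (hf0 x) (hf0 y)), Set.inter_comm, Set.Ioi_inter_Iio,
        Real.volume_Ioo, sub_zero]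
    · exact (measurable_one.indicator measurableSet_Iio).aemeasurable
    · unfold gaussianProposal
      fun_prop

/-- The Metropolis walk is positive: the flow of proper moves is positive definite, and the stays
contribute a weighted integral of `g²`. -/
lemma metropolis_positive {f : Vec d → ℝ} (hf : Measurable f) {r σ : ℝ} (hσ : 0 < σ)
    (hf0 : ∀ x, 0 ≤ f x) (hpos : ∀ x ∈ Metric.closedBall (0 : Vec d) r, 0 < f x)
    (htop : ∫⁻ x in Metric.closedBall 0 r, ENNReal.ofReal (f x) ≠ ⊤)
    [IsProbabilityMeasure (targetMeasure f r)] {g : Vec d → ℝ} (hg : BddMeas g) :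
    0 ≤ ∫ x, g x * markovOp (metropolisKernel f hf r σ) g x ∂(targetMeasure f r) := by
  have := isMarkovKernel_metropolis f hf r hσ
  rw [← integral_mul_markovOp hg hg]
  set Q := targetMeasure f r
  set μ := (volume.restrict (Metric.closedBall (0 : Vec d) r))
  set Z := ∫⁻ x in Metric.closedBall 0 r, ENNReal.ofReal (f x)
  have hfm := (measurable_flowDensity hf σ).ennreal_ofReal
  have hpm := measurable_properMoveProb hf r σ
  set ρ₁ : Measure (Vec d × Vec d) := Z⁻¹ • (μ.prod μ).withDensity
    (fun z => ENNReal.ofReal (flowDensity f σ z.1 z.2)) with hρ₁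
  set ρ₂ : Measure (Vec d × Vec d) := (Q.withDensity (fun x => 1 - properMoveProb f r σ x)).map
    (fun x => (x, x)) with hρ₂
  have hsum : Q ⊗ₘ metropolisKernel f hf r σ = ρ₁ + ρ₂ := by
    ext A hA
    have hF : Measurable (A.indicator (1 : Vec d × Vec d → ENNReal)) := measurable_one.indicator hA
    rw [← lintegral_indicator_one hA, lintegral_target_compProd hf hσ hpos hF,
      ← lintegral_indicator_one hA, lintegral_add_measure, hρ₁, hρ₂, lintegral_smul_measure,
      lintegral_withDensity_eq_lintegral_mul _ hfm hF, lintegral_map hF (by fun_prop),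
      lintegral_withDensity_eq_lintegral_mul (f := fun x => 1 - properMoveProb f r σ x)
        (g := fun x => A.indicator 1 (x, x)) _ (by fun_prop)
        (hF.comp (f := fun x => (x, x)) (by fun_prop)),
      lintegral_prod _ (hfm.mul hF).aemeasurable]
    rfl
  have hG : BddMeas (fun z : Vec d × Vec d => g z.1 * g z.2) :=
    (hg.comp measurable_fst).mul (hg.comp measurable_snd)
  have hI := hG.integrable (Q ⊗ₘ metropolisKernel f hf r σ)
  have hI1 : Integrable (fun z : Vec d × Vec d => g z.1 * g z.2) ρ₁ :=
    hI.mono_measure (by rw [hsum]; exact Measure.le_add_right le_rfl)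
  have hI2 : Integrable (fun z : Vec d × Vec d => g z.1 * g z.2) ρ₂ :=
    hI.mono_measure (by rw [hsum]; exact Measure.le_add_left le_rfl)
  rw [hsum, integral_add_measure hI1 hI2]
  refine add_nonneg ?_ ?_
  · rw [hρ₁, integral_smul_measure, integral_withDensity_eq_integral_toReal_smul hfm
      (ae_of_all _ fun _ => ENNReal.ofReal_lt_top)]
    refine smul_nonneg ENNReal.toReal_nonneg ?_
    refine (integral_flowDensity_nonneg hf hσ hf0 htop hg).trans (le_of_eq ?_)
    congr 1
    ext z
    have h0 : 0 ≤ flowDensity f σ z.1 z.2 :=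
      mul_nonneg (le_min (hf0 _) (hf0 _)) (gaussianProposal_nonneg _ _ _)
    rw [ENNReal.toReal_ofReal h0, smul_eq_mul]
  · rw [hρ₂, integral_map (by fun_prop) hG.1.aestronglyMeasurable]
    exact integral_nonneg fun x => mul_self_nonneg _

end MetropolisPositive

/-! ### Mixing of the walk for a nearly Gaussian target -/

section Mixing

variable {d : ℕ}

/-- The target `f` is comparable with the Gaussian weight on the ball `B(0, r)`, and this ball
carries at least half of the Gaussian mass. -/
structure NearGaussian (f : Vec d → ℝ) (r a : ℝ) : Prop where
  measurable : Measurable f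
  nonneg : ∀ x, 0 ≤ f x
  scale_pos : 0 < a
  lower : ∀ x ∈ Metric.closedBall (0 : Vec d) r, a * Real.exp (-‖x‖ ^ 2 / 2) ≤ f x
  upper : ∀ x ∈ Metric.closedBall (0 : Vec d) r, f x ≤ 2 * a * Real.exp (-‖x‖ ^ 2 / 2)
  mass : ENNReal.ofReal ((2 * Real.pi) ^ ((d : ℝ) / 2) / 2) ≤
    ∫⁻ x in Metric.closedBall (0 : Vec d) r, ENNReal.ofReal (Real.exp (-‖x‖ ^ 2 / 2))

namespace NearGaussian

variable {f : Vec d → ℝ} {r a σ : ℝ}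

lemma pos (h : NearGaussian f r a) {x : Vec d} (hx : x ∈ Metric.closedBall (0 : Vec d) r) :
    0 < f x :=
  (mul_pos h.scale_pos (Real.exp_pos _)).trans_le (h.lower x hx)

lemma lintegral_le (h : NearGaussian f r a) :
    ∫⁻ x in Metric.closedBall 0 r, ENNReal.ofReal (f x)
      ≤ ENNReal.ofReal (2 * a) * volume (Metric.closedBall (0 : Vec d) r) := by
  have hK := (Metric.isClosed_closedBall (x := (0 : Vec d)) (ε := r)).measurableSet
  rw [← setLIntegral_const]
  refine setLIntegral_mono measurable_const fun x hx => ENNReal.ofReal_le_ofReal ?_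
  refine (h.upper x hx).trans (mul_le_of_le_one_right (by linarith [h.scale_pos]) ?_)
  rw [Real.exp_le_one_iff]
  have := sq_nonneg ‖x‖
  linarith

lemma lintegral_ne_top (h : NearGaussian f r a) :
    ∫⁻ x in Metric.closedBall 0 r, ENNReal.ofReal (f x) ≠ ⊤ :=
  ne_top_of_le_ne_top (ENNReal.mul_ne_top ENNReal.ofReal_ne_top
    (isCompact_closedBall _ _).measure_lt_top.ne) h.lintegral_le

lemma le_lintegral (h : NearGaussian f r a) :
    ENNReal.ofReal (a * ((2 * Real.pi) ^ ((d : ℝ) / 2) / 2)) ≤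
      ∫⁻ x in Metric.closedBall 0 r, ENNReal.ofReal (f x) := by
  have hK := (Metric.isClosed_closedBall (x := (0 : Vec d)) (ε := r)).measurableSet
  rw [ENNReal.ofReal_mul h.scale_pos.le]
  refine (mul_le_mul_right h.mass _).trans ?_
  rw [← lintegral_const_mul _ (by fun_prop)]
  refine setLIntegral_mono' hK fun x hx => ?_
  rw [← ENNReal.ofReal_mul h.scale_pos.le]
  exact ENNReal.ofReal_le_ofReal (h.lower x hx)

lemma lintegral_ne_zero (h : NearGaussian f r a) :
    ∫⁻ x in Metric.closedBall 0 r, ENNReal.ofReal (f x) ≠ 0 := by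
  have h1 : 0 < ENNReal.ofReal (a * ((2 * Real.pi) ^ ((d : ℝ) / 2) / 2)) := by
    have := h.scale_pos
    exact ENNReal.ofReal_pos.2 (by positivity)
  exact (h1.trans_le h.le_lintegral).ne'

lemma isProbabilityMeasure (h : NearGaussian f r a) : IsProbabilityMeasure (targetMeasure f r) :=
  isProbabilityMeasure_target h.lintegral_ne_zero h.lintegral_ne_top

/-- Up to normalization, the flow of the walk with target `f` dominates that of the walk with
Gaussian target. -/
lemma walkKernel_le (h : NearGaussian f r a) (hσ : 0 < σ) {x y : Vec d}
    (hx : x ∈ Metric.closedBall (0 : Vec d) r) (hy : y ∈ Metric.closedBall (0 : Vec d) r) :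
    walkKernel σ x y ≤ (2 * Real.pi) ^ ((d : ℝ) / 2) / a * flowDensity f σ x y := by
  have ha := h.scale_pos
  have hmin : a * Real.exp (-(max (‖x‖ ^ 2) (‖y‖ ^ 2) / 2)) ≤ min (f x) (f y) := by
    apply le_min
    · refine le_trans ?_ (h.lower x hx)
      gcongr
      have := le_max_left (‖x‖ ^ 2) (‖y‖ ^ 2)
      linarith
    · refine le_trans ?_ (h.lower y hy)
      gcongr
      have := le_max_right (‖x‖ ^ 2) (‖y‖ ^ 2)
      linarith
  have hq : gaussianProposal σ x y = ((2 * Real.pi) ^ ((d : ℝ) / 2))⁻¹ * ((σ ^ d)⁻¹ *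
      Real.exp (-‖x - y‖ ^ 2 / (2 * σ ^ 2))) := by
    unfold gaussianProposal
    rw [norm_sub_rev, Real.mul_rpow (by positivity) (by positivity), neg_div,
      Real.rpow_neg (by positivity), Real.rpow_neg (by positivity), ← Real.rpow_natCast σ 2,
      ← Real.rpow_mul hσ.le]
    have : ((2 : ℕ) : ℝ) * ((d : ℝ) / 2) = d := by push_cast; ring
    rw [this, Real.rpow_natCast, mul_assoc]
  unfold flowDensity walkKernel
  have hW := gaussianProposal_nonneg σ x y
  calc (σ ^ d)⁻¹ * Real.exp (-(max (‖x‖ ^ 2) (‖y‖ ^ 2) / 2) - ‖x - y‖ ^ 2 / (2 * σ ^ 2))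
      = (2 * Real.pi) ^ ((d : ℝ) / 2) / a *
        ((a * Real.exp (-(max (‖x‖ ^ 2) (‖y‖ ^ 2) / 2))) * gaussianProposal σ x y) := by
        rw [hq, sub_eq_add_neg, Real.exp_add, neg_div]
        field_simp
    _ ≤ _ := by gcongr

/-- The variance of a function under the target is bounded by its mean squared increment along one
step of the walk. -/
lemma lintegral_variance_le (h : NearGaussian f r a) (hd : 2 ≤ d) (hr : 0 < r)
    (hrd : 2 * (d : ℝ) ≤ r ^ 2) (hσ : 0 < σ) (hσd : σ * (8 * d) ≤ 1)
    (hσr : 16 * (r ^ 2 * σ ^ 2 * d) ≤ 1) {g : Vec d → ℝ} (hg : Measurable g) :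
    ∫⁻ x, ∫⁻ y, ENNReal.ofReal ((g x - g y) ^ 2) ∂(targetMeasure f r) ∂(targetMeasure f r)
      ≤ ENNReal.ofReal (800 * Real.exp 5 / σ ^ 2) *
        ∫⁻ z, ENNReal.ofReal ((g z.1 - g z.2) ^ 2)
          ∂(targetMeasure f r ⊗ₘ metropolisKernel f h.measurable r σ) := by
  have hK := (Metric.isClosed_closedBall (x := (0 : Vec d)) (ε := r)).measurableSet
  have := h.isProbabilityMeasure
  have ha := h.scale_pos
  have hf := h.measurable
  set Z := ∫⁻ x in Metric.closedBall 0 r, ENNReal.ofReal (f x) with hZ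
  have hZ0 : Z ≠ 0 := h.lintegral_ne_zero
  have hZt : Z ≠ ⊤ := h.lintegral_ne_top
  set G : Vec d → Vec d → ENNReal := fun x y => ENNReal.ofReal ((g x - g y) ^ 2) with hG
  have hGm : Measurable (fun p : Vec d × Vec d => G p.1 p.2) := by simp only [hG]; fun_prop
  have hGx : ∀ x, Measurable (G x) := fun x => by simp only [hG]; fun_prop
  have hfl := (measurable_flowDensity hf σ).ennreal_ofReal
  set T := (2 * Real.pi) ^ ((d : ℝ) / 2) with hT
  have hT0 : 0 < T := by positivity
  have hproduct : ∫⁻ x, ∫⁻ y, G x y ∂(targetMeasure f r) ∂(targetMeasure f r)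
      = Z⁻¹ * (Z⁻¹ * ∫⁻ x in Metric.closedBall 0 r, ∫⁻ y in Metric.closedBall 0 r,
          ENNReal.ofReal (f x) * (ENNReal.ofReal (f y) * G x y)) := by
    have hin : ∀ x, ∫⁻ y, G x y ∂(targetMeasure f r)
        = Z⁻¹ * ∫⁻ y in Metric.closedBall 0 r, ENNReal.ofReal (f y) * G x y := fun x =>
      lintegral_targetMeasure hf r (hGx x)
    simp_rw [hin]
    have hm : Measurable (fun x => ∫⁻ y in Metric.closedBall 0 r, ENNReal.ofReal (f y) * G x y) :=
      Measurable.lintegral_prod_right' (f := fun p : Vec d × Vec d => ENNReal.ofReal (f p.2)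
        * G p.1 p.2) (by fun_prop)
    rw [lintegral_const_mul _ hm, lintegral_targetMeasure hf r hm, mul_left_comm]
    congr 3
    funext x
    rw [lintegral_const_mul]
    have := hGx x
    fun_prop
  have hgaussPair : ∫⁻ x in Metric.closedBall 0 r, ∫⁻ y in Metric.closedBall 0 r,
          ENNReal.ofReal (f x) * (ENNReal.ofReal (f y) * G x y)
      ≤ ENNReal.ofReal (4 * a ^ 2) * ∫⁻ x in Metric.closedBall 0 r,
        ∫⁻ y in Metric.closedBall 0 r, G x y * gaussPair (x, y) := by
    have hgp := measurable_gaussPair (d := d)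
    rw [← lintegral_const_mul]
    · refine setLIntegral_mono' hK fun x hx => ?_
      rw [← lintegral_const_mul]
      · refine setLIntegral_mono' hK fun y hy => ?_
        rw [← mul_assoc, mul_left_comm, mul_comm (G x y)]
        refine mul_le_mul_left ?_ _
        unfold gaussPair
        rw [← ENNReal.ofReal_mul (h.nonneg x), ← ENNReal.ofReal_mul (by positivity)]
        apply ENNReal.ofReal_le_ofReal
        have hfx := h.upper x hx
        have hfy := h.upper y hy
        calc f x * f y ≤ (2 * a * Real.exp (-‖x‖ ^ 2 / 2)) * (2 * a * Real.exp (-‖y‖ ^ 2 / 2)) :=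
              mul_le_mul hfx hfy (h.nonneg y) (by positivity)
          _ = 4 * a ^ 2 * (Real.exp (-‖x‖ ^ 2 / 2) * Real.exp (-‖y‖ ^ 2 / 2)) := by ring
          _ = _ := by rw [← Real.exp_add]; congr 2; ring
      · have := hGx x
        fun_prop
    · exact Measurable.lintegral_prod_right' (f := fun p : Vec d × Vec d => G p.1 p.2 *
        gaussPair p) (by fun_prop)
  have hpoincare := ball_poincare hd hr hrd hσ hσd hσr hg
  have hdominated : ∫⁻ x in Metric.closedBall 0 r, ∫⁻ y in Metric.closedBall 0 r,
          G x y * ENNReal.ofReal (walkKernel σ x y)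
      ≤ ENNReal.ofReal (T / a) * ∫⁻ x in Metric.closedBall 0 r,
        ∫⁻ y in Metric.closedBall 0 r, ENNReal.ofReal (flowDensity f σ x y) * G x y := by
    rw [← lintegral_const_mul]
    · refine setLIntegral_mono' hK fun x hx => ?_
      rw [← lintegral_const_mul]
      · refine setLIntegral_mono' hK fun y hy => ?_
        rw [← mul_assoc, mul_comm]
        gcongr
        rw [← ENNReal.ofReal_mul (by positivity)]
        exact ENNReal.ofReal_le_ofReal (h.walkKernel_le hσ hx hy)
      · exact (hfl.mul hGm).comp measurable_prodMk_left
    · exact Measurable.lintegral_prod_right' (hfl.mul hGm)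
  have hwalkStep : Z⁻¹ * ∫⁻ x in Metric.closedBall 0 r, ∫⁻ y in Metric.closedBall 0 r,
        ENNReal.ofReal (flowDensity f σ x y) * G x y
      ≤ ∫⁻ z, G z.1 z.2 ∂(targetMeasure f r ⊗ₘ metropolisKernel f hf r σ) := by
    rw [lintegral_target_compProd hf hσ (fun x hx => h.pos hx) hGm]
    exact le_self_add
  set I := ∫⁻ x in Metric.closedBall 0 r, ∫⁻ y in Metric.closedBall 0 r,
        ENNReal.ofReal (flowDensity f σ x y) * G x y with hI
  rw [hproduct]
  have hconst : ENNReal.ofReal (4 * a ^ 2) * (ENNReal.ofReal (100 * Real.exp 5 / σ ^ 2) *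
      ENNReal.ofReal (T / a)) ≤ Z * ENNReal.ofReal (800 * Real.exp 5 / σ ^ 2) := by
    refine le_trans (le_of_eq ?_) (mul_le_mul_left h.le_lintegral _)
    rw [← ENNReal.ofReal_mul (by positivity), ← ENNReal.ofReal_mul (by positivity),
      ← ENNReal.ofReal_mul (by positivity)]
    congr 1
    field_simp
    ring
  calc Z⁻¹ * (Z⁻¹ * ∫⁻ x in Metric.closedBall 0 r, ∫⁻ y in Metric.closedBall 0 r,
          ENNReal.ofReal (f x) * (ENNReal.ofReal (f y) * G x y))
      ≤ Z⁻¹ * (Z⁻¹ * (ENNReal.ofReal (4 * a ^ 2) * (ENNReal.ofReal (100 * Real.exp 5 / σ ^ 2) *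
          (ENNReal.ofReal (T / a) * I)))) := by
        gcongr
        exact hgaussPair.trans (mul_le_mul_right (hpoincare.trans (mul_le_mul_right hdominated _)) _)
    _ = Z⁻¹ * ((ENNReal.ofReal (4 * a ^ 2) * (ENNReal.ofReal (100 * Real.exp 5 / σ ^ 2) *
          ENNReal.ofReal (T / a))) * (Z⁻¹ * I)) := by ring
    _ ≤ Z⁻¹ * ((Z * ENNReal.ofReal (800 * Real.exp 5 / σ ^ 2)) * (Z⁻¹ * I)) := by gcongr
    _ = (Z⁻¹ * Z) * (ENNReal.ofReal (800 * Real.exp 5 / σ ^ 2) * (Z⁻¹ * I)) := by ring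
    _ ≤ _ := by
        rw [ENNReal.inv_mul_cancel hZ0 hZt, one_mul]
        gcongr

/-- A spectral gap of order `σ²`: the variance of `g` is half the mean of `(g x - g y)²` over
independent `x` and `y`, and `E g² - E g P g` is half its mean over two successive states. -/
lemma spectral_gap (h : NearGaussian f r a) (hd : 2 ≤ d) (hr : 0 < r)
    (hrd : 2 * (d : ℝ) ≤ r ^ 2) (hσ : 0 < σ) (hσd : σ * (8 * d) ≤ 1)
    (hσr : 16 * (r ^ 2 * σ ^ 2 * d) ≤ 1) {g : Vec d → ℝ} (hg : BddMeas g)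
    (h0 : ∫ x, g x ∂(targetMeasure f r) = 0) :
    ∫ x, g x * markovOp (metropolisKernel f h.measurable r σ) g x ∂(targetMeasure f r)
      ≤ (1 - σ ^ 2 / (800 * Real.exp 5)) * ∫ x, g x ^ 2 ∂(targetMeasure f r) := by
  have hvar := h.lintegral_variance_le hd hr hrd hσ hσd hσr hg.1
  have := h.isProbabilityMeasure
  have := isMarkovKernel_metropolis f h.measurable r hσ
  have hsymm := target_compProd_symm h.measurable hσ (fun x hx => h.pos hx)
  set Q := targetMeasure f r
  set κ := metropolisKernel f h.measurable r σ
  have hg2 : BddMeas (fun x => g x ^ 2) := by simpa [sq] using hg.mul hg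
  have hb1 : BddMeas (fun z : Vec d × Vec d => g z.1) := hg.comp measurable_fst
  have hb2 : BddMeas (fun z : Vec d × Vec d => g z.2) := hg.comp measurable_snd
  have hb11 : BddMeas (fun z : Vec d × Vec d => g z.1 ^ 2) := hg2.comp measurable_fst
  have hb22 : BddMeas (fun z : Vec d × Vec d => g z.2 ^ 2) := hg2.comp measurable_snd
  have hb12 := (hb1.mul hb2).const_mul (-2)
  have hexp : (fun z : Vec d × Vec d => (g z.1 - g z.2) ^ 2)
      = fun z => (g z.1 ^ 2 + g z.2 ^ 2) + -2 * (g z.1 * g z.2) := by ext z; ring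
  have hD : BddMeas (fun z : Vec d × Vec d => (g z.1 - g z.2) ^ 2) := by
    rw [hexp]; exact (hb11.add hb22).add hb12
  have hone : BddMeas (fun _ : Vec d => (1 : ℝ)) := ⟨measurable_const, 1, by simp⟩
  -- both mean squared increments, expanded
  have hL : ∫ z, (g z.1 - g z.2) ^ 2 ∂(Q.prod Q) = 2 * ∫ x, g x ^ 2 ∂Q := by
    rw [hexp, integral_add ((hb11.add hb22).integrable _) (hb12.integrable _),
      integral_add (hb11.integrable _) (hb22.integrable _), integral_const_mul,
      integral_prod_mul, h0]
    have e1 := integral_prod_mul (μ := Q) (ν := Q) (fun x => g x ^ 2) (fun _ => (1 : ℝ))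
    have e2 := integral_prod_mul (μ := Q) (ν := Q) (fun _ => (1 : ℝ)) (fun x => g x ^ 2)
    simp only [mul_one, one_mul, integral_const, probReal_univ, smul_eq_mul] at e1 e2
    rw [e1, e2]; ring
  have hR : ∫ z, (g z.1 - g z.2) ^ 2 ∂(Q ⊗ₘ κ)
      = 2 * ∫ x, g x ^ 2 ∂Q - 2 * ∫ x, g x * markovOp κ g x ∂Q := by
    rw [hexp, integral_add ((hb11.add hb22).integrable _) (hb12.integrable _),
      integral_add (hb11.integrable _) (hb22.integrable _), integral_const_mul,
      integral_mul_markovOp hg hg]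
    have e1 := integral_mul_markovOp (κ := κ) (Q := Q) hg2 hone
    have e2 := integral_mul_markovOp (κ := κ) (Q := Q) hone hg2
    have e3 : ∫ x, markovOp κ (fun x => g x ^ 2) x ∂Q = _ := integral_markovOp hsymm hg2
    simp only [mul_one, one_mul] at e1 e2
    rw [e1, e2, e3]
    simp [markovOp]
    ring
  have hle : ∫ z, (g z.1 - g z.2) ^ 2 ∂(Q.prod Q)
      ≤ 800 * Real.exp 5 / σ ^ 2 * ∫ z, (g z.1 - g z.2) ^ 2 ∂(Q ⊗ₘ κ) := by
    have hGm : Measurable (fun z : Vec d × Vec d => ENNReal.ofReal ((g z.1 - g z.2) ^ 2)) :=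
      hD.1.ennreal_ofReal
    rw [← lintegral_prod (f := fun z : Vec d × Vec d => ENNReal.ofReal ((g z.1 - g z.2) ^ 2))
      hGm.aemeasurable,
      ← ofReal_integral_eq_lintegral_ofReal (hD.integrable _) (ae_of_all _ fun _ => sq_nonneg _),
      ← ofReal_integral_eq_lintegral_ofReal (hD.integrable _) (ae_of_all _ fun _ => sq_nonneg _),
      ← ENNReal.ofReal_mul (by positivity), ENNReal.ofReal_le_ofReal_iff] at hvar
    · exact hvar
    · exact mul_nonneg (by positivity) (integral_nonneg fun _ => sq_nonneg _)
  rw [hL, hR] at hle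
  have hΓ : 0 < 800 * Real.exp 5 := by positivity
  have hs2 : 0 < σ ^ 2 := by positivity
  rw [div_mul_eq_mul_div, le_div_iff₀ hs2] at hle
  rw [sub_mul, one_mul, div_mul_eq_mul_div, le_sub_iff_add_le, ← le_sub_iff_add_le',
    div_le_iff₀ hΓ]
  linarith

lemma mixesFromWarmStart (h : NearGaussian f r a) (hd : 2 ≤ d) (hr : 0 < r)
    (hrd : 2 * (d : ℝ) ≤ r ^ 2) (hσ : 0 < σ) (hσd : σ * (8 * d) ≤ 1)
    (hσr : 16 * (r ^ 2 * σ ^ 2 * d) ≤ 1) {B : ℝ}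
    (hB : 800 * Real.exp 5 / σ ^ 2 ≤ B * (d : ℝ) ^ 2) : MixesFromWarmStart f r σ B := by
  intro M ε hM hε hε1 Q₀ hQ₀ hwarm t ht A hA
  have := h.isProbabilityMeasure
  have := isMarkovKernel_metropolis f h.measurable r hσ
  have hsymm := target_compProd_symm h.measurable hσ (fun x hx => h.pos hx)
  have hwarm' : Q₀ ≤ ENNReal.ofReal M • targetMeasure f r :=
    Measure.le_iff.2 fun s hs => hwarm s hs
  have hd2 : (2 : ℝ) ≤ d := by exact_mod_cast hd
  have hσ1 : σ ≤ 1 := by nlinarith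
  have he5 : 1 ≤ Real.exp 5 := Real.one_le_exp (by norm_num)
  set q := σ ^ 2 / (800 * Real.exp 5) with hq
  have hq0 : 0 < q := by positivity
  have hq1 : q ≤ 1 := by
    rw [hq, div_le_one (by positivity)]
    nlinarith
  have hmix := abs_iterate_bind_sub_le hsymm
    (fun g hg => metropolis_positive h.measurable hσ h.nonneg (fun x hx => h.pos hx)
      h.lintegral_ne_top hg) (θ := 1 - q) (by linarith)
    (fun g hg h0 => h.spectral_gap hd hr hrd hσ hσd hσr hg h0) t hM hwarm' hA
  refine le_trans hmix ?_
  have hlog : 0 ≤ Real.log (M / ε) := Real.log_nonneg (by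
    rw [le_div_iff₀ hε]; linarith)
  have ht' : Real.log (M / ε) ≤ q * t := by
    have h1 : 800 * Real.exp 5 / σ ^ 2 * Real.log (M / ε) ≤ t :=
      (mul_le_mul_of_nonneg_right hB hlog).trans ht
    have h2 : 800 * Real.exp 5 / σ ^ 2 = q⁻¹ := by rw [hq, inv_div]
    rw [h2, inv_mul_le_iff₀ hq0] at h1
    exact h1
  have hpow : (1 - q) ^ t ≤ Real.exp (-(q * t)) := by
    calc (1 - q) ^ t ≤ (Real.exp (-q)) ^ t := by
          gcongr
          exact Real.one_sub_le_exp_neg q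
      _ = _ := by rw [← Real.exp_nat_mul]; congr 1; ring
  calc M * (1 - q) ^ t ≤ M * Real.exp (-(Real.log (M / ε))) := by
        gcongr
        exact hpow.trans (Real.exp_le_exp.2 (neg_le_neg ht'))
    _ = ε := by
        rw [Real.exp_neg, Real.exp_log (by positivity)]
        field_simp

/-- The probability of a proper move is at least of the order of the mass that the proposal puts
on a ball of radius `σ / 2` inside `B(0, r)` at distance at most `σ` from the current state. -/
lemma le_properMoveProb (h : NearGaussian f r a) (hr : 0 < r) (hσ : 0 < σ) (hσr2 : σ ≤ 2 * r)
    (hσr : 4 * (r * σ) ≤ 1) {u : Vec d} (hu : u ∈ Metric.closedBall (0 : Vec d) r) :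
    ENNReal.ofReal ((2 * Real.pi * σ ^ 2) ^ (-(d : ℝ) / 2) * (Real.exp (-1) / 2) * (σ / 2) ^ d) *
      volume (Metric.closedBall (0 : Vec d) 1) ≤ properMoveProb f r σ u := by
  have hur : ‖u‖ ≤ r := mem_closedBall_zero_iff.1 hu
  have ha := h.scale_pos
  set c : Vec d := (1 - σ / (2 * r)) • u with hc
  have hfrac : σ / (2 * r) ≤ 1 := by rw [div_le_one (by positivity)]; exact hσr2
  have hfrac0 : 0 ≤ σ / (2 * r) := by positivity
  have hcn : ‖c‖ ≤ r - σ / 2 := by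
    rw [hc, norm_smul, Real.norm_eq_abs, abs_of_nonneg (by linarith)]
    calc (1 - σ / (2 * r)) * ‖u‖ ≤ (1 - σ / (2 * r)) * r := by gcongr
      _ = r - σ / 2 := by field_simp
  have hcu : ‖c - u‖ ≤ σ / 2 := by
    have : c - u = -(σ / (2 * r)) • u := by rw [hc]; module
    rw [this, norm_smul, norm_neg, Real.norm_eq_abs, abs_of_nonneg hfrac0]
    calc σ / (2 * r) * ‖u‖ ≤ σ / (2 * r) * r := by gcongr
      _ = σ / 2 := by field_simp
  have hsub : Metric.closedBall c (σ / 2) ⊆ Metric.closedBall 0 r := by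
    intro x hx
    rw [mem_closedBall_iff_norm] at hx
    rw [mem_closedBall_zero_iff]
    calc ‖x‖ = ‖(x - c) + c‖ := by abel_nf
      _ ≤ _ := (norm_add_le _ _).trans (by linarith)
  have hB := (Metric.isClosed_closedBall (x := c) (ε := σ / 2)).measurableSet
  have hdens : ∀ x ∈ Metric.closedBall c (σ / 2),
      (2 * Real.pi * σ ^ 2) ^ (-(d : ℝ) / 2) * (Real.exp (-1) / 2)
        ≤ min (f x / f u) 1 * gaussianProposal σ u x := by
    intro x hx
    have hxK := hsub hx
    have hxr : ‖x‖ ≤ r := mem_closedBall_zero_iff.1 hxK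
    rw [mem_closedBall_iff_norm] at hx
    have hxu : ‖x - u‖ ≤ σ := by
      calc ‖x - u‖ = ‖(x - c) + (c - u)‖ := by abel_nf
        _ ≤ _ := (norm_add_le _ _).trans (by linarith)
    have hratio : Real.exp (-1 / 2) / 2 ≤ min (f x / f u) 1 := by
      apply le_min
      · rw [le_div_iff₀ (h.pos hu)]
        have hdiff : ‖x‖ ^ 2 - ‖u‖ ^ 2 ≤ 1 := by
          have h1 : ‖x‖ - ‖u‖ ≤ σ := (norm_sub_norm_le x u).trans hxu
          have h2 : (‖x‖ - ‖u‖) * (‖x‖ + ‖u‖) ≤ σ * (r + r) := by gcongr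
          nlinarith
        calc Real.exp (-1 / 2) / 2 * f u
            ≤ Real.exp (-1 / 2) / 2 * (2 * a * Real.exp (-‖u‖ ^ 2 / 2)) := by
              gcongr; exact h.upper u hu
          _ = a * (Real.exp (-1 / 2) * Real.exp (-‖u‖ ^ 2 / 2)) := by ring
          _ ≤ a * Real.exp (-‖x‖ ^ 2 / 2) := by
              rw [← Real.exp_add]
              gcongr
              linarith
          _ ≤ f x := h.lower x hxK
      · have : Real.exp (-1 / 2) ≤ 1 := Real.exp_le_one_iff.2 (by norm_num)
        linarith
    have hgauss : (2 * Real.pi * σ ^ 2) ^ (-(d : ℝ) / 2) * Real.exp (-1 / 2)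
        ≤ gaussianProposal σ u x := by
      unfold gaussianProposal
      refine mul_le_mul_of_nonneg_left (Real.exp_le_exp.2 ?_) (by positivity)
      rw [div_le_div_iff₀ (by norm_num) (by positivity)]
      have : ‖x - u‖ ^ 2 ≤ σ ^ 2 := by gcongr
      linarith
    calc (2 * Real.pi * σ ^ 2) ^ (-(d : ℝ) / 2) * (Real.exp (-1) / 2)
        = Real.exp (-1 / 2) / 2 * ((2 * Real.pi * σ ^ 2) ^ (-(d : ℝ) / 2) * Real.exp (-1 / 2)) := by
          have he : Real.exp (-1) = Real.exp (-1 / 2) * Real.exp (-1 / 2) := by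
            rw [← Real.exp_add]; norm_num
          rw [he]; ring
      _ ≤ _ := mul_le_mul hratio hgauss (by positivity) (le_trans (by positivity) hratio)
  have hvol : ENNReal.ofReal ((σ / 2) ^ d) * volume (Metric.closedBall (0 : Vec d) 1)
      = volume (Metric.closedBall c (σ / 2)) := by
    have := Measure.addHaar_closedBall_mul (volume : Measure (Vec d)) c (r := σ / 2)
      (by positivity) (s := 1) zero_le_one
    simpa using this.symm
  rw [ENNReal.ofReal_mul (by positivity), mul_assoc, hvol, ← setLIntegral_const]
  unfold properMoveProb properMove
  rw [withDensity_apply _ MeasurableSet.univ, Measure.restrict_univ]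
  refine le_trans ?_ (lintegral_mono_set hsub)
  exact setLIntegral_mono' hB fun x hx => ENNReal.ofReal_le_ofReal (hdens x hx)

/-- The law of a proper move is dominated by a multiple of the target. -/
lemma properMove_le (h : NearGaussian f r a) (hr : 0 < r) (hσ : 0 < σ) {u : Vec d}
    (hu : u ∈ Metric.closedBall (0 : Vec d) r) :
    properMove f r σ u ≤ (ENNReal.ofReal ((2 * Real.pi * σ ^ 2) ^ (-(d : ℝ) / 2) *
      (2 * Real.exp (r ^ 2 / 2)) * r ^ d) * volume (Metric.closedBall (0 : Vec d) 1)) •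
        targetMeasure f r := by
  have hur : ‖u‖ ≤ r := mem_closedBall_zero_iff.1 hu
  have hK := (Metric.isClosed_closedBall (x := (0 : Vec d)) (ε := r)).measurableSet
  have ha := h.scale_pos
  have hZ0 := h.lintegral_ne_zero
  have hZt := h.lintegral_ne_top
  have hZle := h.lintegral_le
  set Z := ∫⁻ x in Metric.closedBall 0 r, ENNReal.ofReal (f x) with hZ
  have hvol : volume (Metric.closedBall (0 : Vec d) r)
      = ENNReal.ofReal (r ^ d) * volume (Metric.closedBall (0 : Vec d) 1) := by
    have := Measure.addHaar_closedBall_mul (volume : Measure (Vec d)) 0 (r := r) hr.le (s := 1)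
      zero_le_one
    simpa using this
  refine Measure.le_iff.2 fun A hA => ?_
  rw [targetMeasure_eq, Measure.smul_apply, Measure.smul_apply, smul_eq_mul, smul_eq_mul, ← hZ]
  have hfu : a * Real.exp (-(r ^ 2 / 2)) ≤ f u := by
    refine le_trans ?_ (h.lower u hu)
    gcongr
    have : ‖u‖ ^ 2 ≤ r ^ 2 := by gcongr
    linarith
  have hfu0 : 0 < f u := h.pos hu
  set T := (2 * Real.pi * σ ^ 2) ^ (-(d : ℝ) / 2) with hT
  have hT0 : 0 < T := by positivity
  have hb : properMove f r σ u A ≤ ENNReal.ofReal (T / f u) *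
      (volume.restrict (Metric.closedBall 0 r)).withDensity (fun x => ENNReal.ofReal (f x)) A := by
    unfold properMove
    rw [withDensity_apply _ hA, withDensity_apply _ hA, ← lintegral_const_mul _
      (h.measurable.ennreal_ofReal)]
    refine lintegral_mono fun x => ?_
    rw [← ENNReal.ofReal_mul (by positivity)]
    apply ENNReal.ofReal_le_ofReal
    have hq : gaussianProposal σ u x ≤ T := by
      unfold gaussianProposal
      refine mul_le_of_le_one_right hT0.le (Real.exp_le_one_iff.2 ?_)
      rw [neg_div, neg_nonpos]; positivity
    calc min (f x / f u) 1 * gaussianProposal σ u x ≤ (f x / f u) * T :=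
          mul_le_mul (min_le_left _ _) hq (gaussianProposal_nonneg _ _ _)
            (div_nonneg (h.nonneg x) hfu0.le)
      _ = T / f u * f x := by ring
  have hconst : ENNReal.ofReal (T / f u) * Z ≤ ENNReal.ofReal (T * (2 * Real.exp (r ^ 2 / 2)) *
      r ^ d) * volume (Metric.closedBall (0 : Vec d) 1) := by
    refine (mul_le_mul_right hZle _).trans ?_
    rw [hvol, ← mul_assoc, ← mul_assoc, ← ENNReal.ofReal_mul (by positivity),
      ← ENNReal.ofReal_mul (by positivity)]
    refine mul_le_mul_left (ENNReal.ofReal_le_ofReal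
      (mul_le_mul_of_nonneg_right ?_ (by positivity))) _
    rw [div_mul_eq_mul_div, div_le_iff₀ hfu0]
    have h1 : T * (2 * a) = T * (2 * Real.exp (r ^ 2 / 2)) * (a * Real.exp (-(r ^ 2 / 2))) := by
      rw [Real.exp_neg]; field_simp
    rw [h1]
    gcongr
  calc properMove f r σ u A ≤ ENNReal.ofReal (T / f u) * (volume.restrict
        (Metric.closedBall 0 r)).withDensity (fun x => ENNReal.ofReal (f x)) A := hb
    _ = (ENNReal.ofReal (T / f u) * Z) * (Z⁻¹ * (volume.restrict
        (Metric.closedBall 0 r)).withDensity (fun x => ENNReal.ofReal (f x)) A) := by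
        rw [mul_assoc, ← mul_assoc Z, ENNReal.mul_inv_cancel hZ0 hZt, one_mul]
    _ ≤ _ := by gcongr

/-- The law of a first proper move is warm; the volume of the unit ball cancels in the constant. -/
lemma isWarm_properStart (h : NearGaussian f r a) (hr : 0 < r) (hσ : 0 < σ) (hσr2 : σ ≤ 2 * r)
    (hσr : 4 * (r * σ) ≤ 1) {u : Vec d} (hu : u ∈ Metric.closedBall (0 : Vec d) r) :
    IsProbabilityMeasure (properStart f r σ u) ∧
      IsWarm (4 * Real.exp (1 + r ^ 2 / 2) * (2 * r / σ) ^ d) (properStart f r σ u)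
        (targetMeasure f r) := by
  have hp := h.le_properMoveProb hr hσ hσr2 hσr hu
  have hm := h.properMove_le hr hσ hu
  set ω := volume (Metric.closedBall (0 : Vec d) 1) with hω
  have hω0 : ω ≠ 0 := (Metric.measure_closedBall_pos _ _ one_pos).ne'
  have hωt : ω ≠ ⊤ := (isCompact_closedBall _ _).measure_lt_top.ne
  set T := (2 * Real.pi * σ ^ 2) ^ (-(d : ℝ) / 2) with hT
  have hT0 : 0 < T := by positivity
  have hp1 := properMoveProb_le_one f r hσ u
  have hp0 : properMoveProb f r σ u ≠ 0 := by
    refine (lt_of_lt_of_le ?_ hp).ne'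
    exact ENNReal.mul_pos (ENNReal.ofReal_pos.2 (by positivity)).ne' hω0
  have hpt : properMoveProb f r σ u ≠ ⊤ := ne_top_of_le_ne_top ENNReal.one_ne_top hp1
  refine ⟨⟨?_⟩, fun A hA => ?_⟩
  · unfold properStart
    rw [Measure.smul_apply, smul_eq_mul]
    exact ENNReal.inv_mul_cancel hp0 hpt
  · unfold properStart
    rw [Measure.smul_apply, smul_eq_mul, mul_comm, ← div_eq_mul_inv,
      ENNReal.div_le_iff hp0 hpt]
    refine (hm A).trans ?_
    rw [Measure.smul_apply, smul_eq_mul]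
    refine le_trans (mul_le_mul_left ?_ _) (le_of_eq (mul_right_comm _ _ _))
    refine le_trans (le_of_eq ?_) (mul_le_mul_right hp _)
    rw [← mul_assoc (ENNReal.ofReal (4 * _ * _)), ← ENNReal.ofReal_mul (by positivity)]
    congr 2
    rw [Real.exp_add, Real.exp_neg, div_pow, div_pow, mul_pow]
    field_simp
    norm_num

/-- A first proper move reduces the general case to a warm start, whose constant enters through its
logarithm. -/
lemma mixesFromAnyPoint (h : NearGaussian f r a) (hd : 1 ≤ d) (hr : 0 < r) (hσ : 0 < σ)
    (hσr2 : σ ≤ 2 * r) (hσr : 4 * (r * σ) ≤ 1) {B L : ℝ} (hB : 0 ≤ B) (hL : 1 ≤ L)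
    (hlog : Real.log (4 * Real.exp (1 + r ^ 2 / 2) * (2 * r / σ) ^ d) ≤ L * (d * Real.log d))
    (hmix : MixesFromWarmStart f r σ B) : MixesFromAnyPoint f r σ (B * L) := by
  intro ε hε hε1 u hu t ht
  obtain ⟨hprob, hwarm⟩ := h.isWarm_properStart hr hσ hσr2 hσr hu
  set M := 4 * Real.exp (1 + r ^ 2 / 2) * (2 * r / σ) ^ d with hM
  have hM1 : 1 ≤ M := by
    have h1 : 1 ≤ Real.exp (1 + r ^ 2 / 2) := Real.one_le_exp (by positivity)
    have h2 : 1 ≤ (2 * r / σ) ^ d := one_le_pow₀ (by rw [le_div_iff₀ hσ]; linarith)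
    nlinarith
  refine hmix M ε hM1 hε hε1 _ hprob hwarm t (le_trans ?_ ht)
  have hε2 : 0 ≤ Real.log (1 / ε) := Real.log_nonneg (by rw [le_div_iff₀ hε]; linarith)
  rw [div_eq_mul_one_div, Real.log_mul (by positivity) (by positivity)]
  calc B * (d : ℝ) ^ 2 * (Real.log M + Real.log (1 / ε))
      ≤ B * (d : ℝ) ^ 2 * (L * (d * Real.log d) + L * Real.log (1 / ε)) := by
        gcongr
        exact le_mul_of_one_le_left hε2 hL
    _ = _ := by ring

end NearGaussian

end Mixing

section Scale

variable {d : ℕ}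

/-- For `C ≥ 8` the first term of the minimum in `walkScale` is the smaller one. -/
lemma walkScale_eq (hd : 1 ≤ d) {C : ℝ} (hC : 8 ≤ C) :
    walkScale (ContinuousLinearMap.id ℝ (Vec d)) (C * Real.sqrt d) = 1 / (4 * C * d) := by
  have hd0 : (1 : ℝ) ≤ d := by exact_mod_cast hd
  have : Nonempty (Fin d) := ⟨⟨0, hd⟩⟩
  have hs := Real.mul_self_sqrt (show (0 : ℝ) ≤ d by linarith)
  have hs1 : 1 ≤ Real.sqrt d := Real.one_le_sqrt.2 hd0
  unfold walkScale
  rw [ContinuousLinearMap.norm_id, one_mul]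
  have h1 : 4 * Real.sqrt d * (C * Real.sqrt d) = 4 * C * d := by linear_combination 4 * C * hs
  rw [h1]
  apply min_eq_left
  rw [div_le_div_iff₀ (by positivity) (by positivity)]
  have h2 : 64 * 1 ≤ C * C * Real.sqrt d := by gcongr; nlinarith
  nlinarith

/-- The warmth constant of a first proper move is `exp (O (d ln d))`. -/
lemma log_warmth_le (hd : 2 ≤ d) {C : ℝ} (hC : 8 ≤ C) :
    Real.log (4 * Real.exp (1 + (C * Real.sqrt d) ^ 2 / 2) *
      (2 * (C * Real.sqrt d) / (1 / (4 * C * d))) ^ d) ≤ (20 * C ^ 2) * (d * Real.log d) := by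
  have hd0 : (2 : ℝ) ≤ d := by exact_mod_cast hd
  have hs := Real.sq_sqrt (show (0 : ℝ) ≤ d by linarith)
  have hs0 : 0 < Real.sqrt d := Real.sqrt_pos.2 (by linarith)
  have hlog2 : 1 / 2 ≤ Real.log d := by
    have := Real.log_two_gt_d9
    have h2 := Real.log_le_log (by norm_num) hd0
    linarith
  rw [Real.log_mul (by positivity) (by positivity), Real.log_mul (by norm_num) (by positivity),
    Real.log_exp, Real.log_pow]
  have h4 : Real.log 4 ≤ 3 := by
    have := Real.log_le_sub_one_of_pos (show (0 : ℝ) < 4 by norm_num); linarith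
  have hbase : 2 * (C * Real.sqrt d) / (1 / (4 * C * d)) = (8 * C ^ 2) * (d * Real.sqrt d) := by
    field_simp; ring
  have hlogb : Real.log (2 * (C * Real.sqrt d) / (1 / (4 * C * d))) ≤
      8 * C ^ 2 + 2 * Real.log d := by
    rw [hbase, Real.log_mul (by positivity) (by positivity),
      Real.log_mul (x := (d : ℝ)) (by positivity) (by positivity), Real.log_sqrt (by linarith)]
    have := Real.log_le_sub_one_of_pos (show (0 : ℝ) < 8 * C ^ 2 by positivity)
    linarith
  have h5 : (C * Real.sqrt d) ^ 2 = C ^ 2 * d := by rw [mul_pow, hs]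
  rw [h5]
  have hC2 : 64 ≤ C ^ 2 := by nlinarith
  have h6 : (d : ℝ) * Real.log (2 * (C * Real.sqrt d) / (1 / (4 * C * d))) ≤
      d * (8 * C ^ 2 + 2 * Real.log d) := by gcongr
  have h7 : (d : ℝ) * 1 ≤ d * (2 * Real.log d) := by gcongr; linarith
  have h8 : C ^ 2 * (d * 1) ≤ C ^ 2 * (d * (2 * Real.log d)) := by gcongr
  have h9 : 64 * (d * Real.log d) ≤ C ^ 2 * (d * Real.log d) := by gcongr
  linarith

/-- On the ball of radius `C √d` the step size is `1 / (4 C d)`, the spectral gap is of order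
`1 / d²`, and both mixing bounds hold with a constant that depends on `C` only. -/
lemma NearGaussian.mixes {f : Vec d → ℝ} {C a : ℝ} (hd : 2 ≤ d) (hC : 8 ≤ C)
    (h : NearGaussian f (C * Real.sqrt d) a) :
    MixesFromWarmStart f (C * Real.sqrt d)
        (walkScale (ContinuousLinearMap.id ℝ (Vec d)) (C * Real.sqrt d))
        (12800 * Real.exp 5 * C ^ 2 * (20 * C ^ 2)) ∧
      MixesFromAnyPoint f (C * Real.sqrt d)
        (walkScale (ContinuousLinearMap.id ℝ (Vec d)) (C * Real.sqrt d))
        (12800 * Real.exp 5 * C ^ 2 * (20 * C ^ 2)) := by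
  have hd0 : (2 : ℝ) ≤ d := by exact_mod_cast hd
  have hs := Real.sq_sqrt (show (0 : ℝ) ≤ d by linarith)
  have hs0 : 1 ≤ Real.sqrt d := Real.one_le_sqrt.2 (by linarith)
  rw [walkScale_eq (by omega) hC]
  have hr : 0 < C * Real.sqrt d := by positivity
  have hr2 : (C * Real.sqrt d) ^ 2 = C ^ 2 * d := by rw [mul_pow, hs]
  have hC2 : 64 ≤ C ^ 2 := by nlinarith
  have hσ : 0 < 1 / (4 * C * d) := by positivity
  have hσd : 1 / (4 * C * d) * (8 * d) ≤ 1 := by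
    rw [div_mul_eq_mul_div, div_le_one (by positivity)]; nlinarith
  have hrd : 2 * (d : ℝ) ≤ (C * Real.sqrt d) ^ 2 := by rw [hr2]; nlinarith
  have hσr : 16 * ((C * Real.sqrt d) ^ 2 * (1 / (4 * C * d)) ^ 2 * d) ≤ 1 := by
    rw [hr2]; apply le_of_eq; field_simp; norm_num
  have hσr4 : 4 * (C * Real.sqrt d * (1 / (4 * C * d))) ≤ 1 := by
    have : 4 * (C * Real.sqrt d * (1 / (4 * C * d))) = Real.sqrt d / d := by field_simp
    rw [this, div_le_one (by positivity)]
    nlinarith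
  have hσr2 : 1 / (4 * C * d) ≤ 2 * (C * Real.sqrt d) := by
    have h1 : 1 / (4 * C * d) ≤ 1 := by
      rw [div_le_one (by positivity)]; nlinarith
    nlinarith
  have hB : 800 * Real.exp 5 / (1 / (4 * C * d)) ^ 2 ≤ 12800 * Real.exp 5 * C ^ 2 * (d : ℝ) ^ 2 := by
    apply le_of_eq; field_simp; norm_num
  refine ⟨h.mixesFromWarmStart hd hr hrd hσ hσd hσr (hB.trans ?_),
    h.mixesFromAnyPoint (by omega) hr hσ hσr2 hσr4 (by positivity) (by linarith)
      (log_warmth_le hd hC) (h.mixesFromWarmStart hd hr hrd hσ hσd hσr hB)⟩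
  have : 12800 * Real.exp 5 * C ^ 2 * 1 ≤ 12800 * Real.exp 5 * C ^ 2 * (20 * C ^ 2) := by
    gcongr; linarith
  rw [mul_one] at this
  exact mul_le_mul_of_nonneg_right this (by positivity)

end Scale

/-! ### Expansion of a cumulant generating function -/

section Cumulant

variable {Ω : Type*} [MeasurableSpace Ω] {μ : Measure Ω} {Y : Ω → ℝ}

lemma abs_integral_pow_mul_exp_le {t B : ℝ} (ht : t ∈ interior (integrableExpSet Y μ))
    (hB : ∫ ω, |Y ω| ^ 3 * Real.exp (t * Y ω) ∂μ ≤ B * mgf Y μ t) {k : ℕ} (hk : k ≤ 3) :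
    |∫ ω, Y ω ^ k * Real.exp (t * Y ω) ∂μ| ≤ (1 + B) * mgf Y μ t := by
  have hi := fun k : ℕ => integrable_pow_abs_mul_exp_of_mem_interior_integrableExpSet ht k
  have h0 : Integrable (fun ω => Real.exp (t * Y ω)) μ := by simpa using hi 0
  calc |∫ ω, Y ω ^ k * Real.exp (t * Y ω) ∂μ|
      ≤ ∫ ω, |Y ω ^ k * Real.exp (t * Y ω)| ∂μ := abs_integral_le_integral_abs
    _ ≤ ∫ ω, (Real.exp (t * Y ω) + |Y ω| ^ 3 * Real.exp (t * Y ω)) ∂μ := by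
        refine integral_mono_of_nonneg (ae_of_all _ fun _ => abs_nonneg _) (h0.add (hi 3))
          (ae_of_all _ fun ω => ?_)
        simp only [abs_mul, abs_pow, Real.abs_exp]
        have h1 : |Y ω| ^ k ≤ 1 + |Y ω| ^ 3 := by
          rcases le_total |Y ω| 1 with h | h
          · have := pow_le_one₀ (n := k) (abs_nonneg (Y ω)) h
            have := pow_nonneg (abs_nonneg (Y ω)) 3
            linarith
          · have := pow_le_pow_right₀ h hk
            linarith
        have := mul_le_mul_of_nonneg_right h1 (Real.exp_pos (t * Y ω)).le
        linarith
    _ = mgf Y μ t + ∫ ω, |Y ω| ^ 3 * Real.exp (t * Y ω) ∂μ := by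
        rw [integral_add h0 (hi 3)]; rfl
    _ ≤ _ := by linarith

/-- If the tilted third absolute moments are bounded along `[0, t₀]`, then so is the third
derivative of the cumulant generating function, which is therefore quadratic up to a cubic error. -/
lemma abs_cgf_sub_sq_le [IsProbabilityMeasure μ] {t₀ B : ℝ} (ht₀ : 0 ≤ t₀) (hB0 : 0 ≤ B)
    (hint : ∀ t ∈ Set.Icc 0 t₀, t ∈ interior (integrableExpSet Y μ))
    (hB : ∀ t ∈ Set.Icc 0 t₀, ∫ ω, |Y ω| ^ 3 * Real.exp (t * Y ω) ∂μ ≤ B * mgf Y μ t)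
    (hmean : ∫ ω, Y ω ∂μ = 0) (hvar : ∫ ω, Y ω ^ 2 ∂μ = 1) :
    |cgf Y μ t₀ - t₀ ^ 2 / 2| ≤ 6 * (1 + B) ^ 3 * t₀ ^ 3 := by
  set M : ℕ → ℝ → ℝ := fun k t => ∫ ω, Y ω ^ k * Real.exp (t * Y ω) ∂μ with hM
  have hMd : ∀ k, ∀ t ∈ Set.Icc 0 t₀, HasDerivAt (M k) (M (k + 1) t) t := fun k t ht =>
    hasDerivAt_integral_pow_mul_exp_real (hint t ht) k
  have hM0 : M 0 = mgf Y μ := by ext t; simp [hM, mgf]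
  have hpos : ∀ t ∈ Set.Icc 0 t₀, 0 < M 0 t := fun t ht => by
    rw [hM0]; exact mgf_pos (integrable_of_mem_integrableExpSet (interior_subset (hint t ht)))
  have hbd : ∀ k ≤ 3, ∀ t ∈ Set.Icc 0 t₀, |M k t / M 0 t| ≤ 1 + B := fun k hk t ht => by
    rw [abs_div, abs_of_pos (hpos t ht), div_le_iff₀ (hpos t ht), hM0]
    exact abs_integral_pow_mul_exp_le (hint t ht) (hB t ht) hk
  set D := 1 + B with hD
  have hD1 : 1 ≤ D := by linarith
  set m : ℕ → ℝ → ℝ := fun k t => M k t / M 0 t with hm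
  have hmd : ∀ k, ∀ t ∈ Set.Icc 0 t₀, HasDerivAt (m k) (m (k + 1) t - m k t * m 1 t) t := by
    intro k t ht
    have h := (hMd k t ht).div (hMd 0 t ht) (hpos t ht).ne'
    convert! h using 1
    have := (hpos t ht).ne'
    simp only [hm]
    field_simp
  set v : ℝ → ℝ := fun t => m 2 t - m 1 t ^ 2 with hv
  have hvd : ∀ t ∈ Set.Icc 0 t₀, HasDerivAt v
      ((m 3 t - m 2 t * m 1 t) - 2 * m 1 t * (m 2 t - m 1 t * m 1 t)) t := by
    intro t ht
    have h := (hmd 2 t ht).sub ((hmd 1 t ht).pow 2)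
    convert! h using 1
    simp
  have h00 : (0 : ℝ) ∈ Set.Icc 0 t₀ := ⟨le_rfl, ht₀⟩
  have hm00 : M 0 0 = 1 := by simp [hM]
  have hm10 : m 1 0 = 0 := by simp [hm, hM, hmean]
  have hv0 : v 0 = 1 := by
    have : m 2 0 = 1 := by simp [hm, hM, hvar]
    simp [hv, this, hm10]
  set c := 6 * D ^ 3 with hc
  have hthird : ∀ t ∈ Set.Icc 0 t₀,
      ‖(m 3 t - m 2 t * m 1 t) - 2 * m 1 t * (m 2 t - m 1 t * m 1 t)‖ ≤ c := by
    intro t ht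
    have h1 := hbd 1 (by norm_num) t ht
    have h2 := hbd 2 (by norm_num) t ht
    have h3 := hbd 3 (by norm_num) t ht
    change |m 1 t| ≤ D at h1
    change |m 2 t| ≤ D at h2
    change |m 3 t| ≤ D at h3
    have e21 : |m 2 t * m 1 t| ≤ D ^ 2 := by
      rw [abs_mul, sq]; gcongr
    have e111 : |m 1 t * (m 1 t * m 1 t)| ≤ D ^ 3 := by
      rw [abs_mul, abs_mul, show D ^ 3 = D * (D * D) by ring]; gcongr
    have hD2 : D ≤ D ^ 2 := by nlinarith
    have hD3 : D ^ 2 ≤ D ^ 3 := by nlinarith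
    rw [Real.norm_eq_abs]
    rw [abs_le] at *
    constructor <;> nlinarith
  have hvbd : ∀ t ∈ Set.Icc 0 t₀, ‖v t - 1‖ ≤ c * t₀ := by
    intro t ht
    have h := norm_image_sub_le_of_norm_deriv_le_segment' (f := v)
      (fun x hx => (hvd x hx).hasDerivWithinAt) (fun x hx => hthird x (Set.Ico_subset_Icc_self hx))
      t ht
    rw [hv0, sub_zero] at h
    exact h.trans (by gcongr; exact ht.2)
  have hm1bd : ∀ t ∈ Set.Icc 0 t₀, ‖m 1 t - t‖ ≤ c * t₀ * t₀ := by
    intro t ht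
    have h := norm_image_sub_le_of_norm_deriv_le_segment' (f := fun t => m 1 t - t)
      (f' := fun t => v t - 1)
      (fun x hx => by
        have h1 := ((hmd 1 x hx).sub (hasDerivAt_id x)).hasDerivWithinAt (s := Set.Icc 0 t₀)
        convert! h1 using 1
        simp only [hv]; ring)
      (fun x hx => hvbd x (Set.Ico_subset_Icc_self hx)) t ht
    simp only [hm10, sub_zero] at h
    exact h.trans (by gcongr; exact ht.2)
  have h := norm_image_sub_le_of_norm_deriv_le_segment' (f := fun t => cgf Y μ t - t ^ 2 / 2)
      (f' := fun t => m 1 t - t) (a := 0) (b := t₀)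
      (fun x hx => by
        have h1 := (hMd 0 x hx).log (hpos x hx).ne'
        have h2 : HasDerivAt (fun t : ℝ => t ^ 2 / 2) x x := by
          have := (hasDerivAt_pow 2 x).div_const 2
          convert! this using 1
          simp
        have h3 := (h1.sub h2).hasDerivWithinAt (s := Set.Icc 0 t₀)
        rw [hM0] at h3
        convert! h3 using 1
        simp only [hm, hM0])
      (fun x hx => hm1bd x (Set.Ico_subset_Icc_self hx)) t₀ ⟨ht₀, le_rfl⟩
  simp only [cgf_zero, sub_zero] at h
  norm_num at h
  rw [hc, ← Real.norm_eq_abs] at *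
  refine h.trans (le_of_eq ?_)
  ring

end Cumulant

/-! ### Canonical exponential families -/

namespace ExpModel

variable {d : ℕ} {m : ExpModel d}

lemma exp_logPartition (h0 : m.base ≠ 0) {θ : Vec d}
    (hi : Integrable (fun x => Real.exp (inner ℝ x θ)) m.base) :
    Real.exp (m.logPartition θ) = ∫ x, Real.exp (inner ℝ x θ) ∂m.base := by
  have : NeZero m.base := ⟨h0⟩
  exact Real.exp_log (integral_exp_pos hi)

/-- `ψ` is convex on the natural parameter space. The model's parameter set need not be convex,
so the inequality is stated for two points at which the exponential moment is finite. -/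
lemma logPartition_convex (h0 : m.base ≠ 0) {θ₁ θ₂ : Vec d}
    (h1 : Integrable (fun x => Real.exp (inner ℝ x θ₁)) m.base)
    (h2 : Integrable (fun x => Real.exp (inner ℝ x θ₂)) m.base) {a b : ℝ} (ha : 0 ≤ a)
    (hb : 0 ≤ b) (hab : a + b = 1) :
    m.logPartition (a • θ₁ + b • θ₂) ≤ a * m.logPartition θ₁ + b * m.logPartition θ₂ := by
  have : NeZero m.base := ⟨h0⟩
  set A := m.logPartition θ₁
  set B := m.logPartition θ₂
  have eA := exp_logPartition h0 h1
  have eB := exp_logPartition h0 h2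
  have hpt : ∀ x, Real.exp (inner ℝ x (a • θ₁ + b • θ₂)) ≤ Real.exp (a * A + b * B) *
      (a * (Real.exp (-A) * Real.exp (inner ℝ x θ₁))
        + b * (Real.exp (-B) * Real.exp (inner ℝ x θ₂))) := by
    intro x
    have hc := convexOn_exp.2 (Set.mem_univ (-A + inner ℝ x θ₁)) (Set.mem_univ (-B + inner ℝ x θ₂))
      ha hb hab
    simp only [smul_eq_mul] at hc
    rw [← Real.exp_add, ← Real.exp_add]
    refine le_trans (le_of_eq ?_) (mul_le_mul_of_nonneg_left hc (Real.exp_pos _).le)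
    rw [← Real.exp_add, inner_add_right, inner_smul_right, inner_smul_right]
    congr 1
    ring
  have hdom : Integrable (fun x => Real.exp (a * A + b * B) *
      (a * (Real.exp (-A) * Real.exp (inner ℝ x θ₁))
        + b * (Real.exp (-B) * Real.exp (inner ℝ x θ₂)))) m.base :=
    (((h1.const_mul _).const_mul _).add ((h2.const_mul _).const_mul _)).const_mul _
  have hint : Integrable (fun x => Real.exp (inner ℝ x (a • θ₁ + b • θ₂))) m.base := by
    refine hdom.mono' (by fun_prop) (ae_of_all _ fun x => ?_)
    rw [Real.norm_eq_abs, Real.abs_exp]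
    exact hpt x
  have hle := integral_mono hint hdom hpt
  rw [integral_const_mul, integral_add ((h1.const_mul _).const_mul _) ((h2.const_mul _).const_mul _),
    integral_const_mul, integral_const_mul, integral_const_mul, integral_const_mul, ← eA, ← eB,
    ← Real.exp_add, ← Real.exp_add] at hle
  change _ ≤ Real.exp (a * A + b * B) * (a * Real.exp (-A + A) + b * Real.exp (-B + B)) at hle
  rw [neg_add_cancel, neg_add_cancel, Real.exp_zero, mul_one, mul_one, hab, mul_one] at hle
  unfold logPartition
  rw [Real.log_le_iff_le_exp (integral_exp_pos hint)]
  exact hle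

lemma continuousOn_logPartition (hm : m.IsCanonical) : ContinuousOn m.logPartition m.paramSet := by
  intro θ hθ
  obtain ⟨ε, hε, hball⟩ := Metric.isOpen_iff.1 hm.isOpen θ hθ
  have hconv : ConvexOn ℝ (Metric.ball θ ε) m.logPartition :=
    ⟨convex_ball θ ε, fun x hx y hy a b ha hb hab =>
      logPartition_convex hm.base_ne_zero (hm.integrable x (hball hx)) (hm.integrable y (hball hy))
        ha hb hab⟩
  exact ((hconv.continuousOn Metric.isOpen_ball).continuousAt
    (Metric.ball_mem_nhds θ hε)).continuousWithinAt

lemma integral_law (m : ExpModel d) (θ : Vec d) (F : Vec d → ℝ) :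
    ∫ x, F x ∂(m.law θ) = ∫ x, m.density θ x * F x ∂m.base := by
  unfold law
  rw [integral_withDensity_eq_integral_toReal_smul (by unfold density; fun_prop)
    (ae_of_all _ fun _ => ENNReal.ofReal_lt_top)]
  congr 1
  ext x
  rw [ENNReal.toReal_ofReal (by unfold density; positivity), smul_eq_mul]

lemma integrable_law_iff (m : ExpModel d) (θ : Vec d) (F : Vec d → ℝ) :
    Integrable F (m.law θ) ↔ Integrable (fun x => m.density θ x * F x) m.base := by
  unfold law
  rw [integrable_withDensity_iff_integrable_smul' (by unfold density; fun_prop)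
    (ae_of_all _ fun _ => ENNReal.ofReal_lt_top)]
  refine integrable_congr (ae_of_all _ fun x => ?_)
  beta_reduce
  rw [ENNReal.toReal_ofReal (by unfold density; positivity), smul_eq_mul]

lemma density_eq (m : ExpModel d) (θ x : Vec d) :
    m.density θ x = Real.exp (-m.logPartition θ) * Real.exp (inner ℝ x θ) := by
  unfold density; rw [← Real.exp_add]; congr 1; ring

lemma isProbabilityMeasure_law (h0 : m.base ≠ 0) {θ : Vec d}
    (hi : Integrable (fun x => Real.exp (inner ℝ x θ)) m.base) :
    IsProbabilityMeasure (m.law θ) := by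
  refine ⟨?_⟩
  unfold law
  rw [withDensity_apply _ MeasurableSet.univ, Measure.restrict_univ,
    ← ofReal_integral_eq_lintegral_ofReal]
  · simp_rw [density_eq]
    rw [integral_const_mul, ← exp_logPartition h0 hi, ← Real.exp_add, neg_add_cancel,
      Real.exp_zero, ENNReal.ofReal_one]
  · exact (hi.const_mul _).congr (ae_of_all _ fun x => (density_eq m θ x).symm)
  · exact ae_of_all _ fun x => by unfold density; positivity

end ExpModel

namespace ExpModel

variable {d : ℕ} {m : ExpModel d}

lemma IsCanonical.isProbabilityMeasure (hm : m.IsCanonical) :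
    IsProbabilityMeasure (m.law m.trueParam) :=
  isProbabilityMeasure_law hm.base_ne_zero (hm.integrable _ hm.trueParam_mem)

/-- Moving the parameter by `t η` tilts the law of `⟨η, x - μ⟩` by the factor `exp (t ⟨η, x - μ⟩)`,
up to normalization. -/
lemma density_mul_exp (m : ExpModel d) (η x : Vec d) (t : ℝ) :
    m.density m.trueParam x * Real.exp (t * inner ℝ η (x - m.mean))
      = Real.exp (m.logPartition (m.trueParam + t • η) - m.logPartition m.trueParam
          - t * inner ℝ η m.mean) * m.density (m.trueParam + t • η) x := by
  unfold density
  rw [← Real.exp_add, ← Real.exp_add, inner_add_right, inner_smul_right, inner_sub_right,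
    real_inner_comm x η]
  congr 1
  ring

lemma mem_integrableExpSet (m : ExpModel d) {η : Vec d} {t : ℝ}
    (hi : Integrable (fun x => Real.exp (inner ℝ x (m.trueParam + t • η))) m.base) :
    t ∈ integrableExpSet (fun x => inner ℝ η (x - m.mean)) (m.law m.trueParam) := by
  unfold integrableExpSet
  rw [Set.mem_ofPred_eq, integrable_law_iff]
  simp_rw [density_mul_exp, density_eq m (m.trueParam + t • η)]
  exact (hi.const_mul _).const_mul _

lemma mem_interior_integrableExpSet (hm : m.IsCanonical) {η : Vec d} {t : ℝ}
    (ht : m.trueParam + t • η ∈ m.paramSet) :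
    t ∈ interior (integrableExpSet (fun x => inner ℝ η (x - m.mean)) (m.law m.trueParam)) := by
  have hcont : Continuous (fun t : ℝ => m.trueParam + t • η) := by fun_prop
  refine interior_maximal (s := integrableExpSet _ _) ?_ (hm.isOpen.preimage hcont) ht
  intro t' ht'
  exact m.mem_integrableExpSet (hm.integrable _ ht')

/-- Along a line, `ψ` is the cumulant generating function of a one-dimensional projection. -/
lemma cgf_inner (hm : m.IsCanonical) {η : Vec d} {t : ℝ}
    (ht : m.trueParam + t • η ∈ m.paramSet) :
    cgf (fun x => inner ℝ η (x - m.mean)) (m.law m.trueParam) t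
      = m.logPartition (m.trueParam + t • η) - m.logPartition m.trueParam
          - t * inner ℝ η m.mean := by
  unfold cgf mgf
  rw [integral_law]
  simp_rw [density_mul_exp, density_eq m (m.trueParam + t • η)]
  rw [integral_const_mul, integral_const_mul,
    ← exp_logPartition hm.base_ne_zero (hm.integrable _ ht), ← Real.exp_add, neg_add_cancel,
    Real.exp_zero, mul_one, Real.log_exp]

/-- The covariance condition forces square integrability: otherwise the integral of the square
would be the junk value zero. -/
lemma IsCanonical.memLp (hm : m.IsCanonical) (u : Vec d) :
    MemLp (fun x => inner ℝ u (x - m.mean)) 2 (m.law m.trueParam) := by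
  rw [memLp_two_iff_integrable_sq (by fun_prop)]
  rcases eq_or_ne u 0 with rfl | hu
  · simp
  · by_contra h
    have h1 := hm.covariance u u
    have h2 : (fun x => inner ℝ u (x - m.mean) * inner ℝ u (x - m.mean))
        = fun x => (inner ℝ u (x - m.mean) : ℝ) ^ 2 := by ext x; rw [sq]
    rw [h2, integral_undef h, real_inner_self_eq_norm_sq] at h1
    exact hu (norm_eq_zero.1 (pow_eq_zero_iff two_ne_zero |>.1 h1.symm))

lemma IsCanonical.integrable_sub_mean (hm : m.IsCanonical) :
    Integrable (fun x => x - m.mean) (m.law m.trueParam) := by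
  have := hm.isProbabilityMeasure
  have hcoord : ∀ i : Fin d, Integrable (fun x : Vec d => (x - m.mean) i)
      (m.law m.trueParam) := by
    intro i
    have h := (hm.memLp (EuclideanSpace.single i (1 : ℝ))).integrable one_le_two
    simpa [EuclideanSpace.inner_single_left] using h
  have h1 : Integrable (fun x : Vec d => ∑ i, |(x - m.mean) i|) (m.law m.trueParam) :=
    integrable_finsetSum _ fun i _ => (hcoord i).abs
  refine h1.mono' (by fun_prop) (ae_of_all _ fun x => ?_)
  have h2 := (EuclideanSpace.basisFun (Fin d) ℝ).sum_repr (x - m.mean)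
  calc ‖x - m.mean‖ = ‖∑ i, (EuclideanSpace.basisFun (Fin d) ℝ).repr (x - m.mean) i •
        EuclideanSpace.basisFun (Fin d) ℝ i‖ := by rw [h2]
    _ ≤ ∑ i, ‖(EuclideanSpace.basisFun (Fin d) ℝ).repr (x - m.mean) i •
        EuclideanSpace.basisFun (Fin d) ℝ i‖ := norm_sum_le _ _
    _ = _ := by
        refine Finset.sum_congr rfl fun i _ => ?_
        rw [norm_smul, OrthonormalBasis.norm_eq_one, mul_one]
        simp

lemma IsCanonical.integral_inner_sub_mean (hm : m.IsCanonical) (u : Vec d) :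
    ∫ x, inner ℝ u (x - m.mean) ∂(m.law m.trueParam) = 0 := by
  have := hm.isProbabilityMeasure
  have h := hm.integrable_sub_mean
  have hx : Integrable (fun x : Vec d => x) (m.law m.trueParam) := by
    have := h.add (integrable_const m.mean)
    refine this.congr (ae_of_all _ fun x => ?_)
    simp
  rw [integral_inner h, integral_sub hx (integrable_const _)]
  simp [mean]

/-- The centred and rescaled negative log-likelihood ratio
`Ψ(w) = n ψ(θ₀ + w / √n) - n ψ(θ₀) - √n ⟨μ, w⟩`. -/
def cumulant (m : ExpModel d) (n : ℕ) (w : Vec d) : ℝ :=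
  n * m.logPartition (m.trueParam + (Real.sqrt n)⁻¹ • w) - n * m.logPartition m.trueParam
    - Real.sqrt n * inner ℝ m.mean w

lemma integral_moment_le {n : ℕ} {c b : ℝ} (hb : 0 ≤ b)
    (hmom : m.momentSup n 3 c ≤ ENNReal.ofReal b) {θ η : Vec d} (hθ : θ ∈ m.paramSet)
    (hθc : ‖θ - m.trueParam‖ ^ 2 ≤ c * d / n) (hη : ‖η‖ = 1) :
    ∫ x, |inner ℝ η (x - m.mean)| ^ 3 ∂(m.law θ) ≤ b := by
  rw [integral_eq_lintegral_of_nonneg_ae (ae_of_all _ fun x => by positivity) (by fun_prop)]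
  refine ENNReal.toReal_le_of_le_ofReal hb (le_trans ?_ hmom)
  unfold momentSup
  refine le_iSup₂_of_le θ ⟨hθ, hθc⟩ ?_
  exact le_iSup₂_of_le (f := fun η (_ : η ∈ Metric.sphere (0 : Vec d) 1) =>
    ∫⁻ x, ENNReal.ofReal (|inner ℝ η (x - m.mean)| ^ 3) ∂(m.law θ)) η (by simpa using hη) le_rfl

/-- Third-order expansion of the log-likelihood on the ball `‖w‖² ≤ c d`. -/
lemma abs_cumulant_sub_le (hm : m.IsCanonical) {n : ℕ} (hn : 1 ≤ n) {c b : ℝ} (hb : 0 ≤ b)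
    (hmom : m.momentSup n 3 c ≤ ENNReal.ofReal b)
    (hball : {θ : Vec d | ‖θ - m.trueParam‖ ^ 2 ≤ c * d / n} ⊆ m.paramSet) {w : Vec d}
    (hw : ‖w‖ ^ 2 ≤ c * d) :
    |m.cumulant n w - ‖w‖ ^ 2 / 2| ≤ 6 * (1 + b) ^ 3 * (‖w‖ ^ 3 / Real.sqrt n) := by
  have hn0 : (0 : ℝ) < n := by exact_mod_cast hn
  have hsn : 0 < Real.sqrt n := Real.sqrt_pos.2 hn0
  have hsq := Real.sq_sqrt hn0.le
  rcases eq_or_ne w 0 with rfl | hw0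
  · simp [cumulant]
  have hwn : 0 < ‖w‖ := norm_pos_iff.2 hw0
  set η := ‖w‖⁻¹ • w with hη
  have hη1 : ‖η‖ = 1 := by
    rw [hη, norm_smul, norm_inv, norm_norm, inv_mul_cancel₀ hwn.ne']
  set t₀ := ‖w‖ / Real.sqrt n with ht₀
  have ht₀0 : 0 ≤ t₀ := by positivity
  have htη : t₀ • η = (Real.sqrt n)⁻¹ • w := by
    rw [hη, smul_smul, ht₀]; congr 1; field_simp
  have hin : ∀ t ∈ Set.Icc 0 t₀, ‖m.trueParam + t • η - m.trueParam‖ ^ 2 ≤ c * d / n := by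
    intro t ht
    rw [add_sub_cancel_left, norm_smul, hη1, mul_one, Real.norm_eq_abs, sq_abs]
    calc t ^ 2 ≤ t₀ ^ 2 := by gcongr; exacts [ht.1, ht.2]
      _ = ‖w‖ ^ 2 / n := by rw [ht₀, div_pow, hsq]
      _ ≤ _ := by gcongr
  have hmem : ∀ t ∈ Set.Icc 0 t₀, m.trueParam + t • η ∈ m.paramSet := fun t ht => hball (hin t ht)
  have := hm.isProbabilityMeasure
  have hcgf := abs_cgf_sub_sq_le (μ := m.law m.trueParam) (Y := fun x => inner ℝ η (x - m.mean))
    ht₀0 hb (fun t ht => mem_interior_integrableExpSet hm (hmem t ht))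
    (fun t ht => by
      have hmgf : mgf (fun x => inner ℝ η (x - m.mean)) (m.law m.trueParam) t
          = Real.exp (cgf (fun x => inner ℝ η (x - m.mean)) (m.law m.trueParam) t) :=
        (exp_cgf (m.mem_integrableExpSet (hm.integrable _ (hmem t ht)))).symm
      have h1 : ∫ x, |inner ℝ η (x - m.mean)| ^ 3 * Real.exp (t * inner ℝ η (x - m.mean))
            ∂(m.law m.trueParam)
          = mgf (fun x => inner ℝ η (x - m.mean)) (m.law m.trueParam) t *
            ∫ x, |inner ℝ η (x - m.mean)| ^ 3 ∂(m.law (m.trueParam + t • η)) := by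
        rw [hmgf, cgf_inner hm (hmem t ht), integral_law, integral_law, ← integral_const_mul]
        congr 1
        ext x
        have := m.density_mul_exp η x t
        calc _ = |inner ℝ η (x - m.mean)| ^ 3 * (m.density m.trueParam x *
              Real.exp (t * inner ℝ η (x - m.mean))) := by ring
          _ = _ := by rw [this]; ring
      rw [h1, mul_comm]
      exact mul_le_mul_of_nonneg_right
        (integral_moment_le hb hmom (hmem t ht) (hin t ht) hη1) mgf_nonneg)
    (hm.integral_inner_sub_mean η)
    (by
      have h := hm.covariance η η
      rw [real_inner_self_eq_norm_sq, hη1, one_pow] at h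
      rw [← h]
      congr 1
      ext x
      rw [sq])
  have hΨ : m.cumulant n w = n * cgf (fun x => inner ℝ η (x - m.mean)) (m.law m.trueParam) t₀ := by
    rw [cgf_inner hm (hmem t₀ ⟨ht₀0, le_rfl⟩), htη]
    unfold cumulant
    have h2 : n * (t₀ * inner ℝ η m.mean) = Real.sqrt n * inner ℝ m.mean w := by
      rw [hη, real_inner_smul_left, ht₀, real_inner_comm m.mean w]
      field_simp
      rw [hsq]
    linarith
  have hsq2 : ‖w‖ ^ 2 / 2 = n * (t₀ ^ 2 / 2) := by
    rw [ht₀, div_pow, hsq]; field_simp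
  rw [hΨ, hsq2, ← mul_sub, abs_mul, abs_of_pos hn0]
  calc (n : ℝ) * |_| ≤ n * (6 * (1 + b) ^ 3 * t₀ ^ 3) := by gcongr
    _ = _ := by
      rw [ht₀, div_pow]
      field_simp
      rw [hsq]

/-- The localized likelihood in terms of the centred log-likelihood. -/
lemma localLikelihood_eq (m : ExpModel d) {n : ℕ} (hn : 1 ≤ n) (X : Fin n → Vec d) (x : Vec d) :
    m.localLikelihood X x = Real.exp (inner ℝ (m.score X) x - m.cumulant n (x + m.score X)
        + m.cumulant n (m.score X)) * (m.prior (m.toParam X x) / m.prior (m.toParam X 0)) := by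
  have hn0 : (0 : ℝ) < n := by exact_mod_cast hn
  have hsn : 0 < Real.sqrt n := Real.sqrt_pos.2 hn0
  unfold localLikelihood
  congr 2
  have h1 : Real.sqrt n * inner ℝ (sampleMean X) x
      = Real.sqrt n * inner ℝ m.mean x + inner ℝ (m.score X) x := by
    unfold score
    rw [real_inner_smul_left, inner_sub_left]
    ring
  rw [h1]
  unfold cumulant toParam
  rw [inner_add_right, zero_add]
  ring

/-- The local log-likelihood is concave along rays, so that beyond a sphere it decays at least
linearly at the rate reached on the sphere. -/
lemma logLikelihood_le_of_ray (hm : m.IsCanonical) {n : ℕ} (X : Fin n → Vec d) {x : Vec d}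
    (hx : x ∈ m.localSpace X) (h0 : (0 : Vec d) ∈ m.localSpace X) {κ : ℝ} (hκ : 0 ≤ κ)
    (hκ1 : κ ≤ 1) :
    κ * (inner ℝ (m.score X) x - m.cumulant n (x + m.score X) + m.cumulant n (m.score X))
      ≤ inner ℝ (m.score X) (κ • x) - m.cumulant n (κ • x + m.score X)
        + m.cumulant n (m.score X) := by
  have hconv := logPartition_convex hm.base_ne_zero (hm.integrable _ hx) (hm.integrable _ h0)
    hκ (sub_nonneg.2 hκ1) (add_sub_cancel κ 1)
  have hpt : κ • m.toParam X x + (1 - κ) • m.toParam X 0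
      = m.trueParam + (Real.sqrt n)⁻¹ • (κ • x + m.score X) := by
    unfold toParam; module
  rw [hpt] at hconv
  unfold toParam at hconv
  rw [zero_add] at hconv
  unfold cumulant
  rw [inner_add_right, inner_add_right, inner_smul_right, inner_smul_right]
  have hn : (0 : ℝ) ≤ n := Nat.cast_nonneg n
  nlinarith [mul_le_mul_of_nonneg_left hconv hn]

end ExpModel

/-! ### The score of a sample -/

namespace ExpModel

variable {d : ℕ} {m : ExpModel d}

lemma IsCanonical.memLp_sub_mean (hm : m.IsCanonical) :
    MemLp (fun x => x - m.mean) 2 (m.law m.trueParam) := by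
  have h : (fun x : Vec d => x - m.mean) = fun x => ∑ i,
      (inner ℝ (EuclideanSpace.basisFun (Fin d) ℝ i) (x - m.mean) : ℝ) •
        EuclideanSpace.basisFun (Fin d) ℝ i := by
    ext1 x
    exact ((EuclideanSpace.basisFun (Fin d) ℝ).sum_repr' (x - m.mean)).symm
  rw [h]
  refine memLp_finsetSum _ fun i _ => ?_
  refine (memLp_two_iff_integrable_sq_norm (by fun_prop)).2 ?_
  simp only [norm_smul, OrthonormalBasis.norm_eq_one, mul_one]
  exact (hm.memLp _).integrable_norm_pow two_ne_zero

lemma score_eq (m : ExpModel d) {n : ℕ} (hn : 1 ≤ n) (X : Fin n → Vec d) :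
    m.score X = (Real.sqrt n)⁻¹ • ∑ i, (X i - m.mean) := by
  have hn0 : (0 : ℝ) < n := by exact_mod_cast hn
  have hsn : Real.sqrt n ≠ 0 := (Real.sqrt_pos.2 hn0).ne'
  unfold score sampleMean
  rw [Finset.sum_sub_distrib, Finset.sum_const, Finset.card_univ, Fintype.card_fin, smul_sub,
    smul_sub, smul_smul, ← Nat.cast_smul_eq_nsmul ℝ, smul_smul]
  congr 2
  · field_simp
    rw [Real.sq_sqrt hn0.le]
  · field_simp
    rw [Real.sq_sqrt hn0.le]

variable {n : ℕ} {Ω : Type*} [MeasurableSpace Ω] {P : Measure Ω} {X : Fin n → Ω → Vec d}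

lemma IsSample.measurePreserving (hX : m.IsSample P X) (i : Fin n) :
    MeasurePreserving (X i) P (m.law m.trueParam) :=
  ⟨hX.measurable i, hX.identically i⟩

lemma IsSample.memLp_score [IsProbabilityMeasure P] (hm : m.IsCanonical) (hX : m.IsSample P X)
    (hn : 1 ≤ n) : MemLp (fun ω => m.score fun i => X i ω) 2 P := by
  simp_rw [score_eq m hn]
  have h : MemLp (fun ω => ∑ i, (X i ω - m.mean)) 2 P := memLp_finsetSum _ fun i _ =>
    hm.memLp_sub_mean.comp_measurePreserving (hX.measurePreserving i)
  exact h.const_smul (Real.sqrt n)⁻¹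

lemma IsSample.integral_score [IsProbabilityMeasure P] (hm : m.IsCanonical)
    (hX : m.IsSample P X) (hn : 1 ≤ n) : ∫ ω, m.score (fun i => X i ω) ∂P = 0 := by
  have hint := (hX.memLp_score hm hn).integrable one_le_two
  refine ext_inner_left ℝ fun v => ?_
  rw [inner_zero_right, ← integral_inner hint]
  simp_rw [score_eq m hn, inner_smul_right, inner_sum]
  have hLp : ∀ i, MemLp (fun ω => inner ℝ v (X i ω - m.mean)) 2 P := fun i =>
    (hm.memLp v).comp_measurePreserving (hX.measurePreserving i)
  rw [integral_const_mul, integral_finsetSum _ fun i _ => (hLp i).integrable one_le_two,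
    Finset.sum_eq_zero, mul_zero]
  intro i _
  rw [← hm.integral_inner_sub_mean v, ← (hX.measurePreserving i).map_eq,
    integral_map (hX.measurable i).aemeasurable (by fun_prop)]

lemma IsSample.integral_inner_score_sq [IsProbabilityMeasure P] (hm : m.IsCanonical)
    (hX : m.IsSample P X) (hn : 1 ≤ n) (v : Vec d) :
    ∫ ω, (inner ℝ v (m.score fun i => X i ω)) ^ 2 ∂P = ‖v‖ ^ 2 := by
  have hn0 : (0 : ℝ) < n := by exact_mod_cast hn
  have hLp : ∀ i, MemLp (fun ω => inner ℝ v (X i ω - m.mean)) 2 P := fun i =>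
    (hm.memLp v).comp_measurePreserving (hX.measurePreserving i)
  have hzero : ∀ i, ∫ ω, inner ℝ v (X i ω - m.mean) ∂P = 0 := by
    intro i
    rw [← hm.integral_inner_sub_mean v, ← (hX.measurePreserving i).map_eq,
      integral_map (hX.measurable i).aemeasurable (by fun_prop)]
  have hvar : ∀ i, variance (fun ω => inner ℝ v (X i ω - m.mean)) P = ‖v‖ ^ 2 := by
    intro i
    rw [variance_of_integral_eq_zero (hLp i).aemeasurable (hzero i),
      ← real_inner_self_eq_norm_sq, ← hm.covariance v v, ← (hX.measurePreserving i).map_eq,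
      integral_map (hX.measurable i).aemeasurable (by fun_prop)]
    simp only [sq]
  have hind : iIndepFun (fun i ω => (inner ℝ v (X i ω - m.mean) : ℝ)) P :=
    hX.independent.comp (fun _ x => (inner ℝ v (x - m.mean) : ℝ)) fun _ => by fun_prop
  have hsum := IndepFun.variance_sum (s := Finset.univ) (fun i _ => hLp i)
    (fun i _ j _ hij => hind.indepFun hij)
  rw [variance_of_integral_eq_zero] at hsum
  · simp only [hvar, Finset.sum_const, Finset.card_univ, Fintype.card_fin, nsmul_eq_mul,
      Finset.sum_apply] at hsum
    simp_rw [score_eq m hn, inner_smul_right, inner_sum, mul_pow]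
    rw [integral_const_mul, hsum, inv_pow, Real.sq_sqrt hn0.le]
    field_simp
  · exact (memLp_finsetSum' _ fun i _ => hLp i).aemeasurable
  · simp only [Finset.sum_apply]
    rw [integral_finsetSum _ fun i _ => (hLp i).integrable one_le_two]
    exact Finset.sum_eq_zero fun i _ => hzero i

lemma IsSample.integral_norm_score_sq [IsProbabilityMeasure P] (hm : m.IsCanonical)
    (hX : m.IsSample P X) (hn : 1 ≤ n) :
    ∫ ω, ‖m.score fun i => X i ω‖ ^ 2 ∂P = d := by
  have hLp := hX.memLp_score hm hn
  simp_rw [← (EuclideanSpace.basisFun (Fin d) ℝ).sum_sq_inner_right]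
  rw [integral_finsetSum _ fun i _ => (hLp.const_inner _).integrable_sq]
  simp_rw [hX.integral_inner_score_sq hm hn]
  simp

/-- Chebyshev's inequality for the score, whose covariance is the identity. -/
lemma IsSample.prob_score_large_le [IsProbabilityMeasure P] (hm : m.IsCanonical)
    (hX : m.IsSample P X) (hn : 1 ≤ n) (hd : 1 ≤ d) {a : ℝ} (ha : 0 < a) :
    P {ω | ‖m.score fun i => X i ω‖ ^ 2 ≤ a * d}ᶜ ≤ ENNReal.ofReal (1 / a) := by
  have hd0 : (0 : ℝ) < d := by exact_mod_cast hd
  have hLp := hX.memLp_score hm hn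
  have h := mul_meas_ge_le_integral_of_nonneg (μ := P)
    (f := fun ω => ‖m.score fun i => X i ω‖ ^ 2) (ae_of_all _ fun ω => by positivity)
    (hLp.integrable_norm_pow two_ne_zero) (a * d)
  rw [hX.integral_norm_score_sq hm hn] at h
  have h2 : P.real {ω | a * d ≤ ‖m.score fun i => X i ω‖ ^ 2} ≤ 1 / a := by
    rw [le_div_iff₀ ha]
    refine le_of_mul_le_mul_right ?_ hd0
    linarith
  refine le_trans (measure_mono fun ω hω => ?_)
    ((ENNReal.le_ofReal_iff_toReal_le (measure_ne_top _ _) (by positivity)).2 h2)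
  simp only [Set.mem_compl_iff, Set.mem_ofPred_eq, not_le] at hω
  exact hω.le

end ExpModel

/-! ### Gaussian and exponential tails -/

lemma integral_exp_neg_mul_abs {β : ℝ} (hβ : 0 < β) :
    ∫ t : ℝ, Real.exp (-β * |t|) = 2 / β := by
  rw [integral_comp_abs (f := fun t => Real.exp (-β * t)), integral_exp_mul_Ioi (neg_lt_zero.2 hβ)]
  simp
  field_simp

lemma lintegral_exp_neg_norm_le {d : ℕ} {β : ℝ} (hβ : 0 < β) :
    ∫⁻ x : Vec d, ENNReal.ofReal (Real.exp (-(β * (Real.sqrt d * ‖x‖))))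
      ≤ ENNReal.ofReal ((2 / β) ^ d) := by
  have h1 : Integrable (fun t : ℝ => Real.exp (-β * |t|)) := by
    by_contra h
    have h2 := integral_exp_neg_mul_abs hβ
    rw [integral_undef h] at h2
    have : 0 < 2 / β := by positivity
    linarith
  -- `‖x‖₁ ≤ √d ‖x‖₂` bounds the integrand by a product of one-dimensional densities
  have hpt : ∀ x : Vec d, Real.exp (-(β * (Real.sqrt d * ‖x‖)))
      ≤ ∏ i, Real.exp (-β * |x.ofLp i|) := by
    intro x
    rw [← Real.exp_sum, ← Finset.mul_sum]
    refine Real.exp_le_exp.2 ?_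
    have hcs : (∑ i, |x.ofLp i|) ^ 2 ≤ (d : ℝ) * ‖x‖ ^ 2 := by
      have h := sq_sum_le_card_mul_sum_sq (s := (Finset.univ : Finset (Fin d)))
        (f := fun i => |x.ofLp i|)
      simpa [EuclideanSpace.real_norm_sq_eq] using h
    have h3 : ∑ i, |x.ofLp i| ≤ Real.sqrt d * ‖x‖ := by
      refine Real.le_sqrt_of_sq_le hcs |>.trans (le_of_eq ?_)
      rw [Real.sqrt_mul (Nat.cast_nonneg d), Real.sqrt_sq (norm_nonneg x)]
    nlinarith
  calc ∫⁻ x : Vec d, ENNReal.ofReal (Real.exp (-(β * (Real.sqrt d * ‖x‖))))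
      ≤ ∫⁻ x : Vec d, ENNReal.ofReal (∏ i, Real.exp (-β * |x.ofLp i|)) :=
        lintegral_mono fun x => ENNReal.ofReal_le_ofReal (hpt x)
    _ = ∫⁻ y : Fin d → ℝ, ENNReal.ofReal (∏ i, Real.exp (-β * |y i|)) :=
        (PiLp.volume_preserving_ofLp (Fin d)).lintegral_comp
          (f := fun y : Fin d → ℝ => ENNReal.ofReal (∏ i, Real.exp (-β * |y i|))) (by fun_prop)
    _ = ENNReal.ofReal ((2 / β) ^ d) := by
        have h2 : Integrable (fun y : Fin d → ℝ => ∏ i, Real.exp (-β * |y i|)) :=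
          Integrable.fintype_prod fun _ => h1
        rw [← ofReal_integral_eq_lintegral_ofReal h2 (ae_of_all _ fun y => by positivity),
          integral_fintype_prod_volume_eq_pow (fun t : ℝ => Real.exp (-β * |t|)),
          integral_exp_neg_mul_abs hβ, Fintype.card_fin]

lemma integral_exp_neg_norm_sq {d : ℕ} {b : ℝ} (hb : 0 < b) :
    ∫ x : Vec d, Real.exp (-b * ‖x‖ ^ 2) = (Real.pi / b) ^ ((d : ℝ) / 2) := by
  rw [GaussianFourier.integral_rexp_neg_mul_sq_norm hb, finrank_euclideanSpace_fin]

lemma integrable_exp_neg_norm_sq {d : ℕ} {b : ℝ} (hb : 0 < b) :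
    Integrable fun x : Vec d => Real.exp (-b * ‖x‖ ^ 2) := by
  by_contra h
  have h2 := integral_exp_neg_norm_sq (d := d) hb
  rw [integral_undef h] at h2
  have : 0 < (Real.pi / b) ^ ((d : ℝ) / 2) := by positivity
  linarith

lemma integral_exp_neg_half_norm_sq (d : ℕ) :
    ∫ x : Vec d, Real.exp (-‖x‖ ^ 2 / 2) = (2 * Real.pi) ^ ((d : ℝ) / 2) := by
  have h := integral_exp_neg_norm_sq (d := d) (b := 1 / 2) (by norm_num)
  rw [show Real.pi / (1 / 2) = 2 * Real.pi by ring] at h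
  rw [← h]
  congr 1
  ext x
  ring_nf

lemma integrable_exp_neg_half_norm_sq (d : ℕ) :
    Integrable fun x : Vec d => Real.exp (-‖x‖ ^ 2 / 2) := by
  refine (integrable_exp_neg_norm_sq (d := d) (b := 1 / 2) (by norm_num)).congr
    (ae_of_all _ fun x => ?_)
  simp only
  ring_nf

lemma integral_exp_compl_ball_le {d : ℕ} {C : ℝ} (hC : 8 ≤ C) :
    ∫ x in (Metric.closedBall (0 : Vec d) (C * Real.sqrt d))ᶜ, Real.exp (-‖x‖ ^ 2 / 2)
      ≤ Real.exp (-d) * (2 * Real.pi) ^ ((d : ℝ) / 2) := by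
  have hd0 : (0 : ℝ) ≤ d := Nat.cast_nonneg d
  have hK := (Metric.isClosed_closedBall (x := (0 : Vec d)) (ε := C * Real.sqrt d)).measurableSet
  have hint := (integrable_exp_neg_norm_sq (d := d) (b := 1 / 4) (by norm_num)).const_mul
    (Real.exp (-(2 * d)))
  calc _ ≤ ∫ x in (Metric.closedBall (0 : Vec d) (C * Real.sqrt d))ᶜ,
        Real.exp (-(2 * d)) * Real.exp (-(1 / 4) * ‖x‖ ^ 2) := by
        refine setIntegral_mono_on (integrable_exp_neg_half_norm_sq d).integrableOn
          hint.integrableOn hK.compl fun x hx => ?_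
        rw [← Real.exp_add]
        refine Real.exp_le_exp.2 ?_
        rw [Set.mem_compl_iff, mem_closedBall_zero_iff, not_le] at hx
        have h8 : 8 * Real.sqrt d ≤ ‖x‖ :=
          (mul_le_mul_of_nonneg_right hC (Real.sqrt_nonneg _)).trans hx.le
        have h64 : 64 * (d : ℝ) ≤ ‖x‖ ^ 2 := by
          have := pow_le_pow_left₀ (by positivity) h8 2
          rw [mul_pow, Real.sq_sqrt hd0] at this
          linarith
        linarith
    _ ≤ ∫ x : Vec d, Real.exp (-(2 * d)) * Real.exp (-(1 / 4) * ‖x‖ ^ 2) :=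
        setIntegral_le_integral hint (ae_of_all _ fun x => by positivity)
    _ = Real.exp (-(2 * d)) * ((2 : ℝ) ^ ((d : ℝ) / 2) * (2 * Real.pi) ^ ((d : ℝ) / 2)) := by
        rw [integral_const_mul, integral_exp_neg_norm_sq (by norm_num),
          ← Real.mul_rpow (by norm_num) (by positivity)]
        congr 2
        ring
    _ ≤ Real.exp (-(2 * d)) * (Real.exp d * (2 * Real.pi) ^ ((d : ℝ) / 2)) := by
        gcongr
        calc (2 : ℝ) ^ ((d : ℝ) / 2) ≤ (Real.exp 1) ^ ((d : ℝ) / 2) := by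
              gcongr
              linarith [Real.add_one_le_exp (1 : ℝ)]
          _ = Real.exp (d / 2) := by rw [← Real.exp_mul, one_mul]
          _ ≤ _ := Real.exp_le_exp.2 (by linarith)
    _ = _ := by
        rw [← mul_assoc, ← Real.exp_add]
        congr 2
        ring

/-! ### Quasi-posteriors that are nearly normal on a ball -/

lemma measurable_indicator_of_lowerSemicontinuousOn {d : ℕ} {Λ : Set (Vec d)} {l : Vec d → ℝ}
    (hΛ : IsOpen Λ) (hl : LowerSemicontinuousOn l Λ) (h0 : ∀ x ∈ Λ, 0 ≤ l x) :
    Measurable (Λ.indicator l) := by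
  refine measurable_of_Ioi fun y => ?_
  rcases lt_or_ge y 0 with hy | hy
  · convert MeasurableSet.univ
    refine Set.eq_univ_of_forall fun x => ?_
    by_cases hx : x ∈ Λ
    · simpa [hx] using hy.trans_le (h0 x hx)
    · simpa [hx] using hy
  · obtain ⟨u, hu, hu2⟩ := lowerSemicontinuousOn_iff_preimage_Ioi.1 hl y
    have : Λ.indicator l ⁻¹' Set.Ioi y = Λ ∩ u := by
      rw [← hu2]
      ext x
      by_cases hx : x ∈ Λ
      · simp [hx]
      · simpa [hx] using hy
    rw [this]
    exact (hΛ.inter hu).measurableSet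

/-- A localized likelihood `l` on `Λ` that is within a factor `exp (±δ)` of `exp (-‖x‖² / 2)` on
the ball of radius `r`, and whose mass off that ball, like that of the normal density, is at most
`δ`. -/
structure LocallyGaussian {d : ℕ} (Λ : Set (Vec d)) (l : Vec d → ℝ) (r δ : ℝ) : Prop where
  isOpen : IsOpen Λ
  lsc : LowerSemicontinuousOn l Λ
  nonneg : ∀ x ∈ Λ, 0 ≤ l x
  ball_subset : Metric.closedBall 0 r ⊆ Λ
  approx : ∀ x ∈ Metric.closedBall (0 : Vec d) r, 0 < l x ∧ |Real.log (l x) + ‖x‖ ^ 2 / 2| ≤ δ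
  tail : ∫⁻ x in Λ \ Metric.closedBall 0 r, ENNReal.ofReal (l x) ≤ ENNReal.ofReal δ
  normal_tail : ∫ x in (Metric.closedBall (0 : Vec d) r)ᶜ, Real.exp (-‖x‖ ^ 2 / 2)
    ≤ δ * (2 * Real.pi) ^ ((d : ℝ) / 2)
  error_nonneg : 0 ≤ δ
  error_le : δ ≤ 1 / 4

namespace LocallyGaussian

variable {d : ℕ} {Λ : Set (Vec d)} {l : Vec d → ℝ} {r δ : ℝ}

lemma measurableSet_ball : MeasurableSet (Metric.closedBall (0 : Vec d) r) :=
  Metric.isClosed_closedBall.measurableSet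

lemma le_likelihood (h : LocallyGaussian Λ l r δ) {x : Vec d}
    (hx : x ∈ Metric.closedBall (0 : Vec d) r) :
    (1 - δ) * Real.exp (-‖x‖ ^ 2 / 2) ≤ l x := by
  obtain ⟨h1, h2⟩ := h.approx x hx
  calc (1 - δ) * Real.exp (-‖x‖ ^ 2 / 2) ≤ Real.exp (-δ) * Real.exp (-‖x‖ ^ 2 / 2) := by
        gcongr
        linarith [Real.add_one_le_exp (-δ)]
    _ = Real.exp (-δ + -‖x‖ ^ 2 / 2) := by rw [Real.exp_add]
    _ ≤ Real.exp (Real.log (l x)) := Real.exp_le_exp.2 (by linarith [(abs_le.1 h2).1])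
    _ = l x := Real.exp_log h1

lemma likelihood_le (h : LocallyGaussian Λ l r δ) {x : Vec d}
    (hx : x ∈ Metric.closedBall (0 : Vec d) r) :
    l x ≤ (1 + 2 * δ) * Real.exp (-‖x‖ ^ 2 / 2) := by
  obtain ⟨h1, h2⟩ := h.approx x hx
  have h3 : Real.exp δ ≤ 1 + 2 * δ := by
    have h4 := Real.add_one_le_exp (-δ)
    have h5 : Real.exp δ * Real.exp (-δ) = 1 := by rw [← Real.exp_add]; simp
    have h6 := h.error_nonneg
    have h7 := h.error_le
    have h8 := Real.exp_pos δ
    nlinarith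
  calc l x = Real.exp (Real.log (l x)) := (Real.exp_log h1).symm
    _ ≤ Real.exp (δ + -‖x‖ ^ 2 / 2) := Real.exp_le_exp.2 (by linarith [(abs_le.1 h2).2])
    _ = Real.exp δ * Real.exp (-‖x‖ ^ 2 / 2) := by rw [Real.exp_add]
    _ ≤ _ := by gcongr

lemma integrableOn_ball (h : LocallyGaussian Λ l r δ) :
    IntegrableOn l (Metric.closedBall 0 r) := by
  have hm := measurable_indicator_of_lowerSemicontinuousOn h.isOpen h.lsc h.nonneg
  have h1 : IntegrableOn (Λ.indicator l) (Metric.closedBall 0 r) := by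
    refine Integrable.mono' (((integrable_exp_neg_half_norm_sq d).const_mul (1 + 2 * δ)).integrableOn)
      hm.aestronglyMeasurable ((ae_restrict_iff' measurableSet_ball).2 (ae_of_all _ fun x hx => ?_))
    rw [Set.indicator_of_mem (h.ball_subset hx), Real.norm_eq_abs, abs_of_pos (h.approx x hx).1]
    exact h.likelihood_le hx
  refine h1.congr_fun (fun x hx => ?_) measurableSet_ball
  exact Set.indicator_of_mem (h.ball_subset hx) l

lemma integrableOn_diff (h : LocallyGaussian Λ l r δ) :
    IntegrableOn l (Λ \ Metric.closedBall 0 r) := by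
  have hm := measurable_indicator_of_lowerSemicontinuousOn h.isOpen h.lsc h.nonneg
  have hmeas : MeasurableSet (Λ \ Metric.closedBall 0 r) :=
    h.isOpen.measurableSet.diff measurableSet_ball
  have h1 : IntegrableOn (Λ.indicator l) (Λ \ Metric.closedBall 0 r) := by
    refine ⟨hm.aestronglyMeasurable, ?_⟩
    rw [hasFiniteIntegral_iff_ofReal (ae_of_all _ fun x => Set.indicator_nonneg h.nonneg x)]
    refine lt_of_le_of_lt (le_trans (le_of_eq ?_) h.tail) ENNReal.ofReal_lt_top
    refine setLIntegral_congr_fun hmeas fun x hx => ?_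
    simp only [Set.indicator_of_mem hx.1]
  exact h1.congr_fun (fun x hx => Set.indicator_of_mem hx.1 l) hmeas

lemma integrableOn (h : LocallyGaussian Λ l r δ) : IntegrableOn l Λ := by
  have := h.integrableOn_ball.union h.integrableOn_diff
  rwa [Set.union_sdiff_cancel h.ball_subset] at this

lemma integral_eq_add (h : LocallyGaussian Λ l r δ) :
    ∫ x in Λ, l x
      = (∫ x in Metric.closedBall 0 r, l x) + ∫ x in Λ \ Metric.closedBall 0 r, l x := by
  rw [← setIntegral_union Set.disjoint_sdiff_right (h.isOpen.measurableSet.diff measurableSet_ball)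
    h.integrableOn_ball h.integrableOn_diff, Set.union_sdiff_cancel h.ball_subset]

lemma tail_le (h : LocallyGaussian Λ l r δ) :
    ∫ x in Λ \ Metric.closedBall 0 r, l x ≤ δ := by
  rw [integral_eq_lintegral_of_nonneg_ae]
  · exact ENNReal.toReal_le_of_le_ofReal h.error_nonneg h.tail
  · exact (ae_restrict_iff' (h.isOpen.measurableSet.diff measurableSet_ball)).2
      (ae_of_all _ fun x hx => h.nonneg x hx.1)
  · exact h.integrableOn_diff.aestronglyMeasurable

lemma tail_nonneg (h : LocallyGaussian Λ l r δ) : 0 ≤ ∫ x in Λ \ Metric.closedBall 0 r, l x :=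
  setIntegral_nonneg (h.isOpen.measurableSet.diff measurableSet_ball) fun x hx => h.nonneg x hx.1

lemma normal_ball (h : LocallyGaussian Λ l r δ) :
    (1 - δ) * (2 * Real.pi) ^ ((d : ℝ) / 2)
      ≤ ∫ x in Metric.closedBall (0 : Vec d) r, Real.exp (-‖x‖ ^ 2 / 2) := by
  have h1 := integral_add_compl (measurableSet_ball (d := d) (r := r))
    (integrable_exp_neg_half_norm_sq d)
  rw [integral_exp_neg_half_norm_sq] at h1
  linarith [h.normal_tail]

lemma one_le_normalization (d : ℕ) : 1 ≤ (2 * Real.pi) ^ ((d : ℝ) / 2) :=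
  Real.one_le_rpow (by linarith [Real.pi_gt_three]) (by positivity)

lemma le_integral_ball (h : LocallyGaussian Λ l r δ) :
    (1 - δ) ^ 2 * (2 * Real.pi) ^ ((d : ℝ) / 2) ≤ ∫ x in Metric.closedBall 0 r, l x := by
  calc (1 - δ) ^ 2 * (2 * Real.pi) ^ ((d : ℝ) / 2)
      = (1 - δ) * ((1 - δ) * (2 * Real.pi) ^ ((d : ℝ) / 2)) := by ring
    _ ≤ (1 - δ) * ∫ x in Metric.closedBall (0 : Vec d) r, Real.exp (-‖x‖ ^ 2 / 2) :=
        mul_le_mul_of_nonneg_left h.normal_ball (by linarith [h.error_le])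
    _ = ∫ x in Metric.closedBall (0 : Vec d) r, (1 - δ) * Real.exp (-‖x‖ ^ 2 / 2) := by
        rw [integral_const_mul]
    _ ≤ _ := setIntegral_mono_on
        ((integrable_exp_neg_half_norm_sq d).const_mul _).integrableOn h.integrableOn_ball
        measurableSet_ball fun x hx => h.le_likelihood hx

lemma integral_ball_le (h : LocallyGaussian Λ l r δ) :
    ∫ x in Metric.closedBall 0 r, l x ≤ (1 + 2 * δ) * (2 * Real.pi) ^ ((d : ℝ) / 2) := by
  have h0 := h.error_nonneg
  calc _ ≤ ∫ x in Metric.closedBall (0 : Vec d) r, (1 + 2 * δ) * Real.exp (-‖x‖ ^ 2 / 2) :=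
        setIntegral_mono_on h.integrableOn_ball
          ((integrable_exp_neg_half_norm_sq d).const_mul _).integrableOn
          measurableSet_ball fun x hx => h.likelihood_le hx
    _ ≤ ∫ x : Vec d, (1 + 2 * δ) * Real.exp (-‖x‖ ^ 2 / 2) :=
        setIntegral_le_integral ((integrable_exp_neg_half_norm_sq d).const_mul _)
          (ae_of_all _ fun x => by positivity)
    _ = _ := by rw [integral_const_mul, integral_exp_neg_half_norm_sq]

lemma integral_pos (h : LocallyGaussian Λ l r δ) : 0 < ∫ x in Λ, l x := by
  have h1 := h.le_integral_ball
  have h2 := h.tail_nonneg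
  rw [h.integral_eq_add]
  have h3 : 0 < (1 - δ) ^ 2 := by
    have := h.error_le
    have : 0 < 1 - δ := by linarith
    positivity
  have := one_le_normalization d
  nlinarith

lemma half_le_integral (h : LocallyGaussian Λ l r δ) : 1 / 2 ≤ ∫ x in Λ, l x := by
  have h1 := h.le_integral_ball
  have h2 := h.tail_nonneg
  rw [h.integral_eq_add]
  have h3 : 1 / 2 ≤ (1 - δ) ^ 2 := by nlinarith [h.error_le, h.error_nonneg]
  have := one_le_normalization d
  nlinarith

lemma integral_le (h : LocallyGaussian Λ l r δ) :
    ∫ x in Λ, l x ≤ (1 + 3 * δ) * (2 * Real.pi) ^ ((d : ℝ) / 2) := by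
  rw [h.integral_eq_add]
  have h1 := h.integral_ball_le
  have h2 := h.tail_le
  nlinarith [one_le_normalization d, h.error_nonneg]

/-- The factor `2` comes from the lower bound `1 / 2` for the normalizing integral. -/
lemma posterior_ball (h : LocallyGaussian Λ l r δ) :
    1 - 2 * δ ≤ ∫ x in Metric.closedBall 0 r, posteriorDensity Λ l x := by
  have hZ := h.integral_pos
  have h1 : ∫ x in Metric.closedBall 0 r, posteriorDensity Λ l x
      = (∫ x in Metric.closedBall 0 r, l x) / ∫ x in Λ, l x := by
    unfold posteriorDensity
    rw [integral_div]
    congr 1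
    exact setIntegral_congr_fun measurableSet_ball fun x hx =>
      Set.indicator_of_mem (h.ball_subset hx) l
  rw [h1, le_div_iff₀ hZ]
  have h2 := h.tail_le
  have h3 := h.half_le_integral
  have h4 := h.integral_eq_add
  nlinarith [h.error_nonneg]

lemma measurable_posterior (h : LocallyGaussian Λ l r δ) : Measurable (posteriorDensity Λ l) :=
  (measurable_indicator_of_lowerSemicontinuousOn h.isOpen h.lsc h.nonneg).div_const _

lemma posterior_nonneg (h : LocallyGaussian Λ l r δ) (x : Vec d) : 0 ≤ posteriorDensity Λ l x :=
  div_nonneg (Set.indicator_nonneg h.nonneg x) h.integral_pos.le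

lemma posterior_of_mem_ball (h : LocallyGaussian Λ l r δ) {x : Vec d}
    (hx : x ∈ Metric.closedBall (0 : Vec d) r) :
    posteriorDensity Λ l x = l x / ∫ y in Λ, l y := by
  unfold posteriorDensity
  rw [Set.indicator_of_mem (h.ball_subset hx)]

lemma nearGaussian (h : LocallyGaussian Λ l r δ) :
    NearGaussian (posteriorDensity Λ l) r ((1 - δ) / ∫ y in Λ, l y) where
  measurable := h.measurable_posterior
  nonneg := h.posterior_nonneg
  scale_pos := div_pos (by linarith [h.error_le]) h.integral_pos
  lower x hx := by
    rw [h.posterior_of_mem_ball hx, div_mul_eq_mul_div]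
    exact div_le_div_of_nonneg_right (h.le_likelihood hx) h.integral_pos.le
  upper x hx := by
    rw [h.posterior_of_mem_ball hx, mul_div_assoc', div_mul_eq_mul_div]
    refine div_le_div_of_nonneg_right ((h.likelihood_le hx).trans ?_) h.integral_pos.le
    gcongr
    linarith [h.error_le]
  mass := by
    rw [← ofReal_integral_eq_lintegral_ofReal (integrable_exp_neg_half_norm_sq d).integrableOn
      (ae_of_all _ fun x => by positivity)]
    refine ENNReal.ofReal_le_ofReal (le_trans ?_ h.normal_ball)
    have := one_le_normalization d
    nlinarith [h.error_le]

end LocallyGaussian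

lemma normalDensity_id {d : ℕ} (x : Vec d) :
    normalDensity (ContinuousLinearMap.id ℝ (Vec d)) x
      = Real.exp (-‖x‖ ^ 2 / 2) / (2 * Real.pi) ^ ((d : ℝ) / 2) := by
  unfold normalDensity
  rw [ContinuousLinearMap.coe_id, LinearMap.det_id, Real.sqrt_one, ContinuousLinearMap.id_apply,
    real_inner_self_eq_norm_sq]
  ring

namespace LocallyGaussian

variable {d : ℕ} {Λ : Set (Vec d)} {l : Vec d → ℝ} {r δ : ℝ}

/-- The posterior mass is one, so the total variation distance to the normal law is governed by
the part of the normal density that exceeds the posterior density; on the ball that excess is at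
most `4 δ φ`. -/
lemma lintegral_abs_sub_normal_le (h : LocallyGaussian Λ l r δ) :
    ∫⁻ x in Λ, ENNReal.ofReal |posteriorDensity Λ l x -
        normalDensity (ContinuousLinearMap.id ℝ (Vec d)) x| ≤ ENNReal.ofReal (11 * δ) := by
  have h0 := h.error_nonneg
  have h14 := h.error_le
  have hZ := h.integral_pos
  set G := (2 * Real.pi) ^ ((d : ℝ) / 2) with hG
  have hG1 : 1 ≤ G := one_le_normalization d
  have hG0 : 0 < G := by linarith
  set f := posteriorDensity Λ l
  set φ := normalDensity (ContinuousLinearMap.id ℝ (Vec d))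
  have hφ : φ = fun x => Real.exp (-‖x‖ ^ 2 / 2) / G := funext normalDensity_id
  have hφ0 : ∀ x, 0 ≤ φ x := fun x => by rw [hφ]; positivity
  have hφi : Integrable φ := by rw [hφ]; exact (integrable_exp_neg_half_norm_sq d).div_const _
  have hφ1 : ∫ x, φ x = 1 := by
    rw [hφ, integral_div, integral_exp_neg_half_norm_sq, div_self hG0.ne']
  have hfe : Set.EqOn f (fun x => l x / ∫ y in Λ, l y) Λ := fun x hx => by
    simp only [f, posteriorDensity, Set.indicator_of_mem hx]
  have hΛ := h.isOpen.measurableSet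
  have hfi : IntegrableOn f Λ :=
    IntegrableOn.congr_fun (f := fun x => l x / ∫ y in Λ, l y) (h.integrableOn.div_const _)
      hfe.symm hΛ
  have hf1 : ∫ x in Λ, f x = 1 := by
    rw [setIntegral_congr_fun hΛ hfe, integral_div, div_self hZ.ne']
  set K := Metric.closedBall (0 : Vec d) r
  have hK : MeasurableSet K := measurableSet_ball
  have hout : ∫ x in Kᶜ, φ x ≤ δ := by
    rw [hφ, integral_div, div_le_iff₀ hG0]
    exact h.normal_tail
  have hφΛ : 1 - δ ≤ ∫ x in Λ, φ x := by
    have h1 := integral_add_compl hK hφi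
    have h2 : ∫ x in K, φ x ≤ ∫ x in Λ, φ x :=
      setIntegral_mono_set hφi.integrableOn (ae_of_all _ hφ0)
        (LE.le.eventuallyLE h.ball_subset)
    linarith
  have hlow : ∀ x ∈ K, (1 - 4 * δ) * φ x ≤ f x := by
    intro x hx
    have h1 := h.le_likelihood hx
    have h2 := h.integral_le
    rw [show f x = l x / ∫ y in Λ, l y from h.posterior_of_mem_ball hx, le_div_iff₀ hZ, hφ]
    have he := Real.exp_pos (-‖x‖ ^ 2 / 2)
    calc (1 - 4 * δ) * (Real.exp (-‖x‖ ^ 2 / 2) / G) * ∫ y in Λ, l y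
        ≤ (1 - 4 * δ) * (Real.exp (-‖x‖ ^ 2 / 2) / G) * ((1 + 3 * δ) * G) := by
          have : 0 ≤ 1 - 4 * δ := by linarith
          gcongr
      _ = (1 - 4 * δ) * (1 + 3 * δ) * Real.exp (-‖x‖ ^ 2 / 2) := by field_simp
      _ ≤ (1 - δ) * Real.exp (-‖x‖ ^ 2 / 2) := by
          gcongr
          nlinarith
      _ ≤ l x := h1
  have hpt : ∀ x ∈ Λ, |f x - φ x| ≤ f x - φ x + 2 * (4 * δ * φ x + Kᶜ.indicator φ x) := by
    intro x hx
    have hf0 : 0 ≤ f x := h.posterior_nonneg x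
    have hp := hφ0 x
    have hm : 0 ≤ 4 * δ * φ x := by positivity
    by_cases hxK : x ∈ K
    · have h1 := hlow x hxK
      rw [Set.indicator_of_notMem (by simpa using hxK), add_zero]
      rw [abs_le]
      constructor <;> nlinarith
    · rw [Set.indicator_of_mem (by simpa using hxK)]
      rw [abs_le]
      constructor <;> nlinarith
  have hind : Integrable (Kᶜ.indicator φ) := hφi.indicator hK.compl
  have hi2 : IntegrableOn (fun x => 2 * (4 * δ * φ x + Kᶜ.indicator φ x)) Λ :=
    (((hφi.const_mul _).add hind).const_mul _).integrableOn
  have hi1 : IntegrableOn (fun x => f x - φ x) Λ := hfi.sub hφi.integrableOn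
  rw [← ofReal_integral_eq_lintegral_ofReal hi1.abs (ae_of_all _ fun x => abs_nonneg _)]
  refine ENNReal.ofReal_le_ofReal ?_
  calc ∫ x in Λ, |f x - φ x|
      ≤ ∫ x in Λ, (f x - φ x + 2 * (4 * δ * φ x + Kᶜ.indicator φ x)) :=
        setIntegral_mono_on hi1.abs (hi1.add hi2) hΛ hpt
    _ = (∫ x in Λ, (f x - φ x)) + ∫ x in Λ, 2 * (4 * δ * φ x + Kᶜ.indicator φ x) :=
        integral_add hi1 hi2
    _ ≤ δ + ∫ x, 2 * (4 * δ * φ x + Kᶜ.indicator φ x) := by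
        refine add_le_add ?_ (setIntegral_le_integral
          (((hφi.const_mul _).add hind).const_mul _) (ae_of_all _ fun x => ?_))
        · rw [integral_sub hfi hφi.integrableOn, hf1]
          linarith
        · have h1 : 0 ≤ Kᶜ.indicator φ x := Set.indicator_nonneg (fun y _ => hφ0 y) x
          have h2 := hφ0 x
          simp only [Pi.zero_apply]
          positivity
    _ ≤ 11 * δ := by
        rw [integral_const_mul, integral_add (hφi.const_mul _) hind, integral_const_mul, hφ1,
          integral_indicator hK.compl]
        linarith

end LocallyGaussian

/-! ### The localized likelihood of an exponential family -/

namespace ExpModel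

variable {d : ℕ} {m : ExpModel d}

/-- Regularity of a model and its prior at sample size `n`, on the ball of radius `q √d` in the
local parameter `√n (θ - θ₀)`: `b` bounds the third moments and the Lipschitz constant of the log
prior, and `A` controls the growth of the prior. -/
structure IsRegular (m : ExpModel d) (n : ℕ) (A b q : ℝ) : Prop where
  canonical : m.IsCanonical
  properPrior : m.IsProperPrior
  one_le_dim : 1 ≤ d
  one_le_size : 1 ≤ n
  bound_nonneg : 0 ≤ b
  radius_nonneg : 0 ≤ q
  moment : m.momentSup n 3 (q ^ 2) ≤ ENNReal.ofReal b
  ball_subset : {θ : Vec d | ‖θ - m.trueParam‖ ^ 2 ≤ q ^ 2 * d / n} ⊆ m.paramSet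
  prior_pos : 0 < m.prior m.trueParam
  prior_le : ∀ θ ∈ m.paramSet, m.prior θ ≤ m.prior m.trueParam * Real.exp (A * d)
  prior_lipschitz : ∀ θ ∈ m.paramSet, ‖θ - m.trueParam‖ ^ 2 ≤ q ^ 2 * d / n → 0 < m.prior θ ∧
    |Real.log (m.prior θ) - Real.log (m.prior m.trueParam)|
      ≤ b * Real.sqrt d * ‖θ - m.trueParam‖

/-- The constant in the bound `approxConst b q * √(d³ / n)` for the error of the quadratic
approximation of the local log-posterior. -/
def approxConst (b q : ℝ) : ℝ := 12 * (1 + b) ^ 3 * q ^ 3 + 2 * (b * q)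

namespace IsRegular

variable {n : ℕ} {A b q : ℝ}

lemma size_pos (h : m.IsRegular n A b q) : (0 : ℝ) < n := by exact_mod_cast h.one_le_size

lemma norm_smul_sq_le (h : m.IsRegular n A b q) {w : Vec d} (hw : ‖w‖ ≤ q * Real.sqrt d) :
    ‖m.trueParam + (Real.sqrt n)⁻¹ • w - m.trueParam‖ ^ 2 ≤ q ^ 2 * d / n := by
  have hn := h.size_pos
  rw [add_sub_cancel_left, norm_smul, mul_pow, norm_inv, inv_pow, Real.norm_eq_abs, sq_abs,
    Real.sq_sqrt hn.le]
  have h1 : ‖w‖ ^ 2 ≤ q ^ 2 * d := by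
    calc ‖w‖ ^ 2 ≤ (q * Real.sqrt d) ^ 2 := by gcongr
      _ = _ := by rw [mul_pow, Real.sq_sqrt (Nat.cast_nonneg d)]
  rw [inv_mul_eq_div]
  gcongr

lemma mem_paramSet (h : m.IsRegular n A b q) {w : Vec d} (hw : ‖w‖ ≤ q * Real.sqrt d) :
    m.trueParam + (Real.sqrt n)⁻¹ • w ∈ m.paramSet :=
  h.ball_subset (h.norm_smul_sq_le hw)

lemma sqrt_pow_three_div (h : m.IsRegular n A b q) :
    Real.sqrt d ^ 3 / Real.sqrt n = Real.sqrt ((d : ℝ) ^ 3 / n) := by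
  rw [Real.sqrt_div' _ h.size_pos.le]
  congr 1
  rw [eq_comm, Real.sqrt_eq_iff_mul_self_eq (by positivity) (by positivity)]
  have := Real.sq_sqrt (Nat.cast_nonneg (α := ℝ) d)
  calc (d : ℝ) ^ 3 = (Real.sqrt d ^ 2) ^ 3 := by rw [this]
    _ = _ := by ring

lemma abs_cumulant_sub_le (h : m.IsRegular n A b q) {w : Vec d} (hw : ‖w‖ ≤ q * Real.sqrt d) :
    |m.cumulant n w - ‖w‖ ^ 2 / 2|
      ≤ 6 * (1 + b) ^ 3 * (q ^ 3 * Real.sqrt ((d : ℝ) ^ 3 / n)) := by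
  have hb := h.bound_nonneg
  have h1 : ‖w‖ ^ 2 ≤ q ^ 2 * d := by
    calc ‖w‖ ^ 2 ≤ (q * Real.sqrt d) ^ 2 := by gcongr
      _ = _ := by rw [mul_pow, Real.sq_sqrt (Nat.cast_nonneg d)]
  refine (ExpModel.abs_cumulant_sub_le h.canonical h.one_le_size hb h.moment h.ball_subset
    h1).trans ?_
  rw [← h.sqrt_pow_three_div, mul_div_assoc' (q ^ 3), ← mul_pow]
  gcongr

lemma prior_near (h : m.IsRegular n A b q) {w : Vec d} (hw : ‖w‖ ≤ q * Real.sqrt d) :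
    0 < m.prior (m.trueParam + (Real.sqrt n)⁻¹ • w) ∧
      |Real.log (m.prior (m.trueParam + (Real.sqrt n)⁻¹ • w)) - Real.log (m.prior m.trueParam)|
        ≤ b * q * Real.sqrt ((d : ℝ) ^ 3 / n) := by
  obtain ⟨h1, h2⟩ := h.prior_lipschitz _ (h.mem_paramSet hw) (h.norm_smul_sq_le hw)
  refine ⟨h1, h2.trans ?_⟩
  have hb := h.bound_nonneg
  have hq := h.radius_nonneg
  have hd1 : 1 ≤ Real.sqrt d := Real.one_le_sqrt.2 (by exact_mod_cast h.one_le_dim)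
  rw [add_sub_cancel_left, norm_smul, norm_inv, Real.norm_eq_abs,
    abs_of_nonneg (Real.sqrt_nonneg _), ← h.sqrt_pow_three_div, inv_mul_eq_div]
  calc b * Real.sqrt d * (‖w‖ / Real.sqrt n)
      ≤ b * Real.sqrt d * (q * Real.sqrt d / Real.sqrt n) := by gcongr
    _ = b * q * (Real.sqrt d ^ 2 / Real.sqrt n) := by ring
    _ ≤ _ := by
        gcongr
        norm_num

variable {C a δ : ℝ} {X : Fin n → Vec d}

lemma norm_add_score_le (hs : ‖m.score X‖ ^ 2 ≤ a * d) (hq : C + Real.sqrt a ≤ q) {x : Vec d}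
    (hx : ‖x‖ ≤ C * Real.sqrt d) : ‖x + m.score X‖ ≤ q * Real.sqrt d := by
  have h1 : ‖m.score X‖ ≤ Real.sqrt a * Real.sqrt d := by
    rw [← Real.sqrt_mul' _ (Nat.cast_nonneg d)]
    exact Real.le_sqrt_of_sq_le hs
  calc ‖x + m.score X‖ ≤ C * Real.sqrt d + Real.sqrt a * Real.sqrt d :=
        (norm_add_le _ _).trans (add_le_add hx h1)
    _ = (C + Real.sqrt a) * Real.sqrt d := by ring
    _ ≤ _ := by gcongr

lemma norm_score_le (hC : 0 ≤ C) (hs : ‖m.score X‖ ^ 2 ≤ a * d) (hq : C + Real.sqrt a ≤ q) :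
    ‖m.score X‖ ≤ q * Real.sqrt d := by
  simpa using norm_add_score_le (x := 0) hs hq (by simpa using by positivity)

lemma abs_logLikelihood_add_le (h : m.IsRegular n A b q) (hC : 0 ≤ C)
    (hs : ‖m.score X‖ ^ 2 ≤ a * d) (hq : C + Real.sqrt a ≤ q) {x : Vec d}
    (hx : ‖x‖ ≤ C * Real.sqrt d) :
    |inner ℝ (m.score X) x - m.cumulant n (x + m.score X) + m.cumulant n (m.score X)
        + ‖x‖ ^ 2 / 2|
      ≤ 12 * (1 + b) ^ 3 * q ^ 3 * Real.sqrt ((d : ℝ) ^ 3 / n) := by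
  have h1 := abs_le.1 (h.abs_cumulant_sub_le (norm_add_score_le hs hq hx))
  have h2 := abs_le.1 (h.abs_cumulant_sub_le (norm_score_le hC hs hq))
  have h3 := norm_add_sq_real x (m.score X)
  rw [real_inner_comm] at h3
  rw [abs_le]
  constructor <;> linarith

lemma posterior_approx (h : m.IsRegular n A b q) (hC : 0 ≤ C)
    (hs : ‖m.score X‖ ^ 2 ≤ a * d) (hq : C + Real.sqrt a ≤ q) {x : Vec d}
    (hx : ‖x‖ ≤ C * Real.sqrt d) :
    0 < m.localLikelihood X x ∧ |Real.log (m.localLikelihood X x) + ‖x‖ ^ 2 / 2|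
      ≤ approxConst b q * Real.sqrt ((d : ℝ) ^ 3 / n) := by
  obtain ⟨h1, h2⟩ := h.prior_near (norm_add_score_le hs hq hx)
  obtain ⟨h3, h4⟩ := h.prior_near (norm_score_le hC hs hq)
  have h5 := abs_le.1 (h.abs_logLikelihood_add_le hC hs hq hx)
  have e0 : m.toParam X 0 = m.trueParam + (Real.sqrt n)⁻¹ • m.score X := by
    unfold toParam; rw [zero_add]
  rw [m.localLikelihood_eq h.one_le_size, e0]
  change 0 < Real.exp _ * (m.prior (m.trueParam + (Real.sqrt n)⁻¹ • (x + m.score X)) / _) ∧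
    |Real.log (Real.exp _ * (m.prior (m.trueParam + (Real.sqrt n)⁻¹ • (x + m.score X)) / _)) + _|
      ≤ _
  refine ⟨by positivity, ?_⟩
  rw [Real.log_mul (Real.exp_pos _).ne' (by positivity), Real.log_exp,
    Real.log_div h1.ne' h3.ne']
  have h2' := abs_le.1 h2
  have h4' := abs_le.1 h4
  unfold approxConst
  rw [abs_le]
  constructor <;> linarith

lemma prior_div_le (h : m.IsRegular n A b q) (hC : 0 ≤ C)
    (hs : ‖m.score X‖ ^ 2 ≤ a * d) (hq : C + Real.sqrt a ≤ q)
    (hsmall : b * q * Real.sqrt ((d : ℝ) ^ 3 / n) ≤ 1) {x : Vec d} (hx : x ∈ m.localSpace X) :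
    m.prior (m.toParam X x) / m.prior (m.toParam X 0) ≤ Real.exp (A * d + 1) := by
  obtain ⟨h3, h4⟩ := h.prior_near (norm_score_le hC hs hq)
  have e0 : m.toParam X 0 = m.trueParam + (Real.sqrt n)⁻¹ • m.score X := by
    unfold toParam; rw [zero_add]
  rw [e0, div_le_iff₀ h3]
  have h5 : m.prior m.trueParam
      ≤ Real.exp 1 * m.prior (m.trueParam + (Real.sqrt n)⁻¹ • m.score X) := by
    rw [← Real.log_le_log_iff h.prior_pos (by positivity),
      Real.log_mul (Real.exp_pos _).ne' h3.ne', Real.log_exp]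
    linarith [(abs_le.1 h4).1]
  calc m.prior (m.toParam X x) ≤ m.prior m.trueParam * Real.exp (A * d) := h.prior_le _ hx
    _ ≤ Real.exp 1 * m.prior (m.trueParam + (Real.sqrt n)⁻¹ • m.score X) * Real.exp (A * d) := by
        gcongr
    _ = _ := by rw [Real.exp_add]; ring

/-- Exponential decay of the localized likelihood off the ball. Concavity along rays gives the
exponent `-(3 C / 8) √d ‖x‖`; a third of it is spent on the factor `exp (-C² d / 8)`. -/
lemma likelihood_tail_le (h : m.IsRegular n A b q) (hC : 8 ≤ C)
    (hs : ‖m.score X‖ ^ 2 ≤ a * d) (hq : C + Real.sqrt a ≤ q)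
    (hsmall : approxConst b q * Real.sqrt ((d : ℝ) ^ 3 / n) ≤ 1) {x : Vec d}
    (hx : x ∈ m.localSpace X) (hxr : C * Real.sqrt d < ‖x‖) :
    m.localLikelihood X x ≤ Real.exp (A * d + 1 - C ^ 2 * d / 8) *
      Real.exp (-(C / 4 * (Real.sqrt d * ‖x‖))) := by
  have hC0 : 0 ≤ C := by linarith
  have hb := h.bound_nonneg
  have hq0 := h.radius_nonneg
  have hd1 : (1 : ℝ) ≤ d := by exact_mod_cast h.one_le_dim
  have hsd : 0 < Real.sqrt d := Real.sqrt_pos.2 (by linarith)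
  set r := C * Real.sqrt d with hr
  have hr0 : 0 < r := by positivity
  have hr2 : r ^ 2 = C ^ 2 * d := by rw [hr, mul_pow, Real.sq_sqrt (by linarith)]
  have hr64 : 8 ≤ r ^ 2 := by rw [hr2]; nlinarith
  have hx0 : 0 < ‖x‖ := hr0.trans hxr
  have hρ := Real.sqrt_nonneg ((d : ℝ) ^ 3 / n)
  set ρ := Real.sqrt ((d : ℝ) ^ 3 / n)
  have hs1 : b * q * ρ ≤ 1 := by
    unfold approxConst at hsmall
    have : 0 ≤ 12 * (1 + b) ^ 3 * q ^ 3 * ρ := by positivity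
    have : 0 ≤ b * q * ρ := by positivity
    linarith
  have hs2 : 12 * (1 + b) ^ 3 * q ^ 3 * ρ ≤ 1 := by
    unfold approxConst at hsmall
    have : 0 ≤ b * q * ρ := by positivity
    linarith
  have h0 : (0 : Vec d) ∈ m.localSpace X := by
    change m.trueParam + (Real.sqrt n)⁻¹ • (0 + m.score X) ∈ m.paramSet
    rw [zero_add]
    exact h.mem_paramSet (norm_score_le hC0 hs hq)
  have hκ : ‖(r / ‖x‖) • x‖ = r := by
    rw [norm_smul, Real.norm_eq_abs, abs_of_pos (by positivity), div_mul_cancel₀ _ hx0.ne']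
  -- concavity along the ray through `x`, compared at the point of the ray on the sphere
  have hray := logLikelihood_le_of_ray h.canonical X hx h0 (κ := r / ‖x‖) (by positivity)
    ((div_le_one hx0).2 hxr.le)
  have happ := (abs_le.1 (h.abs_logLikelihood_add_le hC0 hs hq hκ.le)).2
  rw [hκ] at happ
  rw [m.localLikelihood_eq h.one_le_size]
  set D := inner ℝ (m.score X) x - m.cumulant n (x + m.score X) + m.cumulant n (m.score X)
  have hD : D ≤ -(3 / 8 * (r * ‖x‖)) := by
    have h1 : r / ‖x‖ * D ≤ -(3 / 8 * r ^ 2) := by linarith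
    have h2 := mul_le_mul_of_nonneg_left h1 (div_nonneg hx0.le hr0.le)
    have e1 : ‖x‖ / r * (r / ‖x‖ * D) = D := by field_simp
    have e2 : ‖x‖ / r * -(3 / 8 * r ^ 2) = -(3 / 8 * (r * ‖x‖)) := by field_simp
    rwa [e1, e2] at h2
  have hrx : r ^ 2 ≤ r * ‖x‖ := by rw [sq]; gcongr
  calc Real.exp D * (m.prior (m.toParam X x) / m.prior (m.toParam X 0))
      ≤ Real.exp D * Real.exp (A * d + 1) := by
        gcongr
        exact h.prior_div_le hC0 hs hq hs1 hx
    _ = Real.exp (D + (A * d + 1)) := (Real.exp_add _ _).symm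
    _ ≤ Real.exp (A * d + 1 - C ^ 2 * d / 8 + -(C / 4 * (Real.sqrt d * ‖x‖))) := by
        refine Real.exp_le_exp.2 ?_
        have e3 : C / 4 * (Real.sqrt d * ‖x‖) = r * ‖x‖ / 4 := by rw [hr]; ring
        rw [e3, ← hr2]
        linarith
    _ = _ := by rw [Real.exp_add]

lemma lintegral_tail_le (h : m.IsRegular n A b q) (hC : 8 ≤ C) (hA : |A| + 1 ≤ C ^ 2 / 8)
    (hs : ‖m.score X‖ ^ 2 ≤ a * d) (hq : C + Real.sqrt a ≤ q)
    (hsmall : approxConst b q * Real.sqrt ((d : ℝ) ^ 3 / n) ≤ 1) :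
    ∫⁻ x in m.localSpace X \ Metric.closedBall 0 (C * Real.sqrt d),
      ENNReal.ofReal (m.localLikelihood X x) ≤ ENNReal.ofReal (Real.exp (1 - d)) := by
  have hd0 : (0 : ℝ) ≤ d := Nat.cast_nonneg d
  have hΛ : IsOpen (m.localSpace X) := by
    refine h.canonical.isOpen.preimage (f := m.toParam X) ?_
    unfold toParam
    fun_prop
  calc _ ≤ ∫⁻ x in m.localSpace X \ Metric.closedBall 0 (C * Real.sqrt d),
        ENNReal.ofReal (Real.exp (A * d + 1 - C ^ 2 * d / 8)) *
          ENNReal.ofReal (Real.exp (-(C / 4 * (Real.sqrt d * ‖x‖)))) := by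
        refine setLIntegral_mono' (hΛ.measurableSet.diff
          Metric.isClosed_closedBall.measurableSet) fun x hx => ?_
        rw [← ENNReal.ofReal_mul (Real.exp_pos _).le]
        refine ENNReal.ofReal_le_ofReal (h.likelihood_tail_le hC hs hq hsmall hx.1 ?_)
        have := hx.2
        rwa [mem_closedBall_zero_iff, not_le] at this
    _ ≤ ∫⁻ x : Vec d, ENNReal.ofReal (Real.exp (A * d + 1 - C ^ 2 * d / 8)) *
          ENNReal.ofReal (Real.exp (-(C / 4 * (Real.sqrt d * ‖x‖)))) := setLIntegral_le_lintegral _ _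
    _ ≤ ENNReal.ofReal (Real.exp (A * d + 1 - C ^ 2 * d / 8)) *
          ENNReal.ofReal ((2 / (C / 4)) ^ d) := by
        rw [lintegral_const_mul _ (by fun_prop)]
        gcongr
        exact lintegral_exp_neg_norm_le (by linarith)
    _ = ENNReal.ofReal (Real.exp (A * d + 1 - C ^ 2 * d / 8) * (2 / (C / 4)) ^ d) := by
        rw [ENNReal.ofReal_mul (Real.exp_pos _).le]
    _ ≤ _ := by
        refine ENNReal.ofReal_le_ofReal ?_
        have h1 : (2 / (C / 4)) ^ d ≤ 1 := by
          refine pow_le_one₀ (by positivity) ?_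
          rw [div_le_one (by linarith)]
          linarith
        refine (mul_le_of_le_one_right (Real.exp_pos _).le h1).trans (Real.exp_le_exp.2 ?_)
        have h2 : A + 1 ≤ C ^ 2 / 8 := by linarith [le_abs_self A]
        nlinarith [mul_le_mul_of_nonneg_right h2 hd0]

/-- On the event that the score has norm at most `√(a d)`, the localized likelihood is nearly
normal in the sense of `LocallyGaussian`. -/
lemma locallyGaussian (h : m.IsRegular n A b q) (hC : 8 ≤ C) (hA : |A| + 1 ≤ C ^ 2 / 8)
    (hs : ‖m.score X‖ ^ 2 ≤ a * d) (hq : C + Real.sqrt a ≤ q)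
    (hδ : approxConst b q * Real.sqrt ((d : ℝ) ^ 3 / n) ≤ δ) (hδ' : Real.exp (1 - d) ≤ δ)
    (hδ4 : δ ≤ 1 / 4) :
    LocallyGaussian (m.localSpace X) (m.localLikelihood X) (C * Real.sqrt d) δ := by
  have hC0 : 0 ≤ C := by linarith
  have hcont : Continuous (m.toParam X) := by unfold toParam; fun_prop
  have h0 : 0 < m.prior (m.toParam X 0) := by
    have := (h.prior_near (norm_score_le hC0 hs hq)).1
    unfold toParam
    rwa [zero_add]
  have hball : Metric.closedBall 0 (C * Real.sqrt d) ⊆ m.localSpace X := fun x hx =>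
    h.mem_paramSet (norm_add_score_le hs hq (mem_closedBall_zero_iff.1 hx))
  refine ⟨h.canonical.isOpen.preimage hcont, ?_, ?_, hball, ?_, ?_, ?_, ?_, hδ4⟩
  · have hexp : ContinuousOn (fun x => Real.exp (Real.sqrt n * inner ℝ (sampleMean X) x
        - n * m.logPartition (m.toParam X x) + n * m.logPartition (m.toParam X 0)))
        (m.localSpace X) := by
      have hψ : ContinuousOn (fun x => m.logPartition (m.toParam X x)) (m.localSpace X) :=
        (continuousOn_logPartition h.canonical).comp hcont.continuousOn fun x hx => hx
      fun_prop
    have hprior : LowerSemicontinuousOn (fun x => m.prior (m.toParam X x)) (m.localSpace X) :=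
      h.properPrior.lower_semicontinuous.comp hcont.continuousOn fun x hx => hx
    intro x hx y hy
    have hE := hexp x hx
    set E := fun x => Real.exp (Real.sqrt n * inner ℝ (sampleMean X) x
        - n * m.logPartition (m.toParam X x) + n * m.logPartition (m.toParam X 0)) with hEdef
    have hE0 : ∀ x, 0 < E x := fun x => Real.exp_pos _
    have hl : ∀ x, m.localLikelihood X x
        = E x * (m.prior (m.toParam X x) / m.prior (m.toParam X 0)) := fun x => rfl
    rw [hl, gt_iff_lt] at hy
    rcases lt_or_ge y 0 with hy0 | hy0
    · filter_upwards [self_mem_nhdsWithin] with z hz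
      rw [hl]
      exact hy0.trans_le (mul_nonneg (hE0 z).le
        (div_nonneg (h.properPrior.nonneg _ hz) h0.le))
    · -- the prior stays above a level `p₁` and the likelihood above a level `e₁`, with
      -- `y < e₁ p₁ / π(θ₀ + s / √n)`
      have h1 : y * m.prior (m.toParam X 0) < E x * m.prior (m.toParam X x) := by
        rw [← mul_div_assoc, lt_div_iff₀ h0] at hy
        exact hy
      have h2 : y * m.prior (m.toParam X 0) / E x < m.prior (m.toParam X x) := by
        rw [div_lt_iff₀ (hE0 x), mul_comm (m.prior _)]
        exact h1
      obtain ⟨p₁, hp1, hp2⟩ := exists_between h2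
      have hp0 : 0 < p₁ := lt_of_le_of_lt
        (div_nonneg (mul_nonneg hy0 h0.le) (hE0 x).le) hp1
      have h3 : y * m.prior (m.toParam X 0) / p₁ < E x := by
        rw [div_lt_iff₀ hp0, mul_comm (E x)]
        rwa [div_lt_iff₀ (hE0 x)] at hp1
      filter_upwards [hprior x hx p₁ hp2, hE.eventually_const_lt h3] with z hz1 hz2
      rw [hl, gt_iff_lt, ← mul_div_assoc, lt_div_iff₀ h0]
      rw [div_lt_iff₀ hp0] at hz2
      exact hz2.trans (mul_lt_mul_of_pos_left hz1 (hE0 z))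
  · intro x hx
    exact mul_nonneg (Real.exp_pos _).le (div_nonneg (h.properPrior.nonneg _ hx) h0.le)
  · intro x hx
    obtain ⟨h1, h2⟩ := h.posterior_approx hC0 hs hq (mem_closedBall_zero_iff.1 hx)
    exact ⟨h1, h2.trans hδ⟩
  · exact (h.lintegral_tail_le hC hA hs hq (by linarith)).trans (ENNReal.ofReal_le_ofReal hδ')
  · refine (integral_exp_compl_ball_le hC).trans ?_
    gcongr
    exact (Real.exp_le_exp.2 (by linarith)).trans hδ'
  · exact (Real.exp_pos _).le.trans hδ'

end IsRegular

end ExpModel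

/-! ### Events whose probability tends to one -/

section Asymptotics

variable {Ω : ℕ → Type*} [∀ n, MeasurableSpace (Ω n)] {P : ∀ n, Measure (Ω n)}

lemma WithProbTendingToOne.mono {A B : ∀ n, Set (Ω n)} (h : WithProbTendingToOne P A)
    (hAB : ∀ᶠ n in atTop, A n ⊆ B n) : WithProbTendingToOne P B :=
  tendsto_of_tendsto_of_tendsto_of_le_of_le' tendsto_const_nhds h
    (Eventually.of_forall fun _ => zero_le)
    (hAB.mono fun _ hn => measure_mono (Set.compl_subset_compl.2 hn))

lemma withProbTendingToOne_of_tight {S : ℝ → ∀ n, Set (Ω n)} {B : ∀ n, Set (Ω n)}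
    (hS : ∀ a : ℝ, 0 < a → ∀ᶠ n in atTop, P n (S a n)ᶜ ≤ ENNReal.ofReal (1 / a))
    (hB : ∀ a : ℝ, 0 < a → ∀ᶠ n in atTop, S a n ⊆ B n) : WithProbTendingToOne P B := by
  refine ENNReal.tendsto_nhds_zero.2 fun ε hε => ?_
  rcases eq_or_ne ε ⊤ with rfl | hε'
  · exact Eventually.of_forall fun _ => le_top
  · have ha : 0 < 1 / ε.toReal := one_div_pos.2 (ENNReal.toReal_pos hε.ne' hε')
    filter_upwards [hS _ ha, hB _ ha] with n h1 h2
    refine (measure_mono (Set.compl_subset_compl.2 h2)).trans (h1.trans ?_)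
    rw [one_div_one_div, ENNReal.ofReal_toReal hε']

/-- If each fixed error bound holds with probability tending to one, then so does some
deterministic bound that tends to zero. -/
lemma exists_vanishing_error [∀ n, IsProbabilityMeasure (P n)] {E : ∀ n, ℝ → Set (Ω n)}
    (hmono : ∀ n, Monotone (E n))
    (h : ∀ δ : ℝ, 0 < δ → WithProbTendingToOne P fun n => E n δ) :
    ∃ e : ℕ → ℝ, (∀ n, 0 < e n) ∧ Tendsto e atTop (𝓝 0) ∧
      WithProbTendingToOne P fun n => E n (e n) := by
  -- the smallest error that fails with probability no larger than itself
  set S : ℕ → Set ℝ := fun n => {δ | 0 < δ ∧ P n (E n δ)ᶜ ≤ ENNReal.ofReal δ} with hS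
  have hbdd : ∀ n, BddBelow (S n) := fun n => ⟨0, fun δ hδ => hδ.1.le⟩
  have hne : ∀ n, (S n).Nonempty := fun n => ⟨1, one_pos, by
    rw [ENNReal.ofReal_one]; exact prob_le_one⟩
  have h0 : ∀ n, 0 ≤ sInf (S n) := fun n => Real.sInf_nonneg fun δ hδ => hδ.1.le
  have hlim : Tendsto (fun n => sInf (S n)) atTop (𝓝 0) := by
    refine tendsto_order.2 ⟨fun a ha => Eventually.of_forall fun n => ha.trans_le (h0 n),
      fun a ha => ?_⟩
    filter_upwards [ENNReal.tendsto_nhds_zero.1 (h (a / 2) (by linarith))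
      (ENNReal.ofReal (a / 2)) (ENNReal.ofReal_pos.2 (by linarith))] with n hn
    exact (csInf_le (hbdd n) ⟨by linarith, hn⟩).trans_lt (by linarith)
  have hlim1 : Tendsto (fun n : ℕ => sInf (S n) + 1 / ((n : ℝ) + 1)) atTop (𝓝 0) := by
    simpa using hlim.add tendsto_one_div_add_atTop_nhds_zero_nat
  refine ⟨fun n => sInf (S n) + 1 / ((n : ℝ) + 1), fun n => ?_, hlim1, ?_⟩
  · have := h0 n
    positivity
  · have hlim2 := ENNReal.tendsto_ofReal hlim1
    rw [ENNReal.ofReal_zero] at hlim2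
    refine tendsto_of_tendsto_of_tendsto_of_le_of_le tendsto_const_nhds hlim2
      (fun _ => zero_le) fun n => ?_
    obtain ⟨δ, hδ, hlt⟩ := exists_lt_of_csInf_lt (hne n)
      (lt_add_of_pos_right (sInf (S n)) (show 0 < 1 / ((n : ℝ) + 1) by positivity))
    exact (measure_mono (Set.compl_subset_compl.2 (hmono n hlt.le))).trans
      (hδ.2.trans (ENNReal.ofReal_le_ofReal hlt.le))

end Asymptotics

lemma integral_normalDensity_ball_ge {d : ℕ} {C : ℝ} (hC : 8 ≤ C) :
    1 - Real.exp (-d) ≤ ∫ x in Metric.closedBall 0 (C * Real.sqrt d),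
      normalDensity (ContinuousLinearMap.id ℝ (Vec d)) x := by
  have hG : 0 < (2 * Real.pi) ^ ((d : ℝ) / 2) := by positivity
  have h1 := integral_add_compl (LocallyGaussian.measurableSet_ball (d := d) (r := C * Real.sqrt d))
    (integrable_exp_neg_half_norm_sq d)
  rw [integral_exp_neg_half_norm_sq] at h1
  have h2 := integral_exp_compl_ball_le (d := d) hC
  simp_rw [normalDensity_id]
  rw [integral_div, le_div_iff₀ hG]
  linarith

lemma abs_mul_ballNormSq_id_le {d : ℕ} {r e : ℝ} (hr : 0 ≤ r) (he : 0 ≤ e) :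
    |e / (1 + r ^ 2) * ballNormSq (ContinuousLinearMap.id ℝ (Vec d)) r| ≤ e := by
  have h1 : ballNormSq (ContinuousLinearMap.id ℝ (Vec d)) r ≤ 1 + r ^ 2 := by
    refine csSup_le (Set.Nonempty.image _ ⟨0, Metric.mem_closedBall_self hr⟩) ?_
    rintro _ ⟨v, hv, rfl⟩
    simp only [ContinuousLinearMap.id_apply, real_inner_self_eq_norm_sq]
    have := pow_le_pow_left₀ (norm_nonneg v) (mem_closedBall_zero_iff.1 hv) 2
    linarith
  have h0 : 0 ≤ ballNormSq (ContinuousLinearMap.id ℝ (Vec d)) r := by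
    refine Real.sSup_nonneg ?_
    rintro _ ⟨v, hv, rfl⟩
    exact real_inner_self_nonneg
  rw [abs_of_nonneg (by positivity), div_mul_eq_mul_div, div_le_iff₀ (by positivity)]
  gcongr

/-! ### Asymptotics of the exponential family -/

section Sequence

variable {Ω : ℕ → Type*} [∀ n, MeasurableSpace (Ω n)] {P : ∀ n, Measure (Ω n)}
  [∀ n, IsProbabilityMeasure (P n)] {d : ℕ → ℕ} {m : ∀ n, ExpModel (d n)}
  {X : ∀ n, Fin n → Ω n → Vec (d n)} {c₀ p : ℝ}

lemma eventually_isRegular {A q : ℝ} (hq : 0 < q) (hc₀ : 0 < c₀)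
    (hd : Tendsto d atTop atTop)
    (hcanonical : ∀ n : ℕ, 1 ≤ n → (m n).IsCanonical)
    (hneighbourhood : NeighbourhoodCondition m) (hmoment : MomentCondition m c₀ p)
    (hprior : PriorCondition m c₀ p)
    (hA : ∀ᶠ n : ℕ in atTop, ∀ θ ∈ (m n).paramSet,
      (m n).prior θ ≤ (m n).prior (m n).trueParam * Real.exp (A * d n)) :
    ∀ᶠ n in atTop, (m n).IsRegular n A (c₀ + (q ^ 2) ^ p) q := by
  obtain ⟨V, hV, hlip⟩ := hprior.lipschitz
  have hq2 : 0 < q ^ 2 := by positivity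
  filter_upwards [eventually_ge_atTop 1, hd.eventually_ge_atTop 1, hneighbourhood _ hq2, hA]
    with n hn hdn hball hAn
  refine ⟨hcanonical n hn, hprior.proper n hn, hdn, hn, by positivity, hq.le,
    (hmoment _ hq2 n hn).1.le, hball, hprior.pos_at_true n hn, hAn, fun θ hθ hθq => ?_⟩
  obtain ⟨h1, h2⟩ := hlip _ hq2 n hn θ hθ hθq
  refine ⟨h1, h2.trans ?_⟩
  gcongr
  exact (hV _ hq2).le

/-- For each fixed `δ` the localized likelihood is nearly normal, up to the error `δ`, with
probability tending to one. -/
lemma withProb_locallyGaussian {A C : ℝ} (hC : 8 ≤ C) (hAC : |A| + 1 ≤ C ^ 2 / 8) (hc₀ : 0 < c₀)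
    (hd : Tendsto d atTop atTop)
    (hcanonical : ∀ n : ℕ, 1 ≤ n → (m n).IsCanonical)
    (hsample : ∀ n : ℕ, 1 ≤ n → (m n).IsSample (P n) (X n))
    (hneighbourhood : NeighbourhoodCondition m) (hmoment : MomentCondition m c₀ p)
    (hprior : PriorCondition m c₀ p)
    (hA : ∀ᶠ n : ℕ in atTop, ∀ θ ∈ (m n).paramSet,
      (m n).prior θ ≤ (m n).prior (m n).trueParam * Real.exp (A * d n))
    (hrate : Tendsto (fun n : ℕ => (d n : ℝ) ^ 3 / (n : ℝ)) atTop (𝓝 0))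
    {δ : ℝ} (hδ : 0 < δ) (hδ4 : δ ≤ 1 / 4) :
    WithProbTendingToOne P fun n => {ω | LocallyGaussian ((m n).localSpace fun i => X n i ω)
      ((m n).localLikelihood fun i => X n i ω) (C * Real.sqrt (d n)) δ} := by
  refine withProbTendingToOne_of_tight
    (S := fun a n => {ω | ‖(m n).score fun i => X n i ω‖ ^ 2 ≤ a * d n}) (fun a ha => ?_)
    fun a ha => ?_
  · filter_upwards [eventually_ge_atTop 1, hd.eventually_ge_atTop 1] with n hn hdn
    exact (hsample n hn).prob_score_large_le (hcanonical n hn) hn hdn ha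
  · have hq : 0 < C + Real.sqrt a := by positivity
    have hsqrt : Tendsto (fun n : ℕ => ExpModel.approxConst
        (c₀ + ((C + Real.sqrt a) ^ 2) ^ p) (C + Real.sqrt a) *
          Real.sqrt ((d n : ℝ) ^ 3 / (n : ℝ))) atTop (𝓝 0) := by
      simpa using ((Real.continuous_sqrt.tendsto 0).comp hrate).const_mul
        (ExpModel.approxConst (c₀ + ((C + Real.sqrt a) ^ 2) ^ p) (C + Real.sqrt a))
    have hexp : Tendsto (fun n : ℕ => Real.exp (1 - d n)) atTop (𝓝 0) :=
      Real.tendsto_exp_atBot.comp (tendsto_atBot_add_const_left atTop 1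
        (tendsto_neg_atTop_atBot.comp (tendsto_natCast_atTop_atTop.comp hd)))
    filter_upwards [eventually_isRegular hq hc₀ hd hcanonical hneighbourhood hmoment hprior hA,
      hsqrt.eventually_le_const hδ, hexp.eventually_le_const hδ] with n h1 h2 h3 ω hω
    exact h1.locallyGaussian hC hAC hω le_rfl h2 h3 hδ4

end Sequence

end

theorem theorem4 {Ω : ℕ → Type*} [∀ n, MeasurableSpace (Ω n)]
    (P : ∀ n, Measure (Ω n)) [∀ n, IsProbabilityMeasure (P n)]
    (d : ℕ → ℕ) (m : ∀ n, ExpModel (d n)) (X : ∀ n, Fin n → Ω n → Vec (d n))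
    (c₀ p : ℝ) (hc₀ : 0 < c₀) (hp : 0 < p)
    (hd : Tendsto d atTop atTop)
    (hcanonical : ∀ n : ℕ, 1 ≤ n → (m n).IsCanonical)
    (hsample : ∀ n : ℕ, 1 ≤ n → (m n).IsSample (P n) (X n))
    (hneighbourhood : NeighbourhoodCondition m)
    (hmoment : MomentCondition m c₀ p)
    (hprior : PriorCondition m c₀ p)
    (hrate : Tendsto (fun n : ℕ => (d n : ℝ) ^ 3 / (n : ℝ)) atTop (𝓝 0)) :
    ∃ C : ℝ, 1 < C ∧
      CLTConditions P
        (fun n ω => (m n).score (fun i => X n i ω))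
        (fun n ω => (m n).localSpace (fun i => X n i ω))
        (fun n ω => (m n).localLikelihood (fun i => X n i ω))
        (fun n => ContinuousLinearMap.id ℝ (Vec (d n)))
        (fun n => C * Real.sqrt (d n)) ∧
      AsymptoticallyNormal P
        (fun n ω => (m n).localSpace (fun i => X n i ω))
        (fun n ω => (m n).localLikelihood (fun i => X n i ω))
        (fun n => ContinuousLinearMap.id ℝ (Vec (d n))) ∧
      ∃ B : ℝ, 0 < B ∧
        WithProbTendingToOne P (fun n => {ω |
          MixesFromWarmStart
            (posteriorDensity ((m n).localSpace (fun i => X n i ω))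
              ((m n).localLikelihood (fun i => X n i ω)))
            (C * Real.sqrt (d n))
            (walkScale (ContinuousLinearMap.id ℝ (Vec (d n))) (C * Real.sqrt (d n))) B ∧
          MixesFromAnyPoint
            (posteriorDensity ((m n).localSpace (fun i => X n i ω))
              ((m n).localLikelihood (fun i => X n i ω)))
            (C * Real.sqrt (d n))
            (walkScale (ContinuousLinearMap.id ℝ (Vec (d n))) (C * Real.sqrt (d n))) B}) := by
  obtain ⟨A, hA⟩ := hprior.upper
  -- the radius is large enough for the local likelihood to absorb the growth `exp (A d)` of the
  -- prior off the ball
  set C : ℝ := 8 * (|A| + 1) with hCdef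
  have hA0 := abs_nonneg A
  have hC : 8 ≤ C := by linarith
  have hAC : |A| + 1 ≤ C ^ 2 / 8 := by rw [hCdef]; nlinarith
  have hLG : ∀ δ : ℝ, 0 < δ → δ ≤ 1 / 4 → WithProbTendingToOne P fun n =>
      {ω | LocallyGaussian ((m n).localSpace fun i => X n i ω)
        ((m n).localLikelihood fun i => X n i ω) (C * Real.sqrt (d n)) δ} := fun δ hδ hδ4 =>
    withProb_locallyGaussian hC hAC hc₀ hd hcanonical hsample hneighbourhood hmoment hprior hA
      hrate hδ hδ4
  have h14 := hLG (1 / 4) (by norm_num) le_rfl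
  refine ⟨C, by linarith, ⟨?_, ?_⟩, ?_, 12800 * Real.exp 5 * C ^ 2 * (20 * C ^ 2),
    by positivity, ?_⟩
  · refine ⟨?_, ?_, ⟨1, ?_⟩, ?_, ?_, ?_⟩
    · filter_upwards [eventually_ge_atTop 1] with n hn
      exact (hsample n hn).memLp_score (hcanonical n hn) hn
    · filter_upwards [eventually_ge_atTop 1] with n hn
      exact (hsample n hn).integral_score (hcanonical n hn) hn
    · filter_upwards [eventually_ge_atTop 1] with n hn v
      rw [(hsample n hn).integral_inner_score_sq (hcanonical n hn) hn, one_mul]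
    · exact h14.mono (Eventually.of_forall fun n ω hω => hω.ball_subset)
    · intro δ hδ
      refine (hLG (min (δ / 2) (1 / 4)) (by positivity) (min_le_right _ _)).mono
        (Eventually.of_forall fun n ω hω => ?_)
      have h1 := hω.posterior_ball
      have h2 := min_le_left (δ / 2) (1 / 4)
      exact le_trans (by linarith) h1
    · intro δ hδ
      have hexp : Tendsto (fun n : ℕ => Real.exp (-(d n : ℝ))) atTop (𝓝 0) :=
        Real.tendsto_exp_atBot.comp
          (tendsto_neg_atTop_atBot.comp (tendsto_natCast_atTop_atTop.comp hd))
      filter_upwards [hexp.eventually_le_const hδ] with n hn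
      exact le_trans (by linarith) (integral_normalDensity_ball_ge hC)
  · obtain ⟨e, he0, helim, heP⟩ := exists_vanishing_error (P := P)
      (E := fun n δ => {ω | ∀ x ∈ Metric.closedBall (0 : Vec (d n)) (C * Real.sqrt (d n)),
        0 < (m n).localLikelihood (fun i => X n i ω) x ∧
          |Real.log ((m n).localLikelihood (fun i => X n i ω) x) + ‖x‖ ^ 2 / 2| ≤ δ})
      (fun n δ δ' hδ ω hω x hx => ⟨(hω x hx).1, (hω x hx).2.trans hδ⟩)
      (fun δ hδ => (hLG (min δ (1 / 4)) (by positivity) (min_le_right _ _)).mono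
        (Eventually.of_forall fun n ω hω x hx =>
          ⟨(hω.approx x hx).1, (hω.approx x hx).2.trans (min_le_left _ _)⟩))
    refine ⟨fun n _ => e n,
      fun n _ => (1 / ((n : ℝ) + 1)) / (1 + (C * Real.sqrt (d n)) ^ 2), ?_, ?_⟩
    · refine ⟨fun n u v => rfl, ⟨1, 1, one_pos, fun n v => ?_⟩,
        fun n => ⟨measurable_const, measurable_const⟩, fun n ω => ⟨he0 n, by positivity⟩,
        h14.mono (Eventually.of_forall fun n ω hω => hω.lsc),
        heP.mono (Eventually.of_forall fun n ω hω x hx => ⟨(hω x hx).1, ?_⟩)⟩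
      · rw [ContinuousLinearMap.id_apply, real_inner_self_eq_norm_sq, one_mul]
        exact ⟨le_rfl, le_rfl⟩
      · rw [ContinuousLinearMap.id_apply, real_inner_self_eq_norm_sq]
        have h1 := (hω x hx).2
        have h2 : 0 ≤ (1 / ((n : ℝ) + 1)) / (1 + (C * Real.sqrt (d n)) ^ 2) * ‖x‖ ^ 2 / 2 := by
          positivity
        rw [show Real.log ((m n).localLikelihood (fun i => X n i ω) x) - -(1 / 2) * ‖x‖ ^ 2
          = Real.log ((m n).localLikelihood (fun i => X n i ω) x) + ‖x‖ ^ 2 / 2 by ring]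
        linarith
    · have huniv : ∀ Y : ∀ n, Ω n → ℝ, (∀ δ : ℝ, 0 < δ → ∀ᶠ n in atTop, ∀ ω, |Y n ω| < δ) →
          IsLittleOP P Y := fun Y hY δ hδ =>
        h14.mono ((hY δ hδ).mono fun n hn ω _ => hn ω)
      refine ⟨huniv _ fun δ hδ => ?_, huniv _ fun δ hδ => ?_⟩
      · filter_upwards [helim.eventually_lt_const hδ] with n hn ω
        rwa [abs_of_pos (he0 n)]
      · filter_upwards [(tendsto_one_div_add_atTop_nhds_zero_nat (𝕜 := ℝ)).eventually_lt_const hδ]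
          with n hn ω
        exact (abs_mul_ballNormSq_id_le (by positivity) (by positivity)).trans_lt hn
  · intro δ hδ
    refine (hLG (min (δ / 12) (1 / 4)) (by positivity) (min_le_right _ _)).mono
      (Eventually.of_forall fun n ω hω => ?_)
    refine lt_of_le_of_lt hω.lintegral_abs_sub_normal_le ((ENNReal.ofReal_lt_ofReal_iff hδ).2 ?_)
    have h2 := min_le_left (δ / 12) (1 / 4)
    linarith
  · refine h14.mono ?_
    filter_upwards [hd.eventually_ge_atTop 2] with n hn ω hω
    exact hω.nearGaussian.mixes hn hC
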